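/- **Setting.** A diagram here consists of finitely many Z-spiders with real phases, joined only by Hadamard edges without parallel edges or self-loops, with $m$ inputs and $n$ outputs, each attached (by a plain wire or through a Hadamard) to a spider, distinct inputs to distinct spiders and distinct outputs to distinct spiders. It is *graph-like* if moreover no spider is attached to both an input and an output. Its linear map $[\![D]\!]:(\mathbb C^2)^{\otimes m}\to(\mathbb C^2)^{\otimes n}$ is the contraction of the tensors of its spiders $|0\dots0\rangle\langle0\dots0|+e^{i\alpha}|1\dots1\rangle\langle1\dots1|$ and of the Hadamards; $\propto$ denotes equality up to a non-zero scalar. Its underlying open graph $(G,I,O)$ has the spiders as vertices $V$, the Hadamard edges as edges, and as $I$, $O$ the spiders attached to inputs and outputs. A *focused gFlow* on $(G,I,O)$ is a map $g:V\setminus O\to 2^{V\setminus I}$ and a strict partial order $\prec$ on $V$ such that for all $u\in V\setminus O$: $\mathrm{Odd}(g(u))\cap (V\setminus O)=\{u\}$, and $u\prec v$ for all $v\in g(u)$, where $\mathrm{Odd}(A)$ is the set of vertices with an odd number of neighbours in $A$. Circuits on $n$ qubits are composed of CNOT, CZ, Hadamard, phase ($Z_\alpha=\mathrm{diag}(1,e^{i\alpha})$)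 and SWAP gates. **Extraction procedure.** The *frontier* of a diagram consists of the spiders attached to its outputs, one for each qubit; the other spiders are *unextracted*. The frontier is *prepared* if its spiders are phaseless, pairwise disconnected and attached to the outputs by plain wires. The procedure maintains a diagram followed by an already extracted circuit. It first prepares the frontier by extracting Hadamard, phase and CZ gates. Then, while there are unextracted spiders, it performs rounds: Gauss–Jordan elimination over $\mathbb F_2$, by primitive row operations (each extracting a CNOT), on the rows of the biadjacency matrix between the frontier and the unextracted spiders that belong to non-input frontier spiders; then, for each such row with a single $1$, in the column of $v$ say, disconnecting all other frontier spiders from $v$ by further row operations, and replacing the frontier spider $w$ of the row by $v$, which extracts a Hadamard and the phase of $v$; then extracting the edges between frontier spiders as CZ gates. When only frontier spiders are left, and $m=n$, it extracts the Hadamards on the inputs and SWAP gates for the remaining permutation of the qubits. All choices are fixed, so that this is a deterministic function. **Simplification.** The simplification of a diagram repeats the following steps in any order: (i) local complementation at an interior spider $u$ (one that is attached to no input or output) whose phase is an odd multiple of $\pi/2$, followed by the removal of $u$, the phase of $u$ being subtracted from the phases of its neighbours; (ii) pivoting $G\wedge uv=G\star u\star v\star u$ along an edge between two interior Pauli spiders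 (phases multiples of $\pi$), followed by the removal of $u$ and $v$, the phase of $v$ being added to the neighbours of $u$, the phase of $u$ to the neighbours of $v$, and moreover $\pi$ to the common neighbours; (iii) for an interior Pauli spider $u$ adjacent to a boundary spider $v$, joining $v$ by a Hadamard edge to a new phaseless spider that takes over its input or output, splitting off the Hadamard, the phase of $v$ and the Hadamard of the boundary wire, if any, as single-qubit gates, and pivoting along $uv$ as in (ii). It is complete when there is no interior spider whose phase is an odd multiple of $\pi/2$, no adjacent pair of interior Pauli spiders, and no interior Pauli spider adjacent to a boundary spider. **Theorem.** 1. (Row operations.) Let $D$ be a diagram with prepared frontier, $s\ne t$ two qubits, where the frontier spider of $s$ is not an input. Adding row $s$ of the biadjacency matrix to row $t$ modulo $2$ gives a diagram $D'$ with prepared frontier such that $[\![D]\!]\propto \mathrm{CNOT}_{t,s}\,[\![D']\!]$ (control $t$, target $s$), and if $D$ has a focused gFlow, so does $D'$. 2. (Preparation.) If a diagram has a focused gFlow, then preparing its frontier leaves the unextracted spiders, the total linear map (up to $\propto$) and the existence of a focused gFlow unchanged, and makes the frontier prepared. 3. (Progress.) If a diagram with prepared frontier has a focused gFlow and an unextracted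 spider, then a round of the procedure makes the set of unextracted spiders strictly smaller, and preserves the total linear map (up to $\propto$), the existence of a focused gFlow, and that the frontier is prepared. 4. (Extraction.) For every graph-like diagram $D$ with $n$ inputs and $n$ outputs whose underlying open graph has a focused gFlow, the extraction procedure succeeds and returns a circuit $C$ with $[\![C]\!]\propto[\![D]\!]$. 5. (Simplify and extract.) Let $C$ be any circuit. The graph-like diagram $D_0$ obtained from $C$ (writing the gates as spiders, fusing spiders, cancelling double Hadamards and parallel edges, and giving each input and output a spider of its own) has a focused gFlow and satisfies $[\![D_0]\!]\propto[\![C]\!]$. Every sequence of simplification steps from $D_0$ has at most as many steps as $D_0$ has interior spiders. Every state reached from $D_0$ consists of a graph-like diagram $D'$ with a focused gFlow between circuits $P$ (at the inputs) and $Q$ (at the outputs) of single-qubit gates; no further step is possible if and only if the simplification is complete; and the extraction procedure applied to $D'$ returns a circuit $C'$ such that the composite of $P$, $C'$ and $Q$, in this order, equals $C$ up to a global phase. -/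

import Mathlib

noncomputable section

namespace ZX

/-! ### Quantum circuits -/

/-- Computational basis states of `n` qubits. -/
abbrev Bits (n : ℕ) := Fin n → Bool

/-- The entry `⟨b|H|a⟩ = (1/√2) (-1)^{ab}` of the Hadamard matrix. -/
def hadEntry (a b : Bool) : ℂ :=
  ((1 / Real.sqrt 2 : ℝ) : ℂ) * (if a && b then -1 else 1)

/-- The gates on `n` qubits: `cnot c t` (control `c`, target `t`), `cz`, Hadamard,
the phase gate `Z_α = diag(1, e^{iα})`, and `swap`. -/
inductive Gate (n : ℕ) where
  | cnot (c t : Fin n) (h : c ≠ t) : Gate n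
  | cz (a b : Fin n) (h : a ≠ b) : Gate n
  | had (q : Fin n) : Gate n
  | phase (α : ℝ) (q : Fin n) : Gate n
  | swap (a b : Fin n) (h : a ≠ b) : Gate n

/-- The unitary of a gate; rows are indexed by output states, columns by input states. -/
def Gate.toMatrix {n : ℕ} : Gate n → Matrix (Bits n) (Bits n) ℂ
  | .cnot c t _ => fun y x => if y = Function.update x t (xor (x t) (x c)) then 1 else 0
  | .cz a b _ => Matrix.diagonal fun x => if x a && x b then -1 else 1
  | .had q => fun y x => if ∀ k, k ≠ q → y k = x k then hadEntry (x q) (y q) else 0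
  | .phase α q => Matrix.diagonal fun x => if x q then Complex.exp (α * Complex.I) else 1
  | .swap a b _ => fun y x => if y = x ∘ Equiv.swap a b then 1 else 0

/-- Hadamard and phase gates. -/
def Gate.IsSingleQubit {n : ℕ} : Gate n → Prop
  | .had _ => True
  | .phase _ _ => True
  | _ => False

/-- A circuit is a list of gates; the head of the list is applied first. -/
abbrev Circuit (n : ℕ) := List (Gate n)

/-- The unitary of a circuit. -/
def Circuit.eval {n : ℕ} : Circuit n → Matrix (Bits n) (Bits n) ℂ
  | [] => 1
  | g :: C => Circuit.eval C * g.toMatrix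

/-- Equality up to a non-zero scalar. -/
def EqUpToScalar {m n : ℕ} (A B : Matrix (Bits n) (Bits m) ℂ) : Prop :=
  ∃ z : ℂ, z ≠ 0 ∧ A = z • B

/-- Equality up to a global phase. -/
def EqUpToPhase {m n : ℕ} (A B : Matrix (Bits n) (Bits m) ℂ) : Prop :=
  ∃ θ : ℝ, A = Complex.exp (θ * Complex.I) • B

/-! ### Open graphs and focused gFlow -/

/-- An open graph, with vertices labelled by natural numbers. -/
structure OpenGraph where
  verts : Finset ℕ
  graph : SimpleGraph ℕ
  inputs : Finset ℕ
  outputs : Finset ℕ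

open scoped Classical in
/-- The odd neighbourhood of `A`: the vertices with an odd number of neighbours in `A`. -/
def OpenGraph.oddNbhd (G : OpenGraph) (A : Finset ℕ) : Finset ℕ :=
  G.verts.filter fun v => Odd (A.filter fun w => G.graph.Adj v w).card

/-- `(g, prec)` is a focused gFlow on `G`. The order is strict, so that `u ∉ g u`;
only its restriction to the vertices of `G` and the values of `g` on the
non-outputs matter. -/
structure OpenGraph.IsFocusedGFlow (G : OpenGraph) (g : ℕ → Finset ℕ)
    (prec : ℕ → ℕ → Prop) : Prop where
  irrefl : ∀ u, ¬ prec u u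
  trans : ∀ u v w, prec u v → prec v w → prec u w
  subset : ∀ u ∈ G.verts \ G.outputs, g u ⊆ G.verts \ G.inputs
  odd : ∀ u ∈ G.verts \ G.outputs, G.oddNbhd (g u) ∩ (G.verts \ G.outputs) = {u}
  lt : ∀ u ∈ G.verts \ G.outputs, ∀ v ∈ g u, prec u v

/-- `G` admits a focused gFlow. -/
def OpenGraph.HasFocusedGFlow (G : OpenGraph) : Prop :=
  ∃ (g : ℕ → Finset ℕ) (prec : ℕ → ℕ → Prop), G.IsFocusedGFlow g prec

/-! ### ZX-diagrams made of Z-spiders and Hadamard edges -/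

/-- The data of a ZX-diagram with `m` inputs and `n` outputs all of whose spiders are Z-spiders,
connected to each other only by Hadamard edges, without parallel edges or self-loops
(the edges form a simple graph). The spider `v ∈ verts` has phase `phase v`.
Input `i` is attached to the spider `input i`, through a Hadamard if `inputHad i = true`
and by a plain wire otherwise; likewise for outputs. -/
structure Diagram (m n : ℕ) where
  verts : Finset ℕ
  graph : SimpleGraph ℕ
  phase : ℕ → ℝ
  input : Fin m → ℕ
  output : Fin n → ℕ
  inputHad : Fin m → Bool
  outputHad : Fin n → Bool

namespace Diagram

variable {m n : ℕ}

/-- Edges join spiders, every input and every output is attached to a spider, and no two inputs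
(no two outputs) are attached to the same spider. -/
structure WellFormed (D : Diagram m n) : Prop where
  adj_mem : ∀ u v, D.graph.Adj u v → u ∈ D.verts
  input_mem : ∀ i, D.input i ∈ D.verts
  output_mem : ∀ j, D.output j ∈ D.verts
  input_inj : Function.Injective D.input
  output_inj : Function.Injective D.output

/-- Graph-like diagrams: moreover, no spider is attached to both an input and an output, so that
every spider is attached to at most one input or output. -/
structure IsGraphLike (D : Diagram m n) : Prop extends D.WellFormed where
  disjoint : ∀ i j, D.input i ≠ D.output j

/-- The underlying open graph. -/
def openGraph (D : Diagram m n) : OpenGraph where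
  verts := D.verts
  graph := D.graph
  inputs := Finset.univ.image D.input
  outputs := Finset.univ.image D.output

/-- The underlying open graph admits a focused gFlow. -/
def HasFocusedGFlow (D : Diagram m n) : Prop := D.openGraph.HasFocusedGFlow

/-- The matrix entry of a boundary wire: a Hadamard or the identity. -/
def wireEntry (h : Bool) (a b : Bool) : ℂ :=
  if h then hadEntry a b else if a = b then 1 else 0

open scoped Classical in
/-- The edges between spiders, each listed once. -/
def edges (D : Diagram m n) : Finset (ℕ × ℕ) :=
  (D.verts ×ˢ D.verts).filter fun e => e.1 < e.2 ∧ D.graph.Adj e.1 e.2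

/-- The linear map of a diagram, as a matrix (rows: outputs, columns: inputs), obtained by
contracting the tensors of its spiders `|0…0⟩⟨0…0| + e^{iα} |1…1⟩⟨1…1|`, of its Hadamard edges and
of its boundary wires. Since Z-spiders force all their legs to carry the same bit, this is a sum over
assignments of a bit to each spider; `s` is the set of spiders that carry the bit `1`. -/
def eval (D : Diagram m n) : Matrix (Bits n) (Bits m) ℂ := fun y x =>
  ∑ s ∈ D.verts.powerset,
    (∏ v ∈ D.verts, if v ∈ s then Complex.exp (D.phase v * Complex.I) else 1) *
    (∏ e ∈ D.edges, hadEntry (decide (e.1 ∈ s)) (decide (e.2 ∈ s))) *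
    (∏ i, wireEntry (D.inputHad i) (x i) (decide (D.input i ∈ s))) *
    (∏ j, wireEntry (D.outputHad j) (decide (D.output j ∈ s)) (y j))

/-! ### The frontier

During extraction the diagram shrinks; the spiders to which its current outputs are attached form
the frontier, one for each qubit. -/

/-- The spiders that are not on the frontier, i.e. that have not been extracted yet. -/
def past (D : Diagram m n) : Finset ℕ := D.verts \ Finset.univ.image D.output

open scoped Classical in
/-- Row `q` of the biadjacency matrix between the frontier and the past, as the set of its
non-zero columns. -/
def row (D : Diagram m n) (q : Fin n) : Finset ℕ :=
  D.past.filter fun v => D.graph.Adj (D.output q) v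

/-- The biadjacency matrix over `𝔽₂` between the frontier and the past. -/
def biadj (D : Diagram m n) : Matrix (Fin n) ℕ (ZMod 2) := fun q v =>
  if v ∈ D.row q then 1 else 0

/-- The frontier spiders are phaseless, attached to the outputs by plain wires, and pairwise
disconnected. -/
structure Prepared (D : Diagram m n) : Prop where
  plain : ∀ q, D.outputHad q = false
  phaseless : ∀ q, D.phase (D.output q) = 0
  disconnected : ∀ p q, ¬ D.graph.Adj (D.output p) (D.output q)

/-- The qubits whose frontier spider is not an input of the diagram. -/
def freeRows (D : Diagram m n) : List (Fin n) :=
  (List.finRange n).filter fun q => ∀ i, D.input i ≠ D.output q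

/-- Add row `src` of the biadjacency matrix to row `dst`, modulo 2. -/
def addRow (D : Diagram m n) (src dst : Fin n) : Diagram m n :=
  { D with
    graph := symmDiff D.graph
      (SimpleGraph.fromRel fun u v => u = D.output dst ∧ v ∈ D.row src) }

end Diagram

/-! ### Circuit extraction -/

/-- A state of the extraction: the diagram that is left, followed by the circuit extracted so far. -/
structure ExtractState (m n : ℕ) where
  diagram : Diagram m n
  circuit : Circuit n

namespace ExtractState

variable {m n : ℕ}

/-- The linear map of a state. -/
def eval (S : ExtractState m n) : Matrix (Bits n) (Bits m) ℂ :=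
  S.circuit.eval * S.diagram.eval

/-- Extract a Hadamard on output `q`. -/
def unfuseHad (S : ExtractState m n) (q : Fin n) : ExtractState m n :=
  if S.diagram.outputHad q then
    ⟨{ S.diagram with outputHad := Function.update S.diagram.outputHad q false },
      .had q :: S.circuit⟩
  else S

open scoped Classical in
/-- Extract the phase of the frontier spider of qubit `q`. -/
def unfusePhase (S : ExtractState m n) (q : Fin n) : ExtractState m n :=
  if S.diagram.phase (S.diagram.output q) ≠ 0 then
    ⟨{ S.diagram with phase := Function.update S.diagram.phase (S.diagram.output q) 0 },
      .phase (S.diagram.phase (S.diagram.output q)) q :: S.circuit⟩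
  else S

open scoped Classical in
/-- Extract an edge between two frontier spiders as a CZ gate. -/
def unfuseCZ (S : ExtractState m n) (p : Fin n × Fin n) : ExtractState m n :=
  if h : p.1 ≠ p.2 ∧ S.diagram.graph.Adj (S.diagram.output p.1) (S.diagram.output p.2) then
    ⟨{ S.diagram with
        graph := S.diagram.graph.deleteEdges
          {s(S.diagram.output p.1, S.diagram.output p.2)} },
      .cz p.1 p.2 h.1 :: S.circuit⟩
  else S

/-- Extract all edges between frontier spiders. -/
def unfuseAllCZ (S : ExtractState m n) : ExtractState m n :=
  (List.finRange n ×ˢ List.finRange n).foldl unfuseCZ S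

/-- Extract the Hadamards, phases and edges of the initial frontier. -/
def prepare (S : ExtractState m n) : ExtractState m n :=
  ((List.finRange n).foldl (fun S q => (S.unfuseHad q).unfusePhase q) S).unfuseAllCZ

/-- Add row `src` to row `dst`, extracting a CNOT with control `dst` and target `src`. -/
def addRow (S : ExtractState m n) (src dst : Fin n) : ExtractState m n :=
  if h : dst ≠ src then ⟨S.diagram.addRow src dst, .cnot dst src h :: S.circuit⟩ else S

/-- Add row `q` to all other rows in the list `rows` that have a `1` in column `v`. -/
def clearColumn (S : ExtractState m n) (q : Fin n) (v : ℕ) (rows : List (Fin n)) :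
    ExtractState m n :=
  rows.foldl (fun S r => if r ≠ q ∧ v ∈ S.diagram.row r then S.addRow q r else S) S

/-- One pivoting step: if row `q` is non-zero, use its first non-zero column as pivot and clear
that column in all other non-input rows. -/
def pivotRow (S : ExtractState m n) (q : Fin n) : ExtractState m n :=
  if h : (S.diagram.row q).Nonempty then
    S.clearColumn q ((S.diagram.row q).min' h) S.diagram.freeRows
  else S

/-- Gauss-Jordan elimination on the non-input rows of the biadjacency matrix, by primitive row
operations. -/
def gaussJordan (S : ExtractState m n) : ExtractState m n :=
  S.diagram.freeRows.foldl pivotRow S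

/-- The non-input rows with exactly one `1`. -/
def readyRows (S : ExtractState m n) : List (Fin n) :=
  S.diagram.freeRows.filter fun q => (S.diagram.row q).card = 1

/-- If the frontier spider of qubit `q` has a single neighbour `v` in the past, disconnect all other
frontier spiders from `v` by row operations. -/
def isolate (S : ExtractState m n) (q : Fin n) : ExtractState m n :=
  if h : (S.diagram.row q).Nonempty then
    S.clearColumn q ((S.diagram.row q).min' h) (List.finRange n)
  else S

/-- Remove the frontier spider of qubit `q`, replace it on the frontier by its neighbour in the
past, and extract a Hadamard gate and then the phase of the new frontier spider. -/
def advance (S : ExtractState m n) (q : Fin n) : ExtractState m n :=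
  if h : (S.diagram.row q).Nonempty then
    unfusePhase
      ⟨{ S.diagram with
          verts := S.diagram.verts.erase (S.diagram.output q)
          graph := S.diagram.graph.deleteIncidenceSet (S.diagram.output q)
          output := Function.update S.diagram.output q ((S.diagram.row q).min' h) },
        .had q :: S.circuit⟩ q
  else S

/-- One round of the extraction: Gauss-Jordan elimination, then moving the frontier onto all the
spiders that have become the unique neighbour of a non-input frontier spider. -/
def updateFrontier (S : ExtractState m n) : ExtractState m n :=
  let T := S.gaussJordan
  let ws := T.readyRows
  (ws.foldl advance (ws.foldl isolate T)).unfuseAllCZ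

/-- At most `k` rounds of the extraction, stopping when no unextracted spider is left. -/
def run : ℕ → ExtractState m n → ExtractState m n
  | 0, S => S
  | k + 1, S => if S.diagram.past = ∅ then S else run k S.updateFrontier

/-- The qubit whose frontier spider is `v`, if there is one. -/
def qubit? (S : ExtractState m n) (v : ℕ) : Option (Fin n) :=
  (List.finRange n).find? fun q => S.diagram.output q = v

/-- Extract a Hadamard on input `i` when the spider of that input is on the frontier. -/
def finishHad (S : ExtractState m n) (i : Fin m) : ExtractState m n :=
  match S.qubit? (S.diagram.input i) with
  | some q =>
    if S.diagram.inputHad i then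
      ⟨{ S.diagram with inputHad := Function.update S.diagram.inputHad i false },
        .had q :: S.circuit⟩
    else S
  | none => S

/-- Extract a SWAP gate that brings the spider of input `i` to qubit `i`. -/
def finishSwap (S : ExtractState n n) (i : Fin n) : ExtractState n n :=
  match S.qubit? (S.diagram.input i) with
  | some q =>
    if h : i ≠ q then
      ⟨{ S.diagram with
          output := S.diagram.output ∘ Equiv.swap i q
          outputHad := S.diagram.outputHad ∘ Equiv.swap i q },
        .swap i q h :: S.circuit⟩
    else S
  | none => S

/-- When only frontier spiders are left: extract the Hadamards on the inputs and the permutation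
of the qubits. -/
def finish (S : ExtractState n n) : ExtractState n n :=
  (List.finRange n).foldl finishSwap ((List.finRange n).foldl finishHad S)

end ExtractState

/-- The circuit extraction procedure. It fails (returns `none`) when some spider could not be
extracted. -/
def extract {n : ℕ} (D : Diagram n n) : Option (Circuit n) :=
  let S := ExtractState.run D.verts.card (ExtractState.prepare ⟨D, []⟩)
  if S.diagram.past = ∅ then some S.finish.circuit else none

/-! ### From circuits to graph-like diagrams -/

namespace Diagram

variable {m n : ℕ}

/-- A label that is not used by any spider. -/
def fresh (D : Diagram m n) : ℕ := D.verts.sup id + 1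

/-- Insert a phaseless spider behind the spider of output `q`, joined to it by a Hadamard edge,
and compensate by a Hadamard on the output wire (two Hadamards cancel). -/
def extendOutput (D : Diagram m n) (q : Fin n) : Diagram m n :=
  { D with
    verts := insert D.fresh D.verts
    graph := D.graph ⊔ SimpleGraph.edge (D.output q) D.fresh
    phase := Function.update D.phase D.fresh 0
    output := Function.update D.output q D.fresh
    outputHad := Function.update D.outputHad q (!D.outputHad q) }

/-- Make the wire of output `q` plain. -/
def plainOutput (D : Diagram m n) (q : Fin n) : Diagram m n :=
  if D.outputHad q then D.extendOutput q else D

/-- `n` parallel wires, each with a phaseless spider. -/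
def wires (n : ℕ) : Diagram n n where
  verts := Finset.range n
  graph := ⊥
  phase := fun _ => 0
  input := fun i => i
  output := fun i => i
  inputHad := fun _ => false
  outputHad := fun _ => false

/-- Compose with a Hadamard gate; two Hadamards in a row cancel. -/
def applyHad (D : Diagram m n) (q : Fin n) : Diagram m n :=
  { D with outputHad := Function.update D.outputHad q (!D.outputHad q) }

/-- Compose with a phase gate; its spider fuses with the last spider on the qubit. -/
def applyPhase (D : Diagram m n) (α : ℝ) (q : Fin n) : Diagram m n :=
  let E := D.plainOutput q
  { E with phase := Function.update E.phase (E.output q) (E.phase (E.output q) + α) }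

/-- Compose with a CZ gate; its two spiders fuse with the last spiders on the qubits, and parallel
Hadamard edges cancel. -/
def applyCZ (D : Diagram m n) (a b : Fin n) : Diagram m n :=
  let E := (D.plainOutput a).plainOutput b
  { E with graph := symmDiff E.graph (SimpleGraph.edge (E.output a) (E.output b)) }

/-- Compose with a gate. The X-spider of a CNOT is a Z-spider surrounded by Hadamards. -/
def applyGate (D : Diagram m n) : Gate n → Diagram m n
  | .cnot c t _ => ((D.applyHad t).applyCZ c t).applyHad t
  | .cz a b _ => D.applyCZ a b
  | .had q => D.applyHad q
  | .phase α q => D.applyPhase α q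
  | .swap a b _ =>
    { D with output := D.output ∘ Equiv.swap a b, outputHad := D.outputHad ∘ Equiv.swap a b }

/-- If the spider of output `q` is also attached to an input, insert one or two phaseless spiders so
that the output has a spider of its own and is attached to it by a plain wire. -/
def separateOutput (D : Diagram m n) (q : Fin n) : Diagram m n :=
  if ∃ i, D.input i = D.output q then
    if D.outputHad q then D.extendOutput q else (D.extendOutput q).extendOutput q
  else D

/-- The graph-like diagram obtained from a circuit. -/
def ofCircuit (C : Circuit n) : Diagram n n :=
  (List.finRange n).foldl separateOutput (C.foldl applyGate (wires n))

end Diagram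

/-! ### Simplification -/

/-- Local complementation of `G` according to `u`. -/
def localComp (G : SimpleGraph ℕ) (u : ℕ) : SimpleGraph ℕ :=
  symmDiff G (SimpleGraph.fromRel fun v w => G.Adj u v ∧ G.Adj u w)

/-- The pivot `G ⋆ u ⋆ v ⋆ u` of `G` along the edge `uv`. -/
def pivot (G : SimpleGraph ℕ) (u v : ℕ) : SimpleGraph ℕ :=
  localComp (localComp (localComp G u) v) u

namespace Diagram

variable {m n : ℕ}

/-- A spider that is attached to no input and no output. -/
def IsInterior (D : Diagram m n) (u : ℕ) : Prop :=
  u ∈ D.verts ∧ (∀ i, D.input i ≠ u) ∧ (∀ j, D.output j ≠ u)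

/-- A spider that is attached to an input or an output. -/
def IsBoundary (D : Diagram m n) (u : ℕ) : Prop :=
  (∃ i, D.input i = u) ∨ (∃ j, D.output j = u)

/-- The phase of `u` is a multiple of `π`. -/
def IsPauli (D : Diagram m n) (u : ℕ) : Prop := ∃ k : ℤ, D.phase u = k * Real.pi

/-- The phase of `u` is an odd multiple of `π / 2`. -/
def IsProperClifford (D : Diagram m n) (u : ℕ) : Prop :=
  ∃ k : ℤ, Odd k ∧ D.phase u = k * (Real.pi / 2)

open scoped Classical in
/-- The number of interior spiders. -/
def interiorCount (D : Diagram m n) : ℕ := (D.verts.filter D.IsInterior).card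

open scoped Classical in
/-- Local complementation at `u`, followed by the removal of `u`; the phase of `u` is subtracted from
the phases of its neighbours. -/
def lcSimp (D : Diagram m n) (u : ℕ) : Diagram m n :=
  { D with
    verts := D.verts.erase u
    graph := (localComp D.graph u).deleteIncidenceSet u
    phase := fun x => if D.graph.Adj u x then D.phase x - D.phase u else D.phase x }

open scoped Classical in
/-- Pivot along `uv`, followed by the removal of `u` and `v`; the phase of `v` is added to the
neighbours of `u`, the phase of `u` to the neighbours of `v`, and moreover `π` to their common
neighbours. -/
def pivotSimp (D : Diagram m n) (u v : ℕ) : Diagram m n :=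
  { D with
    verts := (D.verts.erase u).erase v
    graph := ((pivot D.graph u v).deleteIncidenceSet u).deleteIncidenceSet v
    phase := fun x => D.phase x
      + (if D.graph.Adj u x then D.phase v else 0)
      + (if D.graph.Adj v x then D.phase u else 0)
      + (if D.graph.Adj u x ∧ D.graph.Adj v x then Real.pi else 0) }

/-- The goal of the simplification: no interior proper Clifford spiders, no adjacent interior Pauli
spiders, and no interior Pauli spider adjacent to a boundary spider. -/
structure IsSimplified (D : Diagram m n) : Prop where
  no_properClifford : ∀ u, D.IsInterior u → ¬ D.IsProperClifford u
  no_pauli_pair : ∀ u v, D.IsInterior u → D.IsInterior v → D.IsPauli u → D.IsPauli v →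
    ¬ D.graph.Adj u v
  no_pauli_boundary : ∀ u v, D.IsInterior u → D.IsPauli u → D.IsBoundary v → ¬ D.graph.Adj u v

end Diagram

/-- A state of the simplification: a diagram together with the single-qubit gates that were split off
at its inputs (`pre`) and at its outputs (`post`). -/
structure SimpState (m n : ℕ) where
  pre : Circuit m
  diagram : Diagram m n
  post : Circuit n

namespace SimpState

variable {m n : ℕ}

/-- Make the spider of output `q` a phaseless interior spider: it is joined by a Hadamard edge to a
new phaseless spider, which becomes the spider of output `q`; the Hadamard and the phase gate (and
the Hadamard of the output wire, if any) behind the new spider are split off. -/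
def unfuseOutput (S : SimpState m n) (q : Fin n) : SimpState m n :=
  let D := S.diagram
  { S with
    diagram :=
      { D with
        verts := insert D.fresh D.verts
        graph := D.graph ⊔ SimpleGraph.edge (D.output q) D.fresh
        phase := Function.update (Function.update D.phase (D.output q) 0) D.fresh 0
        output := Function.update D.output q D.fresh
        outputHad := Function.update D.outputHad q false }
    post := [Gate.had q, Gate.phase (D.phase (D.output q)) q]
      ++ (if D.outputHad q then [Gate.had q] else []) ++ S.post }

/-- The same at input `i`. -/
def unfuseInput (S : SimpState m n) (i : Fin m) : SimpState m n :=
  let D := S.diagram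
  { S with
    diagram :=
      { D with
        verts := insert D.fresh D.verts
        graph := D.graph ⊔ SimpleGraph.edge (D.input i) D.fresh
        phase := Function.update (Function.update D.phase (D.input i) 0) D.fresh 0
        input := Function.update D.input i D.fresh
        inputHad := Function.update D.inputHad i false }
    pre := S.pre ++ (if D.inputHad i then [Gate.had i] else [])
      ++ [Gate.phase (D.phase (D.input i)) i, Gate.had i] }

/-- Replace the diagram of a state by its pivot along `uv`. -/
def pivotSimp (S : SimpState m n) (u v : ℕ) : SimpState m n :=
  { S with diagram := S.diagram.pivotSimp u v }

/-- The steps of the simplification. -/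
inductive Step : SimpState m n → SimpState m n → Prop
  | lc (S : SimpState m n) (u : ℕ) (hu : S.diagram.IsInterior u)
      (hc : S.diagram.IsProperClifford u) :
      Step S { S with diagram := S.diagram.lcSimp u }
  | pivot (S : SimpState m n) (u v : ℕ) (hu : S.diagram.IsInterior u)
      (hv : S.diagram.IsInterior v) (pu : S.diagram.IsPauli u) (pv : S.diagram.IsPauli v)
      (huv : S.diagram.graph.Adj u v) :
      Step S (S.pivotSimp u v)
  | pivotOutput (S : SimpState m n) (u : ℕ) (q : Fin n) (hu : S.diagram.IsInterior u)
      (pu : S.diagram.IsPauli u) (huq : S.diagram.graph.Adj u (S.diagram.output q)) :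
      Step S ((S.unfuseOutput q).pivotSimp u (S.diagram.output q))
  | pivotInput (S : SimpState m n) (u : ℕ) (i : Fin m) (hu : S.diagram.IsInterior u)
      (pu : S.diagram.IsPauli u) (hui : S.diagram.graph.Adj u (S.diagram.input i)) :
      Step S ((S.unfuseInput i).pivotSimp u (S.diagram.input i))

/-- The start of the simplification of a diagram. -/
def init (D : Diagram m n) : SimpState m n := ⟨[], D, []⟩

/-- `S` is reached from the diagram `D` by simplification steps. -/
def Reachable (D : Diagram m n) (S : SimpState m n) : Prop :=
  Relation.ReflTransGen Step (init D) S

end SimpState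

end ZX

end

noncomputable section

namespace ZX

/-! ### Equality up to a scalar -/

namespace EqUpToScalar

variable {l m n : ℕ}

/-! Each move is shown separately to preserve the linear map up to a scalar and the existence of a
focused gFlow. A counting argument then gives progress.

Linear maps. A Z-spider forces one bit on all its legs, so a diagram is a sum over the set `s` of
spiders that carry the bit 1. Leaving out the factors 1/√2 of the Hadamard edges, which do not
depend on `s`, gives `contraction`. Its summand is a product of phases, boundary wires and the sign
(-1)^k, with k the number of edges inside `s` (`edgeSign`). Every rewrite is an identity between
such sums. A plain output wire identifies the bit of its spider with the output bit, so phases and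
edges on the frontier are phase and CZ gates. Inserting a spider behind an output is H² = 1
(`attach_eval`). A row addition is the involution that toggles the source spider whenever the
destination spider carries 1 (`contraction_addRow`). Local complementation and pivoting sum out the
bits of the removed spiders (`edgeSign_localComp`, `edgeSign_pivot`).

gFlow. Over 𝔽₂ a focused gFlow assigns to each non-output `u` a vector `k u`, supported off the
inputs, that the adjacency matrix maps to the unit vector of `u` on the non-outputs. A rank must
increase from `u` to the non-outputs in its support. Preservation is then linear algebra: one writes
down new vectors and computes the parities. Local complementation and a new input spider spoil the
focusing, which `IsFlow.hasFocusedGFlow` restores by adding correction sets of later vertices.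

Progress. For an unextracted `u` of maximal rank, the support of `k u` lies on the non-input
frontier, so some rows of the biadjacency matrix sum to the unit vector of `u`. Among reduced rows
this forces a single row to equal it (`Diagram.exists_card_row_eq_one`). Hence each round removes an
unextracted spider, and the number of spiders bounds the number of rounds. What is left at the end
is a permutation with Hadamards on the inputs.

Simplification. Every step lowers the number of interior spiders; a boundary pivot is an interior
pivot once the boundary spider has been pushed inwards. Since circuits are unitary, the final scalar
is a phase (`EqUpToScalar.eqUpToPhase`). -/

theorem refl (A : Matrix (Bits n) (Bits m) ℂ) : EqUpToScalar A A := ⟨1, one_ne_zero, by simp⟩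

theorem of_eq {A B : Matrix (Bits n) (Bits m) ℂ} (h : A = B) : EqUpToScalar A B := h ▸ refl A

theorem symm {A B : Matrix (Bits n) (Bits m) ℂ} (h : EqUpToScalar A B) : EqUpToScalar B A := by
  obtain ⟨z, hz, rfl⟩ := h
  exact ⟨z⁻¹, inv_ne_zero hz, by rw [smul_smul, inv_mul_cancel₀ hz, one_smul]⟩

theorem trans {A B C : Matrix (Bits n) (Bits m) ℂ} (h : EqUpToScalar A B)
    (h' : EqUpToScalar B C) : EqUpToScalar A C := by
  obtain ⟨z, hz, rfl⟩ := h
  obtain ⟨w, hw, rfl⟩ := h'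
  exact ⟨z * w, mul_ne_zero hz hw, by rw [smul_smul]⟩

theorem mul_left {A B : Matrix (Bits n) (Bits m) ℂ} (M : Matrix (Bits l) (Bits n) ℂ)
    (h : EqUpToScalar A B) : EqUpToScalar (M * A) (M * B) := by
  obtain ⟨z, hz, rfl⟩ := h
  exact ⟨z, hz, by rw [Matrix.mul_smul]⟩

theorem mul_right {A B : Matrix (Bits n) (Bits m) ℂ} (M : Matrix (Bits m) (Bits l) ℂ)
    (h : EqUpToScalar A B) : EqUpToScalar (A * M) (B * M) := by
  obtain ⟨z, hz, rfl⟩ := h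
  exact ⟨z, hz, by rw [Matrix.smul_mul]⟩

theorem transpose {A B : Matrix (Bits n) (Bits m) ℂ} (h : EqUpToScalar A B) :
    EqUpToScalar A.transpose B.transpose := by
  obtain ⟨z, hz, rfl⟩ := h
  exact ⟨z, hz, by rw [Matrix.transpose_smul]⟩

end EqUpToScalar

/-! ### Gates -/

theorem hadEntry_comm (a b : Bool) : hadEntry a b = hadEntry b a := by
  cases a <;> cases b <;> rfl

theorem inv_sqrt_two_mul_self :
    ((1 / Real.sqrt 2 : ℝ) : ℂ) * ((1 / Real.sqrt 2 : ℝ) : ℂ) = 1 / 2 := by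
  rw [← Complex.ofReal_mul, div_mul_div_comm, Real.mul_self_sqrt (by norm_num)]
  norm_num

theorem inv_sqrt_two_ne_zero : ((1 / Real.sqrt 2 : ℝ) : ℂ) ≠ 0 := by
  intro h
  have := inv_sqrt_two_mul_self
  rw [h] at this
  norm_num at this

theorem sum_hadEntry_mul_hadEntry (a b : Bool) :
    ∑ k, hadEntry k b * hadEntry a k = if a = b then 1 else 0 := by
  have h := inv_sqrt_two_mul_self
  cases a <;> cases b <;> simp only [hadEntry, Fintype.sum_bool] <;> simp <;>
    (try simp at h) <;> (try rw [h]) <;> norm_num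

theorem Diagram.wireEntry_comm (h a b : Bool) :
    Diagram.wireEntry h a b = Diagram.wireEntry h b a := by
  unfold Diagram.wireEntry
  rw [hadEntry_comm]
  simp only [eq_comm]

/-- This is why a boundary wire needs only a Boolean: a Hadamard composed with it toggles the flag,
since H² = 1, and no scalar appears. -/
theorem sum_hadEntry_mul_wireEntry (h a b : Bool) :
    ∑ k, hadEntry k b * Diagram.wireEntry h a k = Diagram.wireEntry (!h) a b := by
  cases h
  · simp [Diagram.wireEntry, hadEntry_comm]
  · simpa [Diagram.wireEntry] using sum_hadEntry_mul_hadEntry a b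

variable {l m n : ℕ}

/-- Only the two basis states that agree with `y` away from `q` contribute. This and the formulas
for the other gates allow all later comparisons to be made entry by entry. -/
theorem Gate.had_mul_apply (q : Fin n) (M : Matrix (Bits n) (Bits m) ℂ) (y : Bits n)
    (x : Bits m) :
    ((Gate.had q).toMatrix * M) y x =
      ∑ b, hadEntry b (y q) * M (Function.update y q b) x := by
  rw [Matrix.mul_apply]
  symm
  refine Finset.sum_of_injOn (fun b => Function.update y q b) ?_ ?_ ?_ ?_
  · intro a _ b _ h
    exact Function.update_injective _ _ h
  · intro a _
    simp
  · intro z _ hz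
    simp only [Gate.toMatrix]
    rw [if_neg, zero_mul]
    intro h
    refine hz ⟨z q, by simp, ?_⟩
    ext k
    by_cases hk : k = q
    · subst hk; simp
    · simp [hk, h k hk]
  · intro b _
    simp only [Gate.toMatrix]
    rw [if_pos]
    · simp
    · intro k hk
      simp [hk]

theorem Gate.phase_mul_apply (α : ℝ) (q : Fin n) (M : Matrix (Bits n) (Bits m) ℂ) (y : Bits n)
    (x : Bits m) :
    ((Gate.phase α q).toMatrix * M) y x =
      (if y q then Complex.exp (α * Complex.I) else 1) * M y x := by
  simp [Gate.toMatrix, Matrix.diagonal_mul]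

theorem Gate.cz_mul_apply (a b : Fin n) (h : a ≠ b) (M : Matrix (Bits n) (Bits m) ℂ) (y : Bits n)
    (x : Bits m) :
    ((Gate.cz a b h).toMatrix * M) y x = (if y a && y b then -1 else 1) * M y x := by
  simp [Gate.toMatrix, Matrix.diagonal_mul]

theorem Gate.cnot_mul_apply (c t : Fin n) (h : c ≠ t) (M : Matrix (Bits n) (Bits m) ℂ)
    (y : Bits n) (x : Bits m) :
    ((Gate.cnot c t h).toMatrix * M) y x = M (Function.update y t (xor (y t) (y c))) x := by
  rw [Matrix.mul_apply, Finset.sum_eq_single (Function.update y t (xor (y t) (y c)))]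
  · simp [Gate.toMatrix, h, Function.update_of_ne]
  · intro z _ hz
    simp only [Gate.toMatrix]
    rw [if_neg, zero_mul]
    rintro rfl
    apply hz
    simp [h]
  · simp

theorem Gate.swap_mul_apply (a b : Fin n) (h : a ≠ b) (M : Matrix (Bits n) (Bits m) ℂ)
    (y : Bits n) (x : Bits m) :
    ((Gate.swap a b h).toMatrix * M) y x = M (y ∘ Equiv.swap a b) x := by
  rw [Matrix.mul_apply, Finset.sum_eq_single (y ∘ Equiv.swap a b)]
  · simp [Gate.toMatrix, Function.comp_assoc, ← Equiv.coe_trans]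
  · intro z _ hz
    simp only [Gate.toMatrix]
    rw [if_neg, zero_mul]
    rintro rfl
    apply hz
    simp [Function.comp_assoc, ← Equiv.coe_trans]
  · simp

theorem Gate.had_mul_had (q : Fin n) :
    (Gate.had q).toMatrix * (Gate.had q).toMatrix = 1 := by
  ext y x
  rw [Gate.had_mul_apply]
  simp only [Gate.toMatrix, Function.update_self]
  by_cases h : ∀ k, k ≠ q → y k = x k
  · have h' : ∀ b, ∀ k, k ≠ q → Function.update y q b k = x k := fun b k hk => by
      rw [Function.update_of_ne hk, h k hk]
    simp only [if_pos (h' _), sum_hadEntry_mul_hadEntry, Matrix.one_apply]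
    congr 1
    rw [eq_iff_iff]
    constructor
    · intro hq
      ext k
      by_cases hk : k = q
      · rw [hk, hq]
      · exact h k hk
    · rintro rfl; rfl
  · have h' : ∀ b, ¬ ∀ k, k ≠ q → Function.update y q b k = x k := fun b hb => h fun k hk => by
      rw [← hb k hk, Function.update_of_ne hk]
    simp only [if_neg (h' _), mul_zero, Finset.sum_const_zero]
    rw [Matrix.one_apply_ne]
    rintro rfl
    exact h fun _ _ => rfl

theorem Gate.cnot_eq (c t : Fin n) (h : c ≠ t) :
    (Gate.cnot c t h).toMatrix =
      (Gate.had t).toMatrix * ((Gate.cz c t h).toMatrix * (Gate.had t).toMatrix) := by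
  ext y x
  -- Writing the identity to the right of the CNOT as H² on the target turns both sides into sums
  -- over the bit of qubit `t`, which agree term by term.
  rw [← Matrix.mul_one (Gate.cnot c t h).toMatrix, Gate.cnot_mul_apply, ← Gate.had_mul_had t]
  simp only [Gate.had_mul_apply, Gate.cz_mul_apply, Function.update_self, Function.update_of_ne h]
  refine Finset.sum_congr rfl fun b _ => ?_
  rw [← mul_assoc]
  congr 1
  · cases y t <;> cases y c <;> cases b <;> simp [hadEntry]
  · simp [Gate.toMatrix]

/-! ### Signs of graph states -/

open scoped Classical in
/-- The sign of the product of the CZ gates that join `u` to its neighbours in `s`. -/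
def linkSign (G : SimpleGraph ℕ) (u : ℕ) (s : Finset ℕ) : ℂ :=
  ∏ v ∈ s, if G.Adj u v then -1 else 1

open scoped Classical in
/-- The sign `(-1)^k`, where `k` is the number of edges inside `s`. -/
def edgeSign (G : SimpleGraph ℕ) (s : Finset ℕ) : ℂ :=
  ∏ u ∈ s, ∏ v ∈ s, if u < v ∧ G.Adj u v then -1 else 1

theorem linkSign_insert {G : SimpleGraph ℕ} {u v : ℕ} {s : Finset ℕ} (hv : v ∉ s)
    [Decidable (G.Adj u v)] :
    linkSign G u (insert v s) = (if G.Adj u v then -1 else 1) * linkSign G u s := by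
  classical
  unfold linkSign
  rw [Finset.prod_insert hv]
  congr

@[simp] theorem linkSign_empty (G : SimpleGraph ℕ) (u : ℕ) : linkSign G u ∅ = 1 := by
  simp [linkSign]

@[simp] theorem edgeSign_empty (G : SimpleGraph ℕ) : edgeSign G ∅ = 1 := by
  simp [edgeSign]

theorem linkSign_congr {G H : SimpleGraph ℕ} {u v : ℕ} {s : Finset ℕ}
    (h : ∀ w ∈ s, (G.Adj u w ↔ H.Adj v w)) : linkSign G u s = linkSign H v s := by
  classical
  unfold linkSign
  exact Finset.prod_congr rfl fun w hw => if_congr (h w hw) rfl rfl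

theorem edgeSign_congr {G H : SimpleGraph ℕ} {s : Finset ℕ}
    (h : ∀ u ∈ s, ∀ v ∈ s, (G.Adj u v ↔ H.Adj u v)) : edgeSign G s = edgeSign H s := by
  classical
  unfold edgeSign
  exact Finset.prod_congr rfl fun u hu => Finset.prod_congr rfl fun v hv =>
    if_congr (and_congr Iff.rfl (h u hu v hv)) rfl rfl

theorem linkSign_mul_self (G : SimpleGraph ℕ) (u : ℕ) (s : Finset ℕ) :
    linkSign G u s * linkSign G u s = 1 := by
  classical
  unfold linkSign
  rw [← Finset.prod_mul_distrib]
  refine Finset.prod_eq_one fun v _ => ?_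
  split_ifs <;> norm_num

/-- The condition `u < v` counts every edge once, so exactly one of the two ordered pairs formed by
the new vertex and an old one contributes. Inductions on `s` rest on this recursion. -/
theorem edgeSign_insert {G : SimpleGraph ℕ} {u : ℕ} {s : Finset ℕ} (hu : u ∉ s) :
    edgeSign G (insert u s) = edgeSign G s * linkSign G u s := by
  classical
  unfold edgeSign linkSign
  rw [Finset.prod_insert hu]
  simp only [Finset.prod_insert hu]
  rw [Finset.prod_mul_distrib, ← mul_assoc, mul_comm]
  congr 1
  rw [if_neg (by simp), one_mul, ← Finset.prod_mul_distrib]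
  refine Finset.prod_congr rfl fun v hv => ?_
  have hne : u ≠ v := fun h => hu (h ▸ hv)
  rw [G.adj_comm v u]
  rcases lt_or_gt_of_ne hne with h | h
  · simp [h, not_lt_of_gt h]
  · simp [h, not_lt_of_gt h]

/-- The number of edges inside `s` is additive modulo 2 under symmetric difference of graphs. This
is the cancellation of parallel Hadamard edges. -/
theorem edgeSign_symmDiff (G H : SimpleGraph ℕ) (s : Finset ℕ) :
    edgeSign (symmDiff G H) s = edgeSign G s * edgeSign H s := by
  classical
  unfold edgeSign
  simp only [← Finset.prod_mul_distrib]
  refine Finset.prod_congr rfl fun u _ => Finset.prod_congr rfl fun v _ => ?_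
  have : (symmDiff G H).Adj u v ↔ (G.Adj u v ∧ ¬ H.Adj u v) ∨ (H.Adj u v ∧ ¬ G.Adj u v) := by
    simp [symmDiff, SimpleGraph.sup_adj, SimpleGraph.sdiff_adj]
  rw [if_congr (and_congr Iff.rfl this) rfl rfl]
  by_cases h : u < v <;> by_cases h1 : G.Adj u v <;> by_cases h2 : H.Adj u v <;> simp [h, h1, h2]

theorem edgeSign_edge {a b : ℕ} (hab : a ≠ b) (s : Finset ℕ) :
    edgeSign (SimpleGraph.edge a b) s = if a ∈ s ∧ b ∈ s then -1 else 1 := by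
  classical
  induction s using Finset.induction_on with
  | empty => simp
  | insert c s hc ih =>
    rw [edgeSign_insert hc, ih]
    have key : linkSign (SimpleGraph.edge a b) c s =
        if (c = a ∧ b ∈ s) ∨ (c = b ∧ a ∈ s) then -1 else 1 := by
      unfold linkSign
      by_cases h : (c = a ∧ b ∈ s) ∨ (c = b ∧ a ∈ s)
      · rw [if_pos h]
        rcases h with ⟨rfl, h⟩ | ⟨rfl, h⟩
        · rw [Finset.prod_eq_single b]
          · simp [SimpleGraph.edge_adj, hab]
          · intro d _ hd
            rw [if_neg]
            simp [SimpleGraph.edge_adj]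
            grind
          · intro h'; exact absurd h h'
        · rw [Finset.prod_eq_single a]
          · simp [SimpleGraph.edge_adj, hab.symm]
          · intro d _ hd
            rw [if_neg]
            simp [SimpleGraph.edge_adj]
            grind
          · intro h'; exact absurd h h'
      · rw [if_neg h]
        refine Finset.prod_eq_one fun d hd => ?_
        rw [if_neg]
        simp [SimpleGraph.edge_adj]
        grind
    rw [key]
    clear ih key
    by_cases h3 : c = a
    · subst h3
      simp [hc, hab, hab.symm]
    · by_cases h4 : c = b
      · subst h4
        simp [hc, hab]
      · simp [Finset.mem_insert, h3, h4, Ne.symm h3, Ne.symm h4]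

/-! ### The contraction of a diagram without normalisation -/

namespace Diagram

variable {m n : ℕ}

/-- The contribution of the spider phases and of the edges. -/
def weight (D : Diagram m n) (s : Finset ℕ) : ℂ :=
  (∏ v ∈ s, Complex.exp (D.phase v * Complex.I)) * edgeSign D.graph s

/-- The contribution of the input wires. -/
def inputAmp (D : Diagram m n) (x : Bits m) (s : Finset ℕ) : ℂ :=
  ∏ i, wireEntry (D.inputHad i) (x i) (decide (D.input i ∈ s))

/-- The contribution of the output wires. -/
def outputAmp (D : Diagram m n) (s : Finset ℕ) (y : Bits n) : ℂ :=
  ∏ j, wireEntry (D.outputHad j) (decide (D.output j ∈ s)) (y j)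

/-- The linear map of a diagram, with the factors `1/√2` of the Hadamard edges left out. -/
def contraction (D : Diagram m n) : Matrix (Bits n) (Bits m) ℂ := fun y x =>
  ∑ s ∈ D.verts.powerset, D.weight s * D.inputAmp x s * D.outputAmp s y

theorem prod_edges_eq_edgeSign (D : Diagram m n) {s : Finset ℕ} (hs : s ⊆ D.verts) :
    (∏ e ∈ D.edges, if e.1 ∈ s ∧ e.2 ∈ s then (-1 : ℂ) else 1) = edgeSign D.graph s := by
  classical
  unfold edgeSign edges
  rw [Finset.prod_filter, ← Finset.prod_product', ← Finset.prod_subset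
    (Finset.product_subset_product hs hs)]
  · refine Finset.prod_congr rfl fun e he => ?_
    rw [Finset.mem_product] at he
    simp [he.1, he.2]
  · intro e _ he
    rw [Finset.mem_product] at he
    simp [he]

/-- Each Hadamard edge contributes the same 1/√2 whatever bits it carries. The number of edges
changes under the rewrites, so equality up to a scalar is tested on contractions. -/
theorem eval_eq_smul_contraction (D : Diagram m n) :
    D.eval = ((1 / Real.sqrt 2 : ℝ) : ℂ) ^ D.edges.card • D.contraction := by
  classical
  ext y x
  rw [Matrix.smul_apply, smul_eq_mul, contraction, Finset.mul_sum]
  refine Finset.sum_congr rfl fun s hs => ?_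
  have hs := Finset.mem_powerset.1 hs
  have h1 : (∏ v ∈ D.verts, if v ∈ s then Complex.exp (D.phase v * Complex.I) else 1) =
      ∏ v ∈ s, Complex.exp (D.phase v * Complex.I) := by
    rw [Finset.prod_ite_mem, Finset.inter_eq_right.2 hs]
  have h2 : (∏ e ∈ D.edges, hadEntry (decide (e.1 ∈ s)) (decide (e.2 ∈ s))) =
      ((1 / Real.sqrt 2 : ℝ) : ℂ) ^ D.edges.card * edgeSign D.graph s := by
    rw [← prod_edges_eq_edgeSign D hs, ← Finset.prod_const, ← Finset.prod_mul_distrib]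
    refine Finset.prod_congr rfl fun e _ => ?_
    simp [hadEntry]
  rw [h1, h2, weight, inputAmp, outputAmp]
  ring

theorem eval_equiv_contraction (D : Diagram m n) : EqUpToScalar D.eval D.contraction :=
  ⟨_, pow_ne_zero _ inv_sqrt_two_ne_zero, D.eval_eq_smul_contraction⟩

theorem eval_equiv_mul {l : ℕ} {D : Diagram m n} {E : Diagram m l}
    {M : Matrix (Bits n) (Bits l) ℂ} (h : EqUpToScalar D.contraction (M * E.contraction)) :
    EqUpToScalar D.eval (M * E.eval) :=
  (D.eval_equiv_contraction.trans h).trans (E.eval_equiv_contraction.symm.mul_left M)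

theorem eval_equiv {D E : Diagram m n} (h : EqUpToScalar D.contraction E.contraction) :
    EqUpToScalar D.eval E.eval :=
  (D.eval_equiv_contraction.trans h).trans E.eval_equiv_contraction.symm

/-- The contribution of the output wires other than `q`. -/
def otherOutputAmp (D : Diagram m n) (q : Fin n) (s : Finset ℕ) (y : Bits n) : ℂ :=
  ∏ j ∈ Finset.univ.erase q, wireEntry (D.outputHad j) (decide (D.output j ∈ s)) (y j)

theorem outputAmp_eq (D : Diagram m n) (q : Fin n) (s : Finset ℕ) (y : Bits n) :
    D.outputAmp s y =
      wireEntry (D.outputHad q) (decide (D.output q ∈ s)) (y q) * D.otherOutputAmp q s y :=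
  (Finset.mul_prod_erase _ _ (Finset.mem_univ q)).symm

theorem otherOutputAmp_congr {D E : Diagram m n} {q : Fin n} {s t : Finset ℕ} {y z : Bits n}
    (hh : ∀ j ≠ q, D.outputHad j = E.outputHad j)
    (ho : ∀ j ≠ q, (D.output j ∈ s ↔ E.output j ∈ t)) (hy : ∀ j ≠ q, y j = z j) :
    D.otherOutputAmp q s y = E.otherOutputAmp q t z := by
  unfold otherOutputAmp
  refine Finset.prod_congr rfl fun j hj => ?_
  have hj := Finset.ne_of_mem_erase hj
  rw [hh j hj, hy j hj]
  congr 1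
  simp only [ho j hj]

theorem contraction_applyHad (D : Diagram m n) (q : Fin n) :
    (D.applyHad q).contraction = (Gate.had q).toMatrix * D.contraction := by
  ext y x
  rw [Gate.had_mul_apply]
  simp only [contraction, Finset.mul_sum]
  rw [Finset.sum_comm]
  refine Finset.sum_congr rfl fun s _ => ?_
  have h1 : (D.applyHad q).outputAmp s y =
      wireEntry (!D.outputHad q) (decide (D.output q ∈ s)) (y q) * D.otherOutputAmp q s y := by
    rw [outputAmp_eq _ q, otherOutputAmp_congr (E := D) (t := s) (z := y)]
    · change wireEntry (Function.update D.outputHad q (!D.outputHad q) q) _ _ * _ = _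
      rw [Function.update_self]
      rfl
    · intro j hj
      simp [applyHad, hj]
    · simp [applyHad]
    · simp
  have h2 : ∀ b, D.outputAmp s (Function.update y q b) =
      wireEntry (D.outputHad q) (decide (D.output q ∈ s)) b * D.otherOutputAmp q s y := by
    intro b
    rw [outputAmp_eq _ q, otherOutputAmp_congr (E := D) (t := s) (z := y)]
    · simp
    · simp
    · simp
    · intro j hj; simp [hj]
  simp only [h1, h2]
  rw [← sum_hadEntry_mul_wireEntry, Finset.sum_mul, Finset.mul_sum]
  refine Finset.sum_congr rfl fun b _ => ?_
  change D.weight s * D.inputAmp x s * _ = _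
  ring

/-- On a plain wire the bit of the spider and the output bit agree or the summand vanishes, so the
gate may be moved onto the spider. -/
theorem contraction_addPhase {D : Diagram m n} {q : Fin n} (hq : D.outputHad q = false) (α : ℝ) :
    ({ D with phase := Function.update D.phase (D.output q) (D.phase (D.output q) + α) } :
      Diagram m n).contraction = (Gate.phase α q).toMatrix * D.contraction := by
  classical
  ext y x
  rw [Gate.phase_mul_apply]
  simp only [contraction, Finset.mul_sum]
  refine Finset.sum_congr rfl fun s _ => ?_
  simp only [weight, inputAmp]
  change _ * _ * _ * D.outputAmp s y = _
  rw [outputAmp_eq _ q]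
  by_cases h : D.output q ∈ s
  · simp only [h, hq, decide_true, wireEntry]
    rw [← Finset.mul_prod_erase _ _ h, ← Finset.mul_prod_erase s (fun v => Complex.exp _) h]
    have : ∀ v ∈ s.erase (D.output q), Complex.exp
        ((Function.update D.phase (D.output q) (D.phase (D.output q) + α) v : ℝ) * Complex.I) =
        Complex.exp (D.phase v * Complex.I) := fun v hv => by
      rw [Function.update_of_ne (Finset.ne_of_mem_erase hv)]
    rw [Finset.prod_congr rfl this]
    cases y q
    · simp
    · simp [add_mul, Complex.exp_add]
      ring
  · have : ∀ v ∈ s, Complex.exp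
        ((Function.update D.phase (D.output q) (D.phase (D.output q) + α) v : ℝ) * Complex.I) =
        Complex.exp (D.phase v * Complex.I) := fun v hv => by
      rw [Function.update_of_ne]
      rintro rfl
      exact h hv
    rw [Finset.prod_congr rfl this]
    simp only [h, hq, decide_false, wireEntry]
    cases y q
    · simp
    · simp

theorem contraction_symmDiff_edge {D : Diagram m n} {a b : Fin n} (ha : D.outputHad a = false)
    (hb : D.outputHad b = false) (hab : a ≠ b) (ho : D.output a ≠ D.output b) :
    ({ D with graph := symmDiff D.graph (SimpleGraph.edge (D.output a) (D.output b)) } :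
      Diagram m n).contraction = (Gate.cz a b hab).toMatrix * D.contraction := by
  classical
  ext y x
  rw [Gate.cz_mul_apply]
  simp only [contraction, Finset.mul_sum]
  refine Finset.sum_congr rfl fun s _ => ?_
  simp only [weight, inputAmp]
  change _ * _ * _ * D.outputAmp s y = _
  rw [edgeSign_symmDiff, edgeSign_edge ho]
  by_cases h0 : D.outputAmp s y = 0
  · simp [h0]
  -- A nonzero amplitude forces every plain output to carry the bit of its spider, so the sign of
  -- the extra edge is that of the CZ gate.
  · have key : ∀ q, D.outputHad q = false → (y q = true ↔ D.output q ∈ s) := by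
      intro q hq
      rw [outputAmp_eq _ q, hq] at h0
      have := left_ne_zero_of_mul h0
      simp only [wireEntry] at this
      cases hy : y q <;> simp_all
    simp only [Bool.and_eq_true, key a ha, key b hb]
    ring

theorem contraction_swap (D : Diagram m n) {a b : Fin n} (h : a ≠ b) :
    ({ D with output := D.output ∘ Equiv.swap a b, outputHad := D.outputHad ∘ Equiv.swap a b } :
      Diagram m n).contraction = (Gate.swap a b h).toMatrix * D.contraction := by
  ext y x
  rw [Gate.swap_mul_apply]
  simp only [contraction]
  refine Finset.sum_congr rfl fun s _ => ?_
  simp only [weight, inputAmp]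
  congr 1
  simp only [outputAmp]
  refine Fintype.prod_equiv (Equiv.swap a b) _ _ fun j => ?_
  simp

/-- Insert the phaseless spider `w` behind the spider of output `q`, joined to it by a Hadamard
edge, and compensate by a Hadamard on the output wire. -/
def attach (D : Diagram m n) (q : Fin n) (w : ℕ) : Diagram m n :=
  { D with
    verts := insert w D.verts
    graph := D.graph ⊔ SimpleGraph.edge (D.output q) w
    phase := Function.update D.phase w 0
    output := Function.update D.output q w
    outputHad := Function.update D.outputHad q (!D.outputHad q) }

theorem WellFormed.not_adj {D : Diagram m n} (hD : D.WellFormed) {w : ℕ} (hw : w ∉ D.verts)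
    (v : ℕ) : ¬ D.graph.Adj w v := fun h => hw (hD.adj_mem _ _ h)

theorem WellFormed.mem_of_adj {D : Diagram m n} (hD : D.WellFormed) {v w : ℕ}
    (h : D.graph.Adj v w) : w ∈ D.verts := hD.adj_mem _ _ h.symm

/-- Summing over the bit of `w` composes the Hadamard of the new edge with the toggled output wire,
which restores the old wire. The scalar 1/√2 is the normalisation of the new edge, left out of
`contraction`. -/
theorem attach_eval {D : Diagram m n} (hD : D.WellFormed) (q : Fin n) {w : ℕ} (hw : w ∉ D.verts) :
    EqUpToScalar (D.attach q w).eval D.eval := by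
  classical
  refine eval_equiv (EqUpToScalar.symm ⟨((1 / Real.sqrt 2 : ℝ) : ℂ), inv_sqrt_two_ne_zero, ?_⟩)
  ext y x
  rw [Matrix.smul_apply, smul_eq_mul]
  simp only [contraction]
  have hv : D.output q ≠ w := fun h => hw (h ▸ hD.output_mem q)
  rw [show (D.attach q w).verts = insert w D.verts from rfl, Finset.sum_powerset_insert hw,
    ← Finset.sum_add_distrib, Finset.mul_sum]
  refine Finset.sum_congr rfl fun s hs => ?_
  have hs := Finset.mem_powerset.1 hs
  have hws : w ∉ s := fun h => hw (hs h)
  have hG : ∀ u ∈ s, ∀ v ∈ s, ((D.attach q w).graph.Adj u v ↔ D.graph.Adj u v) := by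
    intro u hu v hv
    have h1 : u ≠ w := fun h => hws (h ▸ hu)
    have h2 : v ≠ w := fun h => hws (h ▸ hv)
    simp [attach, SimpleGraph.edge_adj, h1, h2]
  have hphase : ∏ v ∈ s, Complex.exp ((D.attach q w).phase v * Complex.I) =
      ∏ v ∈ s, Complex.exp (D.phase v * Complex.I) := by
    refine Finset.prod_congr rfl fun v hv => ?_
    have : v ≠ w := fun h => hws (h ▸ hv)
    simp [attach, this]
  have hlink : linkSign (D.attach q w).graph w s = if D.output q ∈ s then -1 else 1 := by
    have : ∀ v, (D.attach q w).graph.Adj w v ↔ v = D.output q := by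
      intro v
      simp only [attach, SimpleGraph.sup_adj, SimpleGraph.edge_adj, hD.not_adj hw]
      grind
    simp only [linkSign, this]
    simp [Finset.prod_ite_eq']
  have hw1 : (D.attach q w).weight s = D.weight s := by
    rw [weight, weight, hphase, edgeSign_congr hG]
  have hw2 : (D.attach q w).weight (insert w s) =
      D.weight s * if D.output q ∈ s then -1 else 1 := by
    rw [weight, weight, Finset.prod_insert hws, hphase, edgeSign_insert hws, hlink,
      edgeSign_congr hG]
    simp [attach]
  have hi1 : (D.attach q w).inputAmp x s = D.inputAmp x s := rfl
  have hi2 : (D.attach q w).inputAmp x (insert w s) = D.inputAmp x s := by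
    unfold inputAmp
    refine Finset.prod_congr rfl fun i _ => ?_
    have : D.input i ≠ w := fun h => hw (h ▸ hD.input_mem i)
    simp [attach, this]
  have ho : ∀ t, (∀ j, (D.output j ∈ t ↔ D.output j ∈ s)) → (D.attach q w).outputAmp t y =
      wireEntry (!D.outputHad q) (decide (w ∈ t)) (y q) * D.otherOutputAmp q s y := by
    intro t ht
    rw [outputAmp_eq _ q, otherOutputAmp_congr (E := D) (t := s) (z := y)]
    · simp [attach]
    · intro j hj; simp [attach, hj]
    · intro j hj; simp [attach, hj, ht]
    · simp
  have hne : ∀ j, D.output j ≠ w := fun j h => hw (h ▸ hD.output_mem j)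
  rw [hw1, hw2, hi1, hi2, ho s (by simp), ho (insert w s) (by simp [hne]), outputAmp_eq _ q]
  have h2 := sum_hadEntry_mul_wireEntry (!D.outputHad q) (y q) (decide (D.output q ∈ s))
  rw [wireEntry_comm (D.outputHad q)]
  rw [Bool.not_not] at h2
  rw [← h2, Fintype.sum_bool]
  simp only [hadEntry, hws, wireEntry_comm _ (y q)]
  by_cases h : D.output q ∈ s <;> simp [h] <;> ring

end Diagram

/-! ### Signs under toggling a vertex -/

theorem linkSign_insert_of_not_adj {G : SimpleGraph ℕ} {u v : ℕ} (h : ¬ G.Adj u v)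
    (s : Finset ℕ) : linkSign G u (insert v s) = linkSign G u s := by
  classical
  by_cases hv : v ∈ s
  · rw [Finset.insert_eq_of_mem hv]
  · rw [linkSign_insert hv, if_neg h, one_mul]

theorem edgeSign_eq_one {G : SimpleGraph ℕ} {s : Finset ℕ}
    (h : ∀ u ∈ s, ∀ v ∈ s, ¬ G.Adj u v) : edgeSign G s = 1 := by
  classical
  unfold edgeSign
  exact Finset.prod_eq_one fun u hu => Finset.prod_eq_one fun v hv => by simp [h u hu v hv]

theorem edgeSign_of_star {G : SimpleGraph ℕ} {d : ℕ} {s : Finset ℕ}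
    (h : ∀ u v, G.Adj u v → u = d ∨ v = d) (hd : d ∈ s) : edgeSign G s = linkSign G d s := by
  classical
  rw [← Finset.insert_erase hd, edgeSign_insert (Finset.notMem_erase d s), edgeSign_eq_one,
    one_mul, linkSign_insert_of_not_adj (G.irrefl)]
  intro u hu v hv huv
  rcases h u v huv with rfl | rfl
  · exact Finset.notMem_erase _ _ hu
  · exact Finset.notMem_erase _ _ hv

/-- Add `w` to `s` or remove it. -/
def toggle (w : ℕ) (s : Finset ℕ) : Finset ℕ := if w ∈ s then s.erase w else insert w s

theorem mem_toggle_self {w : ℕ} {s : Finset ℕ} : w ∈ toggle w s ↔ w ∉ s := by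
  unfold toggle
  split_ifs with h <;> simp [h]

theorem mem_toggle_of_ne {v w : ℕ} {s : Finset ℕ} (h : v ≠ w) : v ∈ toggle w s ↔ v ∈ s := by
  unfold toggle
  split_ifs <;> simp [h]

theorem toggle_toggle (w : ℕ) (s : Finset ℕ) : toggle w (toggle w s) = s := by
  ext v
  by_cases h : v = w
  · subst h
    rw [mem_toggle_self, mem_toggle_self, not_not]
  · rw [mem_toggle_of_ne h, mem_toggle_of_ne h]

/-- Adding and removing `w` change the sign by the same factor, because that factor is ±1. -/
theorem edgeSign_toggle (G : SimpleGraph ℕ) (w : ℕ) (s : Finset ℕ) :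
    edgeSign G (toggle w s) = edgeSign G s * linkSign G w s := by
  unfold toggle
  split_ifs with h
  · conv_rhs => rw [← Finset.insert_erase h]
    rw [edgeSign_insert (Finset.notMem_erase w s), linkSign_insert_of_not_adj G.irrefl, mul_assoc,
      linkSign_mul_self, mul_one]
  · rw [edgeSign_insert h]

theorem linkSign_toggle_of_not_adj {G : SimpleGraph ℕ} {u w : ℕ} (h : ¬ G.Adj u w)
    (s : Finset ℕ) : linkSign G u (toggle w s) = linkSign G u s := by
  unfold toggle
  split_ifs with hw
  · conv_rhs => rw [← Finset.insert_erase hw, linkSign_insert_of_not_adj h]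
  · rw [linkSign_insert_of_not_adj h]

theorem prod_toggle {f : ℕ → ℂ} {w : ℕ} (h : f w = 1) (s : Finset ℕ) :
    ∏ v ∈ toggle w s, f v = ∏ v ∈ s, f v := by
  unfold toggle
  split_ifs with hw
  · rw [← Finset.mul_prod_erase s f hw, h, one_mul]
  · rw [Finset.prod_insert hw, h, one_mul]

/-! ### Row additions as CNOT gates, interior spiders, and reversal -/

namespace Diagram

variable {m n : ℕ}

theorem mem_row {D : Diagram m n} {q : Fin n} {v : ℕ} :
    v ∈ D.row q ↔ v ∈ D.past ∧ D.graph.Adj (D.output q) v := by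
  simp [row]

theorem mem_past {D : Diagram m n} {v : ℕ} :
    v ∈ D.past ↔ v ∈ D.verts ∧ ∀ q, D.output q ≠ v := by
  simp [past]

theorem output_notMem_row (D : Diagram m n) (p q : Fin n) : D.output p ∉ D.row q := by
  intro h
  exact (mem_past.1 (mem_row.1 h).1).2 p rfl

/-- The CNOT flips the output bit of `src` when that of `dst` is 1, and the sum absorbs this by
flipping the bit of the spider `w` of `src` at the same time. The inputs do not notice, since `w` is
no input, and neither do the phases, since `w` is phaseless. The sign changes by the edges from `w`
into `s`, and these are exactly the edges that the row addition toggles at `d`. -/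
theorem contraction_addRow {D : Diagram m n} (hD : D.WellFormed) (hP : D.Prepared)
    {src dst : Fin n} (h : dst ≠ src) (hI : ∀ i, D.input i ≠ D.output src) :
    D.contraction = (Gate.cnot dst src h).toMatrix * (D.addRow src dst).contraction := by
  classical
  ext y x
  rw [Gate.cnot_mul_apply]
  simp only [contraction]
  set d := D.output dst with hd
  set w := D.output src with hw
  have hdw : d ≠ w := fun e => h (hD.output_inj e)
  have hwV : w ∈ D.verts := hD.output_mem src
  set R := SimpleGraph.fromRel fun u v => u = d ∧ v ∈ D.row src with hR
  have hRadj : ∀ v, R.Adj d v ↔ v ∈ D.row src := by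
    intro v
    have h1 : d ∉ D.row src := D.output_notMem_row dst src
    simp only [hR, SimpleGraph.fromRel_adj]
    constructor
    · rintro ⟨_, h2 | h2⟩
      · exact h2.2
      · exact absurd h2.2 h1
    · intro h2
      refine ⟨?_, Or.inl ⟨trivial, h2⟩⟩
      rintro rfl
      exact h1 h2
  have hRstar : ∀ u v, R.Adj u v → u = d ∨ v = d := by
    intro u v
    simp only [hR, SimpleGraph.fromRel_adj]
    tauto
  -- The map is its own inverse: toggling `w` does not affect whether `d` lies in `s`, because `d ≠
  -- w`.
  refine Finset.sum_bij' (fun s _ => if d ∈ s then toggle w s else s)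
    (fun s _ => if d ∈ s then toggle w s else s) ?_ ?_ ?_ ?_ ?_
  · intro s hs
    rw [Finset.mem_powerset] at hs ⊢
    split_ifs
    · intro v hv
      by_cases hvw : v = w
      · rw [hvw]; exact hwV
      · exact hs ((mem_toggle_of_ne hvw).1 hv)
    · exact hs
  · intro s hs
    rw [Finset.mem_powerset] at hs ⊢
    split_ifs
    · intro v hv
      by_cases hvw : v = w
      · rw [hvw]; exact hwV
      · exact hs ((mem_toggle_of_ne hvw).1 hv)
    · exact hs
  · intro s _
    by_cases hds : d ∈ s
    · simp [hds, mem_toggle_of_ne hdw, toggle_toggle]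
    · simp [hds]
  · intro s _
    by_cases hds : d ∈ s
    · simp [hds, mem_toggle_of_ne hdw, toggle_toggle]
    · simp [hds]
  · intro s hs
    rw [Finset.mem_powerset] at hs
    -- The CNOT reads the output bit `y dst`, the bijection reads the spider bit. Where they differ,
    -- the plain wire makes both summands zero.
    by_cases hdy : (d ∈ s ↔ y dst = true)
    swap
    · have hz1 : D.outputAmp s y = 0 := by
        rw [outputAmp_eq _ dst, hP.plain, ← hd]
        have : decide (d ∈ s) ≠ y dst := by
          intro e
          apply hdy
          rw [← e]; simp
        simp [wireEntry, this]
      have hz2 : (D.addRow src dst).outputAmp (if d ∈ s then toggle w s else s)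
          (Function.update y src (xor (y src) (y dst))) = 0 := by
        rw [outputAmp_eq _ dst]
        have e1 : (D.addRow src dst).outputHad dst = false := hP.plain dst
        have e2 : decide ((D.addRow src dst).output dst ∈ if d ∈ s then toggle w s else s) ≠
            y dst := by
          intro e
          apply hdy
          rw [← e]
          change d ∈ s ↔ decide (d ∈ if d ∈ s then toggle w s else s) = true
          by_cases hds : d ∈ s
          · simp [hds, mem_toggle_of_ne hdw]
          · simp [hds]
        rw [e1, Function.update_of_ne h]
        simp only [wireEntry, e2]
        simp
      rw [hz1, hz2, mul_zero, mul_zero]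
    have hout : (D.addRow src dst).outputAmp (if d ∈ s then toggle w s else s)
          (Function.update y src (xor (y src) (y dst))) = D.outputAmp s y := by
      rw [outputAmp_eq _ src, outputAmp_eq _ src]
      congr 1
      · change wireEntry (D.outputHad src) (decide (w ∈ if d ∈ s then toggle w s else s)) _ =
          wireEntry _ (decide (w ∈ s)) _
        rw [hP.plain, Function.update_self]
        by_cases hds : d ∈ s
        · rw [if_pos hds, hdy.1 hds]
          by_cases hws : w ∈ s <;> cases y src <;> simp [wireEntry, mem_toggle_self, hws]
        · have : y dst = false := by
            rw [hdy] at hds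
            simpa using hds
          rw [if_neg hds, this]
          simp
      · refine otherOutputAmp_congr (fun _ _ => rfl) ?_ ?_
        · intro j hj
          have hne : D.output j ≠ w := fun e => hj (hD.output_inj e)
          change (D.output j ∈ if d ∈ s then toggle w s else s) ↔ _
          split_ifs
          · exact mem_toggle_of_ne hne
          · rfl
        · intro j hj
          rw [Function.update_of_ne hj]
    have hin : (D.addRow src dst).inputAmp x (if d ∈ s then toggle w s else s) =
        D.inputAmp x s := by
      unfold inputAmp
      refine Finset.prod_congr rfl fun i _ => ?_
      change wireEntry (D.inputHad i) _ (decide (D.input i ∈ if d ∈ s then toggle w s else s)) = _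
      congr 1
      split_ifs
      · simp only [mem_toggle_of_ne (hI i)]
      · rfl
    have hwt : (D.addRow src dst).weight (if d ∈ s then toggle w s else s) = D.weight s := by
      unfold weight
      change (∏ v ∈ _, Complex.exp (D.phase v * Complex.I)) * edgeSign (symmDiff D.graph R) _ = _
      rw [edgeSign_symmDiff]
      split_ifs with hds
      -- Toggling `w` costs the sign of its links in `D`, and the star `R` centred at `d`
      -- contributes the links of `d`. All neighbours of `w` lie in the past because the frontier is
      -- disconnected, so the two signs coincide and their product is 1.
      · rw [prod_toggle (by rw [hw, hP.phaseless]; simp), edgeSign_toggle,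
          edgeSign_of_star hRstar ((mem_toggle_of_ne hdw).2 hds),
          linkSign_toggle_of_not_adj (by rw [hRadj]; exact D.output_notMem_row src src),
          mul_assoc (edgeSign _ _), linkSign_congr (G := R) (v := w) (H := D.graph),
          linkSign_mul_self, mul_one]
        intro v hv
        rw [hRadj, mem_row, mem_past]
        constructor
        · exact fun h => h.2
        · intro hadj
          refine ⟨⟨hs hv, ?_⟩, hadj⟩
          rintro q rfl
          exact hP.disconnected _ _ hadj
      · rw [edgeSign_eq_one (G := R), mul_one]
        intro u hu v hv huv
        rcases hRstar u v huv with rfl | rfl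
        · exact hds hu
        · exact hds hv
    rw [hout, hin, hwt]

theorem inputAmp_insert {D : Diagram m n} {u : ℕ} (h : ∀ i, D.input i ≠ u) (x : Bits m)
    (s : Finset ℕ) : D.inputAmp x (insert u s) = D.inputAmp x s := by
  unfold inputAmp
  exact Finset.prod_congr rfl fun i _ => by simp [h i]

theorem outputAmp_insert {D : Diagram m n} {u : ℕ} (h : ∀ j, D.output j ≠ u) (y : Bits n)
    (s : Finset ℕ) : D.outputAmp (insert u s) y = D.outputAmp s y := by
  unfold outputAmp
  exact Finset.prod_congr rfl fun j _ => by simp [h j]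

theorem weight_insert {D : Diagram m n} {u : ℕ} {s : Finset ℕ} (h : u ∉ s) :
    D.weight (insert u s) =
      Complex.exp (D.phase u * Complex.I) * linkSign D.graph u s * D.weight s := by
  unfold weight
  rw [Finset.prod_insert h, edgeSign_insert h]
  ring

/-- The diagram read from its outputs to its inputs. -/
def reverse (D : Diagram m n) : Diagram n m where
  verts := D.verts
  graph := D.graph
  phase := D.phase
  input := D.output
  output := D.input
  inputHad := D.outputHad
  outputHad := D.inputHad

theorem WellFormed.reverse {D : Diagram m n} (hD : D.WellFormed) : D.reverse.WellFormed :=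
  ⟨hD.adj_mem, hD.output_mem, hD.input_mem, hD.output_inj, hD.input_inj⟩

/-- Exchanging inputs and outputs transposes the matrix, as the Hadamard is symmetric. Statements
about linear maps at inputs are thereby reduced to those at outputs. -/
theorem reverse_eval (D : Diagram m n) : EqUpToScalar D.reverse.eval D.eval.transpose := by
  refine D.reverse.eval_equiv_contraction.trans
    (EqUpToScalar.trans (EqUpToScalar.of_eq ?_) D.eval_equiv_contraction.symm.transpose)
  ext x y
  rw [Matrix.transpose_apply]
  unfold contraction
  refine Finset.sum_congr rfl fun s _ => ?_
  rw [mul_right_comm]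
  congr 1
  · congr 1
    exact Finset.prod_congr rfl fun i _ => wireEntry_comm _ _ _
  · exact Finset.prod_congr rfl fun i _ => wireEntry_comm _ _ _

end Diagram

/-! ### Summing out a spider -/

theorem symmDiff_adj {G H : SimpleGraph ℕ} {v w : ℕ} :
    (symmDiff G H).Adj v w ↔ ¬ (G.Adj v w ↔ H.Adj v w) := by
  simp only [symmDiff, SimpleGraph.sup_adj, SimpleGraph.sdiff_adj]
  tauto

theorem localComp_adj {G : SimpleGraph ℕ} {u v w : ℕ} (h : v ≠ w) :
    (localComp G u).Adj v w ↔ ¬ (G.Adj v w ↔ (G.Adj u v ∧ G.Adj u w)) := by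
  simp only [localComp, symmDiff_adj, SimpleGraph.fromRel_adj]
  tauto

/-- Away from `u` and `v`, the three local complementations change the adjacency of `x` and `y` by
the 𝔽₂-sum of the products `ux · vy` and `vx · uy`. The proof is a truth table in the four
adjacencies to `u` and `v`. -/
theorem pivot_adj {G : SimpleGraph ℕ} {u v x y : ℕ} (huv : G.Adj u v) (hxy : x ≠ y)
    (hxu : x ≠ u) (hxv : x ≠ v) (hyu : y ≠ u) (hyv : y ≠ v) :
    (pivot G u v).Adj x y ↔
      ¬ (G.Adj x y ↔ ¬ ((G.Adj u x ∧ G.Adj v y) ↔ (G.Adj v x ∧ G.Adj u y))) := by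
  have h1 := G.adj_comm v u
  have h2 := G.irrefl (v := u)
  have h3 := G.irrefl (v := v)
  have huv' := huv.ne
  simp only [pivot, localComp_adj hxy, localComp_adj hxu.symm, localComp_adj hyu.symm,
    localComp_adj hxv.symm, localComp_adj hyv.symm, localComp_adj huv'.symm, h1, h2, huv]
  by_cases h4 : G.Adj u x <;> by_cases h5 : G.Adj u y <;> by_cases h6 : G.Adj v x <;>
    by_cases h7 : G.Adj v y <;> simp [h4, h5, h6, h7]

/-- The factor `1 + ε * linkSign G u s` is the sum over the bit of the removed spider, with ε = ±i
its phase factor. If `u` has k neighbours in `s`, this sum is (1 + ε) ε⁻ᵏ (-1)^(k(k-1)/2): the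
powers of ε⁻¹ are the phase corrections, and the sign is that of the complete graph on those
neighbours. Each new neighbour multiplies the sum by ε⁻¹ times the current link sign. -/
theorem edgeSign_localComp {G : SimpleGraph ℕ} {u : ℕ} {s : Finset ℕ} {ε : ℂ} (hε : ε * ε = -1)
    [DecidablePred (G.Adj u)] :
    (1 + ε) * ((∏ v ∈ s, if G.Adj u v then ε⁻¹ else 1) * edgeSign (localComp G u) s) =
      (1 + ε * linkSign G u s) * edgeSign G s := by
  classical
  rw [localComp, edgeSign_symmDiff, mul_comm (edgeSign G s), ← mul_assoc, ← mul_assoc]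
  congr 1
  induction s using Finset.induction_on with
  | empty => simp
  | insert a s ha ih =>
    rw [edgeSign_insert ha, linkSign_insert ha, Finset.prod_insert ha]
    by_cases hua : G.Adj u a
    · have h1 : linkSign (SimpleGraph.fromRel fun v w => G.Adj u v ∧ G.Adj u w) a s =
          linkSign G u s := by
        refine linkSign_congr fun w hw => ?_
        have : a ≠ w := fun h => ha (h ▸ hw)
        simp [SimpleGraph.fromRel_adj, hua, this]
      rw [h1, if_pos hua, if_pos hua]
      have h2 := linkSign_mul_self G u s
      have h3 : ε⁻¹ = -ε := by
        refine inv_eq_of_mul_eq_one_left ?_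
        rw [neg_mul, hε, neg_neg]
      generalize linkSign G u s = σ at *
      calc _ = ((1 + ε) * (∏ v ∈ s, if G.Adj u v then ε⁻¹ else 1) *
            edgeSign (SimpleGraph.fromRel fun v w => G.Adj u v ∧ G.Adj u w) s) * (ε⁻¹ * σ) := by
            ring
        _ = _ := by
            rw [ih, h3]
            linear_combination (-ε * ε) * h2 - hε
    · have h1 : linkSign (SimpleGraph.fromRel fun v w => G.Adj u v ∧ G.Adj u w) a s = 1 := by
        unfold linkSign
        exact Finset.prod_eq_one fun w _ => by simp [SimpleGraph.fromRel_adj, hua]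
      rw [h1, if_neg hua, if_neg hua, one_mul, one_mul, mul_one, ih]

/-- The four terms on the right are the four choices of bits for `u` and `v`; the minus sign of the
last one comes from the edge `uv`. -/
theorem edgeSign_pivot {G : SimpleGraph ℕ} {u v : ℕ} (huv : G.Adj u v) {s : Finset ℕ}
    (hu : u ∉ s) (hv : v ∉ s) {a b : ℂ} (ha : a * a = 1) (hb : b * b = 1)
    [DecidablePred (G.Adj u)] [DecidablePred (G.Adj v)] :
    (1 + a + b - a * b) *
        ((∏ x ∈ s, (if G.Adj u x then b else 1) * (if G.Adj v x then a else 1) *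
          (if G.Adj u x ∧ G.Adj v x then -1 else 1)) * edgeSign (pivot G u v) s) =
      (1 + a * linkSign G u s + b * linkSign G v s
        - a * linkSign G u s * (b * linkSign G v s)) * edgeSign G s := by
  classical
  set H := SimpleGraph.fromRel fun x y => ¬ ((G.Adj u x ∧ G.Adj v y) ↔ (G.Adj v x ∧ G.Adj u y))
    with hH
  have hHadj : ∀ {x y}, x ≠ y → (H.Adj x y ↔
      ¬ ((G.Adj u x ∧ G.Adj v y) ↔ (G.Adj v x ∧ G.Adj u y))) := by
    intro x y hxy
    simp only [hH, SimpleGraph.fromRel_adj]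
    tauto
  -- The pivot also rewires `u` and `v` themselves, but neither lies in `s`. On `s` it is the
  -- symmetric difference with `H`.
  have hpiv : edgeSign (pivot G u v) s = edgeSign (symmDiff G H) s := by
    refine edgeSign_congr fun x hx y hy => ?_
    by_cases hxy : x = y
    · subst hxy
      simp
    · have hxu : x ≠ u := fun h => hu (h ▸ hx)
      have hxv : x ≠ v := fun h => hv (h ▸ hx)
      have hyu : y ≠ u := fun h => hu (h ▸ hy)
      have hyv : y ≠ v := fun h => hv (h ▸ hy)
      rw [pivot_adj huv hxy hxu hxv hyu hyv, ← hHadj hxy]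
      exact symmDiff_adj.symm
  rw [hpiv, edgeSign_symmDiff, mul_comm (edgeSign G s), ← mul_assoc, ← mul_assoc]
  congr 1
  clear hpiv
  induction s using Finset.induction_on with
  | empty => simp
  | insert c s hc ih =>
    specialize ih (fun h => hu (Finset.mem_insert_of_mem h))
      (fun h => hv (Finset.mem_insert_of_mem h))
    have hne : ∀ y ∈ s, c ≠ y := fun y hy h => hc (h ▸ hy)
    rw [edgeSign_insert hc, linkSign_insert hc, linkSign_insert hc, Finset.prod_insert hc]
    have h2 := linkSign_mul_self G u s
    have h3 := linkSign_mul_self G v s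
    have hlink : linkSign H c s = (if G.Adj u c then linkSign G v s else 1) *
        (if G.Adj v c then linkSign G u s else 1) := by
      unfold linkSign
      by_cases h4 : G.Adj u c <;> by_cases h5 : G.Adj v c
      · rw [if_pos h4, if_pos h5, ← Finset.prod_mul_distrib]
        refine Finset.prod_congr rfl fun y hy => ?_
        simp only [hHadj (hne y hy)]
        by_cases h6 : G.Adj u y <;> by_cases h7 : G.Adj v y <;> simp [h4, h5, h6, h7]
      · rw [if_pos h4, if_neg h5, mul_one]
        refine Finset.prod_congr rfl fun y hy => ?_
        simp only [hHadj (hne y hy)]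
        simp [h4, h5]
      · rw [if_neg h4, if_pos h5, one_mul]
        refine Finset.prod_congr rfl fun y hy => ?_
        simp only [hHadj (hne y hy)]
        simp [h4, h5]
      · rw [if_neg h4, if_neg h5, one_mul]
        refine Finset.prod_eq_one fun y hy => ?_
        rw [if_neg]
        rw [hHadj (hne y hy)]
        simp [h4, h5]
    rw [hlink]
    generalize linkSign G u s = σ at *
    generalize linkSign G v s = τ at *
    generalize (∏ x ∈ s, (if G.Adj u x then b else 1) * (if G.Adj v x then a else 1) *
          (if G.Adj u x ∧ G.Adj v x then -1 else 1)) = P at *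
    generalize edgeSign H s = Q at *
    -- Put A = aσ and B = bτ. Adjacency of the new vertex to `u` negates A, adjacency to `v` negates
    -- B. As A² = B² = 1, this multiplies 1 + A + B - AB by B, by A, or by -AB when both hold, which
    -- matches the new phase factors and the edges of `H` at the vertex.
    have hA : a * σ * (a * σ) = 1 := by rw [mul_mul_mul_comm, ha, h2, one_mul]
    have hB : b * τ * (b * τ) = 1 := by rw [mul_mul_mul_comm, hb, h3, one_mul]
    by_cases h4 : G.Adj u c <;> by_cases h5 : G.Adj v c <;>
      simp only [h4, h5, if_true, if_false, and_self, and_true, and_false]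
    · linear_combination (-(a * b * σ * τ)) * ih + (b * τ * (b * τ) - b * τ) * hA +
        (1 - a * σ) * hB
    · linear_combination (b * τ) * ih + (1 - a * σ) * hB
    · linear_combination (a * σ) * ih + (1 - b * τ) * hA
    · linear_combination ih

namespace Diagram

variable {m n : ℕ}

theorem fresh_notMem (D : Diagram m n) : D.fresh ∉ D.verts := by
  intro h
  have := Finset.le_sup (f := id) h
  simp only [fresh, id] at this
  omega

theorem eval_applyHad (D : Diagram m n) (q : Fin n) :
    EqUpToScalar (D.applyHad q).eval ((Gate.had q).toMatrix * D.eval) :=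
  eval_equiv_mul (EqUpToScalar.of_eq (D.contraction_applyHad q))

theorem applyHad_applyHad (D : Diagram m n) (q : Fin n) : (D.applyHad q).applyHad q = D := by
  simp [applyHad]

theorem eval_had_mul (D : Diagram m n) (q : Fin n) :
    EqUpToScalar D.eval ((Gate.had q).toMatrix * (D.applyHad q).eval) := by
  simpa only [applyHad_applyHad] using (D.applyHad q).eval_applyHad q

/-! ### Local complementation and pivoting -/

theorem exp_mul_self_of_isProperClifford {D : Diagram m n} {u : ℕ} (h : D.IsProperClifford u) :
    Complex.exp (D.phase u * Complex.I) * Complex.exp (D.phase u * Complex.I) = -1 := by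
  obtain ⟨k, ⟨j, rfl⟩, h⟩ := h
  rw [← Complex.exp_add, h]
  have : ((((2 * j + 1 : ℤ) : ℝ) * (Real.pi / 2) : ℝ) : ℂ) * Complex.I +
      ((((2 * j + 1 : ℤ) : ℝ) * (Real.pi / 2) : ℝ) : ℂ) * Complex.I =
      Real.pi * Complex.I + j * (2 * Real.pi * Complex.I) := by
    push_cast; ring
  rw [this, Complex.exp_add, Complex.exp_int_mul_two_pi_mul_I, Complex.exp_pi_mul_I, mul_one]

theorem exp_mul_self_of_isPauli {D : Diagram m n} {u : ℕ} (h : D.IsPauli u) :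
    Complex.exp (D.phase u * Complex.I) * Complex.exp (D.phase u * Complex.I) = 1 := by
  obtain ⟨k, h⟩ := h
  rw [← Complex.exp_add, h]
  have : (((k : ℝ) * Real.pi : ℝ) : ℂ) * Complex.I + (((k : ℝ) * Real.pi : ℝ) : ℂ) * Complex.I =
      k * (2 * Real.pi * Complex.I) := by
    push_cast; ring
  rw [this, Complex.exp_int_mul_two_pi_mul_I]

/-- Subsets are grouped by their part outside `u`, so that the two bits of `u` give the factor in
`edgeSign_localComp`. The scalar 1 + ε is nonzero because ε = -1 would contradict ε² = -1. -/
theorem lcSimp_eval {D : Diagram m n} {u : ℕ} (hu : D.IsInterior u) (hc : D.IsProperClifford u) :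
    EqUpToScalar (D.lcSimp u).eval D.eval := by
  classical
  have hε := exp_mul_self_of_isProperClifford hc
  set ε := Complex.exp (D.phase u * Complex.I) with hεdef
  refine eval_equiv (EqUpToScalar.symm ⟨1 + ε, ?_, ?_⟩)
  · intro h
    have : ε = -1 := by linear_combination h
    rw [this] at hε
    norm_num at hε
  ext y x
  rw [Matrix.smul_apply, smul_eq_mul]
  simp only [contraction]
  rw [← Finset.insert_erase hu.1, Finset.sum_powerset_insert (Finset.notMem_erase _ _),
    ← Finset.sum_add_distrib, Finset.mul_sum]
  refine Finset.sum_congr rfl fun s hs => ?_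
  have hus : u ∉ s := fun h => Finset.notMem_erase _ _ (Finset.mem_powerset.1 hs h)
  rw [inputAmp_insert hu.2.1, outputAmp_insert hu.2.2, weight_insert hus, ← hεdef]
  change _ = (1 + ε) * ((D.lcSimp u).weight s * D.inputAmp x s * D.outputAmp s y)
  have hw : (D.lcSimp u).weight s = (∏ v ∈ s, Complex.exp (D.phase v * Complex.I)) *
      ((∏ v ∈ s, if D.graph.Adj u v then ε⁻¹ else 1) * edgeSign (localComp D.graph u) s) := by
    rw [weight, ← mul_assoc, ← Finset.prod_mul_distrib]
    congr 1
    · refine Finset.prod_congr rfl fun v _ => ?_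
      simp only [lcSimp]
      split_ifs
      · rw [hεdef, ← Complex.exp_neg, ← Complex.exp_add]
        push_cast
        ring_nf
      · rw [mul_one]
    · refine edgeSign_congr fun v hv w hw => ?_
      have h1 : v ≠ u := fun h => hus (h ▸ hv)
      have h2 : w ≠ u := fun h => hus (h ▸ hw)
      simp [lcSimp, SimpleGraph.deleteIncidenceSet_adj, h1, h2]
  have key := edgeSign_localComp (G := D.graph) (u := u) (s := s) hε
  rw [hw, weight]
  linear_combination (-(∏ v ∈ s, Complex.exp (D.phase v * Complex.I)) * D.inputAmp x s *
    D.outputAmp s y) * key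

/-- As for local complementation, but with two bits summed out. For signs a and b the scalar 1 + a +
b - ab is 2, or -2 when both are -1. -/
theorem pivotSimp_eval {D : Diagram m n} {u v : ℕ} (hu : D.IsInterior u) (hv : D.IsInterior v)
    (pu : D.IsPauli u) (pv : D.IsPauli v) (huv : D.graph.Adj u v) :
    EqUpToScalar (D.pivotSimp u v).eval D.eval := by
  classical
  have ha := exp_mul_self_of_isPauli pu
  have hb := exp_mul_self_of_isPauli pv
  set a := Complex.exp (D.phase u * Complex.I) with hadef
  set b := Complex.exp (D.phase v * Complex.I) with hbdef
  refine eval_equiv (EqUpToScalar.symm ⟨1 + a + b - a * b, ?_, ?_⟩)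
  · intro h
    rcases mul_self_eq_one_iff.1 ha with h1 | h1 <;>
      rcases mul_self_eq_one_iff.1 hb with h2 | h2 <;>
      rw [h1, h2] at h <;> norm_num at h
  ext y x
  rw [Matrix.smul_apply, smul_eq_mul]
  simp only [contraction]
  have hvmem : v ∈ D.verts.erase u := Finset.mem_erase.2 ⟨huv.ne.symm, hv.1⟩
  rw [show (D.pivotSimp u v).verts = (D.verts.erase u).erase v from rfl,
    ← Finset.insert_erase hu.1, Finset.sum_powerset_insert (Finset.notMem_erase _ _),
    ← Finset.sum_add_distrib, Finset.erase_insert (Finset.notMem_erase _ _)]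
  conv_lhs => rw [← Finset.insert_erase hvmem]
  rw [Finset.sum_powerset_insert (Finset.notMem_erase _ _), ← Finset.sum_add_distrib,
    Finset.mul_sum]
  refine Finset.sum_congr rfl fun s hs => ?_
  have hs := Finset.mem_powerset.1 hs
  have hvs : v ∉ s := fun h => Finset.notMem_erase _ _ (hs h)
  have hus : u ∉ s := fun h => Finset.notMem_erase _ _ (Finset.mem_of_mem_erase (hs h))
  have hus' : u ∉ insert v s := by simp [hus, huv.ne]
  rw [inputAmp_insert hu.2.1, inputAmp_insert hu.2.1, outputAmp_insert hu.2.2,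
    outputAmp_insert hu.2.2, weight_insert hus, weight_insert hus', inputAmp_insert hv.2.1,
    outputAmp_insert hv.2.2, weight_insert hvs, linkSign_insert hvs, if_pos huv, ← hadef, ← hbdef]
  change _ = _ * ((D.pivotSimp u v).weight s * D.inputAmp x s * D.outputAmp s y)
  have hw : (D.pivotSimp u v).weight s = (∏ x ∈ s, Complex.exp (D.phase x * Complex.I)) *
      ((∏ x ∈ s, (if D.graph.Adj u x then b else 1) * (if D.graph.Adj v x then a else 1) *
        (if D.graph.Adj u x ∧ D.graph.Adj v x then -1 else 1)) *
        edgeSign (pivot D.graph u v) s) := by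
    rw [weight, ← mul_assoc, ← Finset.prod_mul_distrib]
    congr 1
    · refine Finset.prod_congr rfl fun x _ => ?_
      simp only [pivotSimp, Complex.ofReal_add, add_mul, Complex.exp_add, mul_assoc]
      congr 1
      congr 1
      · split_ifs <;> simp [hbdef]
      congr 1
      · split_ifs <;> simp [hadef]
      · split_ifs <;> simp
    · refine edgeSign_congr fun x hx y hy => ?_
      have h1 : x ≠ u := fun h => hus (h ▸ hx)
      have h2 : y ≠ u := fun h => hus (h ▸ hy)
      have h3 : x ≠ v := fun h => hvs (h ▸ hx)
      have h4 : y ≠ v := fun h => hvs (h ▸ hy)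
      simp [pivotSimp, SimpleGraph.deleteIncidenceSet_adj, h1, h2, h3, h4]
  have key := edgeSign_pivot huv hus hvs ha hb
  rw [hw, weight]
  linear_combination (-(∏ v ∈ s, Complex.exp (D.phase v * Complex.I)) * D.inputAmp x s *
    D.outputAmp s y) * key

end Diagram

/-! ### Circuits -/

theorem Circuit.eval_append {n : ℕ} (A B : Circuit n) :
    Circuit.eval (A ++ B) = Circuit.eval B * Circuit.eval A := by
  induction A with
  | nil => simp [Circuit.eval]
  | cons g A ih => simp only [List.cons_append, Circuit.eval, ih, Matrix.mul_assoc]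

theorem Gate.had_transpose {n : ℕ} (q : Fin n) :
    (Gate.had q).toMatrix.transpose = (Gate.had q).toMatrix := by
  ext y x
  change (if ∀ k, k ≠ q → x k = y k then hadEntry (y q) (x q) else 0) =
    if ∀ k, k ≠ q → y k = x k then hadEntry (x q) (y q) else 0
  rw [hadEntry_comm]
  simp only [eq_comm]

theorem Gate.phase_transpose {n : ℕ} (α : ℝ) (q : Fin n) :
    (Gate.phase α q).toMatrix.transpose = (Gate.phase α q).toMatrix := by
  simp [Gate.toMatrix, Matrix.diagonal_transpose]

/-! ### Splitting off the gates of a boundary spider -/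

namespace Diagram

variable {m n : ℕ}

/-- Join the spider of output `q` by a Hadamard edge to a new phaseless spider that takes over the
output, dropping its phase and the Hadamard of its wire. -/
def unfuseOutput (D : Diagram m n) (q : Fin n) : Diagram m n :=
  { D with
    verts := insert D.fresh D.verts
    graph := D.graph ⊔ SimpleGraph.edge (D.output q) D.fresh
    phase := Function.update (Function.update D.phase (D.output q) 0) D.fresh 0
    output := Function.update D.output q D.fresh
    outputHad := Function.update D.outputHad q false }

/-- The same at input `i`. -/
def unfuseInput (D : Diagram m n) (i : Fin m) : Diagram m n :=
  (D.reverse.unfuseOutput i).reverse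

/-- The diagram without the phase and the Hadamard at output `q`. -/
def bareOutput (D : Diagram m n) (q : Fin n) : Diagram m n :=
  { D with
    phase := Function.update D.phase (D.output q) 0
    outputHad := Function.update D.outputHad q false }

theorem WellFormed.bareOutput {D : Diagram m n} (hD : D.WellFormed) (q : Fin n) :
    (D.bareOutput q).WellFormed :=
  ⟨hD.adj_mem, hD.input_mem, hD.output_mem, hD.input_inj, hD.output_inj⟩

theorem WellFormed.applyHad {D : Diagram m n} (hD : D.WellFormed) (q : Fin n) :
    (D.applyHad q).WellFormed :=
  ⟨hD.adj_mem, hD.input_mem, hD.output_mem, hD.input_inj, hD.output_inj⟩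

/-- Attaching a spider toggles the Hadamard of the output wire. One Hadamard is therefore applied to
the bare wire first, so that the new spider ends up on a plain one. -/
theorem unfuseOutput_eq (D : Diagram m n) (q : Fin n) :
    D.unfuseOutput q = ((D.bareOutput q).applyHad q).attach q D.fresh := by
  simp [unfuseOutput, bareOutput, applyHad, attach]

theorem eval_bareOutput (D : Diagram m n) (q : Fin n) :
    EqUpToScalar D.eval (Circuit.eval (Gate.phase (D.phase (D.output q)) q ::
      (if D.outputHad q then [Gate.had q] else [])) * (D.bareOutput q).eval) := by
  have h1 := eval_equiv_mul (EqUpToScalar.of_eq (contraction_addPhase (D := D.bareOutput q) (q := q)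
    (by simp [bareOutput]) (D.phase (D.output q))))
  have h2 : ({ D.bareOutput q with
      phase := Function.update (D.bareOutput q).phase ((D.bareOutput q).output q)
        ((D.bareOutput q).phase ((D.bareOutput q).output q) + D.phase (D.output q)) } :
      Diagram m n) =
      { D with outputHad := Function.update D.outputHad q false } := by
    simp [bareOutput]
  rw [h2] at h1
  by_cases h : D.outputHad q
  · have h3 : D.applyHad q = { D with outputHad := Function.update D.outputHad q false } := by
      simp [applyHad, h]
    rw [← h3] at h1
    simp only [h, if_true, Circuit.eval, Matrix.one_mul, Matrix.mul_assoc]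
    exact (D.eval_had_mul q).trans (h1.mul_left _)
  · have h3 : Function.update D.outputHad q false = D.outputHad := by
      rw [← Bool.eq_false_of_not_eq_true h, Function.update_eq_self]
    rw [h3] at h1
    simpa [h, Circuit.eval] using h1

theorem eval_unfuseOutput {D : Diagram m n} (hD : D.WellFormed) (q : Fin n) :
    EqUpToScalar D.eval (Circuit.eval ([Gate.had q, Gate.phase (D.phase (D.output q)) q] ++
      (if D.outputHad q then [Gate.had q] else [])) * (D.unfuseOutput q).eval) := by
  refine (D.eval_bareOutput q).trans ?_
  rw [unfuseOutput_eq, List.cons_append, List.cons_append, List.nil_append]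
  conv_rhs => rw [Circuit.eval]
  rw [Matrix.mul_assoc]
  refine EqUpToScalar.mul_left _ ?_
  refine ((D.bareOutput q).eval_had_mul q).trans (EqUpToScalar.mul_left _ ?_)
  exact (attach_eval ((hD.bareOutput q).applyHad q) q D.fresh_notMem).symm

/-- Transposed from the output version. Hadamard and phase matrices are symmetric, so transposition
only reverses the order of the split-off gates. -/
theorem eval_unfuseInput {D : Diagram m n} (hD : D.WellFormed) (i : Fin m) :
    EqUpToScalar D.eval ((D.unfuseInput i).eval * Circuit.eval
      ((if D.inputHad i then [Gate.had i] else []) ++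
        [Gate.phase (D.phase (D.input i)) i, Gate.had i])) := by
  have h1 := (eval_unfuseOutput hD.reverse i).transpose
  have h2 := D.reverse.reverse_eval
  have h3 := (D.reverse.unfuseOutput i).reverse_eval
  refine h2.trans (h1.trans ?_)
  rw [Matrix.transpose_mul]
  refine (h3.symm.mul_right _).trans (EqUpToScalar.of_eq ?_)
  congr 1
  by_cases h : D.inputHad i
  · simp [reverse, h, Circuit.eval, Matrix.transpose_mul, Gate.had_transpose,
      Gate.phase_transpose, Matrix.mul_assoc]
  · simp [reverse, h, Circuit.eval, Matrix.transpose_mul, Gate.had_transpose,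
      Gate.phase_transpose]

end Diagram

/-! ### gFlow as linear algebra over 𝔽₂ -/

open scoped Classical in
/-- The entries of the adjacency matrix over `𝔽₂`. -/
def adjBit (G : SimpleGraph ℕ) (v w : ℕ) : ZMod 2 := if G.Adj v w then 1 else 0

/-- The number of neighbours of `v` in the set with indicator function `k`, modulo 2. -/
def oddAt (G : SimpleGraph ℕ) (V : Finset ℕ) (k : ℕ → ZMod 2) (v : ℕ) : ZMod 2 :=
  ∑ w ∈ V, adjBit G v w * k w

theorem zmod_two_add_self (a : ZMod 2) : a + a = 0 := CharTwo.add_self_eq_zero a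

theorem adjBit_of_adj {G : SimpleGraph ℕ} {v w : ℕ} (h : G.Adj v w) : adjBit G v w = 1 := by
  simp [adjBit, h]

theorem adjBit_of_not_adj {G : SimpleGraph ℕ} {v w : ℕ} (h : ¬ G.Adj v w) : adjBit G v w = 0 := by
  simp [adjBit, h]

theorem adjBit_comm (G : SimpleGraph ℕ) (v w : ℕ) : adjBit G v w = adjBit G w v := by
  classical
  simp [adjBit, G.adj_comm v w]

theorem adjBit_congr {G H : SimpleGraph ℕ} {v w x y : ℕ} (h : G.Adj v w ↔ H.Adj x y) :
    adjBit G v w = adjBit H x y := by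
  classical
  simp [adjBit, h]

theorem oddAt_congr {G H : SimpleGraph ℕ} {V : Finset ℕ} {k k' : ℕ → ZMod 2} {v : ℕ}
    (h : ∀ w ∈ V, adjBit G v w * k w = adjBit H v w * k' w) : oddAt G V k v = oddAt H V k' v :=
  Finset.sum_congr rfl h

theorem oddAt_add (G : SimpleGraph ℕ) (V : Finset ℕ) (k k' : ℕ → ZMod 2) (v : ℕ) :
    oddAt G V (k + k') v = oddAt G V k v + oddAt G V k' v := by
  simp [oddAt, mul_add, Finset.sum_add_distrib]

theorem oddAt_smul (G : SimpleGraph ℕ) (V : Finset ℕ) (c : ZMod 2) (k : ℕ → ZMod 2) (v : ℕ) :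
    oddAt G V (c • k) v = c * oddAt G V k v := by
  simp [oddAt, Finset.mul_sum, mul_left_comm]

theorem oddAt_sum (G : SimpleGraph ℕ) (V : Finset ℕ) {ι : Type*} (t : Finset ι)
    (f : ι → ℕ → ZMod 2) (v : ℕ) :
    oddAt G V (∑ i ∈ t, f i) v = ∑ i ∈ t, oddAt G V (f i) v := by
  simp only [oddAt, Finset.sum_apply, Finset.mul_sum]
  rw [Finset.sum_comm]

theorem oddAt_single (G : SimpleGraph ℕ) {V : Finset ℕ} {w : ℕ} (hw : w ∈ V) (c : ZMod 2)
    (v : ℕ) : oddAt G V (Pi.single w c) v = adjBit G v w * c := by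
  rw [oddAt, Finset.sum_eq_single w]
  · simp
  · intro b _ hb
    simp [hb]
  · exact fun h => absurd hw h

theorem oddAt_eq_add_erase (G : SimpleGraph ℕ) {V : Finset ℕ} {w : ℕ} (hw : w ∈ V)
    (k : ℕ → ZMod 2) (v : ℕ) :
    oddAt G V k v = adjBit G v w * k w + oddAt G (V.erase w) k v :=
  (Finset.add_sum_erase V _ hw).symm

theorem oddAt_insert_of_eq_zero (G : SimpleGraph ℕ) {V : Finset ℕ} {w : ℕ}
    {k : ℕ → ZMod 2} (hk : k w = 0) (v : ℕ) : oddAt G (insert w V) k v = oddAt G V k v := by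
  rw [oddAt, oddAt, Finset.sum_insert_zero]
  rw [hk, mul_zero]

namespace Diagram

variable {m n : ℕ}

/-- A gFlow in terms of indicator functions and a rank function on the past. The odd
neighbourhood of a correction set may contain vertices of larger rank. -/
structure IsFlow (D : Diagram m n) (k : ℕ → ℕ → ZMod 2) (r : ℕ → ℕ) : Prop where
  mem : ∀ u ∈ D.past, ∀ v, k u v ≠ 0 → v ∈ D.verts
  notInput : ∀ u ∈ D.past, ∀ v, k u v ≠ 0 → ∀ i, D.input i ≠ v
  lt : ∀ u ∈ D.past, ∀ v ∈ D.past, k u v ≠ 0 → r u < r v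
  odd_self : ∀ u ∈ D.past, oddAt D.graph D.verts (k u) u = 1
  odd_lt : ∀ u ∈ D.past, ∀ v ∈ D.past, v ≠ u → oddAt D.graph D.verts (k u) v ≠ 0 → r u < r v

/-- A focused gFlow in terms of indicator functions and a rank function on the past. -/
structure IsFocusedFlow (D : Diagram m n) (k : ℕ → ℕ → ZMod 2) (r : ℕ → ℕ) : Prop where
  mem : ∀ u ∈ D.past, ∀ v, k u v ≠ 0 → v ∈ D.verts
  notInput : ∀ u ∈ D.past, ∀ v, k u v ≠ 0 → ∀ i, D.input i ≠ v
  lt : ∀ u ∈ D.past, ∀ v ∈ D.past, k u v ≠ 0 → r u < r v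
  odd : ∀ u ∈ D.past, ∀ v ∈ D.past,
    oddAt D.graph D.verts (k u) v = if v = u then 1 else 0

theorem oddAt_indicator (G : SimpleGraph ℕ) {V A : Finset ℕ} (hA : A ⊆ V) (v : ℕ)
    [DecidablePred (G.Adj v)] :
    oddAt G V (fun w => if w ∈ A then 1 else 0) v =
      ((A.filter fun w => G.Adj v w).card : ZMod 2) := by
  rw [Finset.card_filter, Nat.cast_sum, oddAt, ← Finset.sum_subset hA]
  · refine Finset.sum_congr rfl fun w hw => ?_
    by_cases h : G.Adj v w <;> simp [adjBit, h, hw]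
  · intro w _ hw
    simp [hw]

theorem past_eq (D : Diagram m n) : D.openGraph.verts \ D.openGraph.outputs = D.past := rfl

theorem mem_oddNbhd_iff {D : Diagram m n} {A : Finset ℕ} (hA : A ⊆ D.verts) {v : ℕ}
    (hv : v ∈ D.verts) : v ∈ D.openGraph.oddNbhd A ↔
      oddAt D.graph D.verts (fun w => if w ∈ A then 1 else 0) v = 1 := by
  classical
  have hv' : v ∈ D.openGraph.verts := hv
  rw [oddAt_indicator _ hA, ZMod.natCast_eq_one_iff_odd]
  simp only [OpenGraph.oddNbhd, Finset.mem_filter, hv', true_and]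
  rw [iff_iff_eq]
  congr

/-- Only finitely many vertices matter, so the partial order can be replaced by a rank with natural
values, which is easier to shift and extend. -/
theorem HasFocusedGFlow.exists_isFocusedFlow {D : Diagram m n} (h : D.HasFocusedGFlow) :
    ∃ k r, D.IsFocusedFlow k r := by
  classical
  obtain ⟨g, prec, h⟩ := h
  have hsub : ∀ u ∈ D.past, g u ⊆ D.verts := fun u hu =>
    (h.subset u hu).trans Finset.sdiff_subset
  -- The rank of `v` is its number of predecessors. If `u` precedes `v`, then `v` inherits all
  -- predecessors of `u` and has `u` itself in addition.
  refine ⟨fun u v => if v ∈ g u then 1 else 0, fun v => (D.verts.filter fun u => prec u v).card,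
    ?_, ?_, ?_, ?_⟩
  · intro u hu v hv
    exact hsub u hu (by simpa using hv)
  · intro u hu v hv i hi
    have := h.subset u hu (show v ∈ g u by simpa using hv)
    rw [Finset.mem_sdiff] at this
    exact this.2 (by simp [openGraph, ← hi])
  · intro u hu v _ hv
    have huv := h.lt u hu v (by simpa using hv)
    refine Finset.card_lt_card ((Finset.ssubset_iff_of_subset ?_).2 ⟨u, ?_, ?_⟩)
    · intro w hw
      rw [Finset.mem_filter] at hw ⊢
      exact ⟨hw.1, h.trans _ _ _ hw.2 huv⟩
    · exact Finset.mem_filter.2 ⟨(mem_past.1 hu).1, huv⟩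
    · simp [h.irrefl u]
  · intro u hu v hv
    have h1 : v ∈ D.openGraph.oddNbhd (g u) ↔ v = u := by
      have := h.odd u hu
      rw [Finset.ext_iff] at this
      have := this v
      rw [Finset.mem_inter, past_eq, Finset.mem_singleton] at this
      simpa [hv] using this
    rw [mem_oddNbhd_iff (hsub u hu) (mem_past.1 hv).1] at h1
    have h2 : ∀ z : ZMod 2, z ≠ 1 → z = 0 := by decide
    split_ifs with hvu
    · exact h1.2 hvu
    · exact h2 _ (mt h1.1 hvu)

theorem IsFocusedFlow.hasFocusedGFlow {D : Diagram m n} {k : ℕ → ℕ → ZMod 2} {r : ℕ → ℕ}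
    (h : D.IsFocusedFlow k r) : D.HasFocusedGFlow := by
  classical
  -- Outputs may occur in correction sets and must come later than every vertex they correct, so
  -- they are placed just above the maximal rank of the past.
  set R : ℕ → ℕ := fun v => if v ∈ D.past then r v else D.past.sup r + 1 with hR
  have hsub : ∀ u, (D.verts.filter fun v => k u v ≠ 0) ⊆ D.verts :=
    fun u => Finset.filter_subset _ _
  refine ⟨fun u => D.verts.filter fun v => k u v ≠ 0, fun u v => R u < R v, ?_, ?_, ?_, ?_, ?_⟩
  · intro u; exact lt_irrefl _
  · intro u v w; exact lt_trans
  · intro u hu v hv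
    rw [Finset.mem_filter] at hv
    rw [Finset.mem_sdiff]
    refine ⟨hv.1, ?_⟩
    intro hv'
    obtain ⟨i, _, hi⟩ := Finset.mem_image.1 hv'
    exact h.notInput u hu v hv.2 i hi
  · intro u hu
    rw [past_eq] at hu ⊢
    ext v
    rw [Finset.mem_inter, Finset.mem_singleton]
    have key : v ∈ D.past → (v ∈ D.openGraph.oddNbhd (D.verts.filter fun v => k u v ≠ 0) ↔
        v = u) := by
      intro hv
      have h1 := h.odd u hu v hv
      have hk : oddAt D.graph D.verts (k u) v = oddAt D.graph D.verts
          (fun w => if w ∈ D.verts.filter (fun v => k u v ≠ 0) then 1 else 0) v := by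
        refine oddAt_congr fun w hw => ?_
        congr 1
        simp only [Finset.mem_filter, hw, true_and]
        generalize k u w = z
        revert z; decide
      rw [mem_oddNbhd_iff (hsub u) (mem_past.1 hv).1, ← hk, h1]
      simp
    constructor
    · rintro ⟨h1, h2⟩; exact (key h2).1 h1
    · rintro rfl; exact ⟨(key hu).2 rfl, hu⟩
  · intro u hu v hv
    rw [past_eq] at hu
    rw [Finset.mem_filter] at hv
    simp only [hR, if_pos hu]
    split_ifs with hv'
    · exact h.lt u hu v hv' hv.2
    · exact Nat.lt_succ_of_le (Finset.le_sup hu)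

theorem hasFocusedGFlow_iff {D : Diagram m n} :
    D.HasFocusedGFlow ↔ ∃ k r, D.IsFocusedFlow k r :=
  ⟨HasFocusedGFlow.exists_isFocusedFlow, fun ⟨_, _, h⟩ => h.hasFocusedGFlow⟩

/-- A gFlow can be focused. -/
theorem IsFlow.hasFocusedGFlow {D : Diagram m n} {k : ℕ → ℕ → ZMod 2} {r : ℕ → ℕ}
    (h : D.IsFlow k r) : D.HasFocusedGFlow := by
  classical
  -- The induction runs downwards from the maximal rank, so focused correction sets are already
  -- available for all vertices later than `u`.
  have key : ∀ N, ∀ u ∈ D.past, D.past.sup r - r u ≤ N → ∃ f : ℕ → ZMod 2,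
      (∀ v, f v ≠ 0 → v ∈ D.verts ∧ (∀ i, D.input i ≠ v) ∧ (v ∈ D.past → r u < r v)) ∧
      ∀ v ∈ D.past, oddAt D.graph D.verts f v = if v = u then 1 else 0 := by
    intro N
    induction N using Nat.strong_induction_on with
    | _ N ih =>
      intro u hu hN
      -- The existence is made total, with the value 0 where nothing is claimed, so that a function
      -- of `v` can be chosen.
      have hex : ∀ v, ∃ f : ℕ → ZMod 2, (v ∈ D.past → r u < r v →
          (∀ w, f w ≠ 0 → w ∈ D.verts ∧ (∀ i, D.input i ≠ w) ∧ (w ∈ D.past → r v < r w)) ∧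
          ∀ w ∈ D.past, oddAt D.graph D.verts f w = if w = v then 1 else 0) := by
        intro v
        by_cases hv : v ∈ D.past ∧ r u < r v
        · have h1 : r v ≤ D.past.sup r := Finset.le_sup hv.1
          obtain ⟨f, hf⟩ := ih (D.past.sup r - r v) (by omega) v hv.1 le_rfl
          exact ⟨f, fun _ _ => hf⟩
        · exact ⟨0, fun h1 h2 => absurd ⟨h1, h2⟩ hv⟩
      choose F hF using hex
      -- `T` collects the unwanted odd vertices. They are all later than `u`, and adding the focused
      -- set of each removes exactly that vertex from the odd neighbourhood without disturbing the
      -- rest of the past.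
      set T := D.past.filter fun v => v ≠ u ∧ oddAt D.graph D.verts (k u) v ≠ 0 with hT
      have hTlt : ∀ v ∈ T, v ∈ D.past ∧ r u < r v := by
        intro v hv
        rw [hT, Finset.mem_filter] at hv
        exact ⟨hv.1, h.odd_lt u hu v hv.1 hv.2.1 hv.2.2⟩
      refine ⟨k u + ∑ v ∈ T, F v, ?_, ?_⟩
      · intro w hw
        have : k u w ≠ 0 ∨ ∃ v ∈ T, F v w ≠ 0 := by
          by_contra hcon
          push Not at hcon
          apply hw
          rw [Pi.add_apply, Finset.sum_apply, hcon.1, Finset.sum_eq_zero hcon.2, add_zero]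
        rcases this with h1 | ⟨v, hv, h1⟩
        · exact ⟨h.mem u hu w h1, h.notInput u hu w h1, fun h2 => h.lt u hu w h2 h1⟩
        · obtain ⟨h2, h3⟩ := hTlt v hv
          obtain ⟨h4, h5, h6⟩ := (hF v h2 h3).1 w h1
          exact ⟨h4, h5, fun h7 => h3.trans (h6 h7)⟩
      · intro w hw
        rw [oddAt_add, oddAt_sum]
        have h1 : ∑ v ∈ T, oddAt D.graph D.verts (F v) w = if w ∈ T then 1 else 0 := by
          rw [Finset.sum_congr rfl fun v hv => (hF v (hTlt v hv).1 (hTlt v hv).2).2 w hw]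
          simp
        rw [h1]
        by_cases hwu : w = u
        · subst hwu
          simp [hT, h.odd_self w hw]
        · have : ∀ z : ZMod 2, z + (if z ≠ 0 then 1 else 0) = 0 := by decide
          have hwT : w ∈ T ↔ oddAt D.graph D.verts (k u) w ≠ 0 := by
            simp [hT, hw, hwu]
          simp only [if_neg hwu, hwT, this]
  have hex : ∀ u, ∃ f : ℕ → ZMod 2, u ∈ D.past →
      (∀ v, f v ≠ 0 → v ∈ D.verts ∧ (∀ i, D.input i ≠ v) ∧ (v ∈ D.past → r u < r v)) ∧
      ∀ v ∈ D.past, oddAt D.graph D.verts f v = if v = u then 1 else 0 := by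
    intro u
    by_cases hu : u ∈ D.past
    · obtain ⟨f, hf⟩ := key _ u hu le_rfl
      exact ⟨f, fun _ => hf⟩
    · exact ⟨0, fun h => absurd h hu⟩
  choose F hF using hex
  exact hasFocusedGFlow_iff.2 ⟨F, r, fun u hu v hv => ((hF u hu).1 v hv).1,
    fun u hu v hv => ((hF u hu).1 v hv).2.1, fun u hu v hv hk => ((hF u hu).1 v hk).2.2 hv,
    fun u hu => (hF u hu).2⟩

theorem hasFocusedGFlow_of_past_eq_empty {D : Diagram m n} (h : D.past = ∅) :
    D.HasFocusedGFlow :=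
  IsFlow.hasFocusedGFlow (k := 0) (r := 0) (by constructor <;> simp [h])

/-- The existence of a gFlow depends only on the edges that are incident to the past. -/
theorem HasFocusedGFlow.congr {D E : Diagram m n} (h : D.HasFocusedGFlow)
    (hV : E.verts = D.verts) (hP : E.past = D.past)
    (hI : ∀ v, (∃ i, E.input i = v) → ∃ i, D.input i = v)
    (hG : ∀ v ∈ D.past, ∀ w, (E.graph.Adj v w ↔ D.graph.Adj v w)) : E.HasFocusedGFlow := by
  obtain ⟨k, r, h⟩ := h.exists_isFocusedFlow
  refine IsFocusedFlow.hasFocusedGFlow (k := k) (r := r) ⟨?_, ?_, ?_, ?_⟩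
  · rw [hP, hV]; exact h.mem
  · rw [hP]
    intro u hu v hv i hi
    obtain ⟨j, hj⟩ := hI v ⟨i, hi⟩
    exact h.notInput u hu v hv j hj
  · rw [hP]; exact h.lt
  · rw [hP, hV]
    intro u hu v hv
    rw [← h.odd u hu v hv]
    exact oddAt_congr fun w _ => by rw [adjBit_congr (hG v hv w)]

end Diagram

/-! ### Preservation of gFlow under the rewrites -/

namespace Diagram

variable {m n : ℕ}

theorem zmod_two_cases (a : ZMod 2) : a = 0 ∨ a = 1 := by
  revert a; decide

theorem mem_past_of_adj_output {D : Diagram m n} (hD : D.WellFormed) (hP : D.Prepared)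
    {q : Fin n} {v : ℕ} (h : D.graph.Adj (D.output q) v) : v ∈ D.past := by
  refine mem_past.2 ⟨hD.mem_of_adj h, ?_⟩
  rintro p rfl
  exact hP.disconnected _ _ h

theorem addRow_adj {D : Diagram m n} {src dst : Fin n} {v w : ℕ} :
    (D.addRow src dst).graph.Adj v w ↔ ¬ (D.graph.Adj v w ↔
      ((v = D.output dst ∧ w ∈ D.row src) ∨ (w = D.output dst ∧ v ∈ D.row src))) := by
  have h1 : D.output dst ∉ D.row src := D.output_notMem_row dst src
  rw [addRow, symmDiff_adj, SimpleGraph.fromRel_adj]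
  have : (v ≠ w ∧ ((v = D.output dst ∧ w ∈ D.row src) ∨ (w = D.output dst ∧ v ∈ D.row src))) ↔
      ((v = D.output dst ∧ w ∈ D.row src) ∨ (w = D.output dst ∧ v ∈ D.row src)) := by
    refine ⟨fun h => h.2, fun h => ⟨?_, h⟩⟩
    rintro rfl
    rcases h with ⟨rfl, h⟩ | ⟨rfl, h⟩ <;> exact h1 h
  rw [this]

/-- Correction sets that contain the spider of `dst` get the spider of `src` toggled. The links
added at `dst` and the toggled `src` then contribute the same parity at every past vertex, and
cancel. The spider of `src` is allowed since it is no input, and ranks on the past are not involved.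
-/
theorem HasFocusedGFlow.addRow {D : Diagram m n} (hD : D.WellFormed)
    {src dst : Fin n} (h : dst ≠ src) (hI : ∀ i, D.input i ≠ D.output src)
    (hF : D.HasFocusedGFlow) : (D.addRow src dst).HasFocusedGFlow := by
  obtain ⟨k, r, hF⟩ := hF.exists_isFocusedFlow
  have hpast : (D.addRow src dst).past = D.past := rfl
  have hne : ∀ u, ∀ v, v ≠ D.output src →
      (k u + (Pi.single (D.output src) (k u (D.output dst)) : ℕ → ZMod 2)) v = k u v := by
    intro u v hv
    simp [hv]
  refine IsFocusedFlow.hasFocusedGFlow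
    (k := fun u => k u + Pi.single (D.output src) (k u (D.output dst))) (r := r) ⟨?_, ?_, ?_, ?_⟩
  · intro u hu v hv
    by_cases hvs : v = D.output src
    · rw [hvs]; exact hD.output_mem src
    · rw [hne u v hvs] at hv
      exact hF.mem u hu v hv
  · intro u hu v hv
    by_cases hvs : v = D.output src
    · rw [hvs]; exact hI
    · rw [hne u v hvs] at hv
      exact hF.notInput u hu v hv
  · intro u hu v hv' hv
    rw [hpast] at hv'
    rw [hne u v fun e => (mem_past.1 hv').2 src e.symm] at hv
    exact hF.lt u hu v hv' hv
  · intro u hu v hv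
    rw [hpast] at hv hu
    rw [← hF.odd u hu v hv]
    have hvd : v ≠ D.output dst := fun e => (mem_past.1 hv).2 dst e.symm
    have hds : D.output dst ≠ D.output src := fun e => h (hD.output_inj e)
    have key : ∀ w, adjBit (D.addRow src dst).graph v w = adjBit D.graph v w +
        (Pi.single (D.output dst) (adjBit D.graph v (D.output src)) : ℕ → ZMod 2) w := by
      intro w
      by_cases hw : w = D.output dst
      · subst hw
        have h1 := addRow_adj (D := D) (src := src) (dst := dst) (v := v) (w := D.output dst)
        simp only [hvd, false_and, true_and, false_or, mem_row, hv,
          D.graph.adj_comm (D.output src)] at h1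
        by_cases h2 : D.graph.Adj v (D.output src) <;>
          by_cases h3 : D.graph.Adj v (D.output dst) <;>
          (simp [adjBit, h1, h2, h3]; try decide)
      · have h1 := addRow_adj (D := D) (src := src) (dst := dst) (v := v) (w := w)
        simp only [hvd, hw, false_and, false_or, iff_false, not_not] at h1
        simp [hw, adjBit_congr h1]
    change oddAt _ D.verts _ v = _
    rw [oddAt_add, oddAt_single _ (hD.output_mem src), key]
    have h2 : oddAt (D.addRow src dst).graph D.verts (k u) v = oddAt D.graph D.verts (k u) v +
        adjBit D.graph v (D.output src) * k u (D.output dst) := by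
      simp only [oddAt, key, add_mul, Finset.sum_add_distrib]
      congr 1
      rw [Finset.sum_eq_single (D.output dst)]
      · simp
      · intro b _ hb
        simp [hb]
      · exact fun h => absurd (hD.output_mem dst) h
    rw [h2, Pi.single_eq_of_ne hds.symm, add_zero, add_assoc, zmod_two_add_self, add_zero]

/-- Removing a frontier spider with a single neighbour `v`, and replacing it by `v`. -/
theorem HasFocusedGFlow.advance {D E : Diagram m n} {w v : ℕ} (hwV : w ∈ D.verts)
    (hadj : ∀ x, D.graph.Adj w x → x ∉ D.past.erase v)
    (hV : E.verts = D.verts.erase w) (hP : E.past = D.past.erase v)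
    (hI : ∀ i, E.input i = D.input i) (hG : E.graph = D.graph.deleteIncidenceSet w)
    (hw : w ∉ D.past) (hF : D.HasFocusedGFlow) : E.HasFocusedGFlow := by
  obtain ⟨k, r, hF⟩ := hF.exists_isFocusedFlow
  -- It suffices to delete `w` from all correction sets: the only past vertex whose parity could
  -- depend on `w` is `v`, which leaves the past.
  refine IsFocusedFlow.hasFocusedGFlow (k := fun u => Function.update (k u) w 0) (r := r)
    ⟨?_, ?_, ?_, ?_⟩
  · intro u hu x hx
    have hxw : x ≠ w := by rintro rfl; simp at hx
    rw [Function.update_of_ne hxw] at hx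
    rw [hP] at hu
    rw [hV, Finset.mem_erase]
    exact ⟨hxw, hF.mem u (Finset.mem_of_mem_erase hu) x hx⟩
  · intro u hu x hx i
    have hxw : x ≠ w := by rintro rfl; simp at hx
    rw [Function.update_of_ne hxw] at hx
    rw [hP] at hu
    rw [hI]
    exact hF.notInput u (Finset.mem_of_mem_erase hu) x hx i
  · intro u hu x hx' hx
    have hxw : x ≠ w := by rintro rfl; simp at hx
    rw [Function.update_of_ne hxw] at hx
    rw [hP] at hu hx'
    exact hF.lt u (Finset.mem_of_mem_erase hu) x (Finset.mem_of_mem_erase hx') hx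
  · intro u hu x hx
    rw [hP] at hu hx
    have hxw : x ≠ w := by rintro rfl; exact hw (Finset.mem_of_mem_erase hx)
    rw [← hF.odd u (Finset.mem_of_mem_erase hu) x (Finset.mem_of_mem_erase hx), hV,
      oddAt_eq_add_erase _ hwV, adjBit_of_not_adj fun h => hadj x h.symm hx, zero_mul, zero_add]
    refine oddAt_congr fun y hy => ?_
    have hyw : y ≠ w := Finset.ne_of_mem_erase hy
    have : E.graph.Adj x y ↔ D.graph.Adj x y := by
      rw [hG, SimpleGraph.deleteIncidenceSet_adj]
      tauto
    rw [adjBit_congr this, Function.update_of_ne hyw]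

theorem attach_adj {D : Diagram m n} {q : Fin n} {w x y : ℕ} (h : D.output q ≠ w) :
    (D.attach q w).graph.Adj x y ↔
      D.graph.Adj x y ∨ (x = D.output q ∧ y = w) ∨ (x = w ∧ y = D.output q) := by
  simp only [attach, SimpleGraph.sup_adj, SimpleGraph.edge_adj]
  grind

theorem WellFormed.attach {D : Diagram m n} (hD : D.WellFormed) (q : Fin n) {w : ℕ}
    (hw : w ∉ D.verts) : (D.attach q w).WellFormed := by
  have hne : D.output q ≠ w := fun h => hw (h ▸ hD.output_mem q)
  refine ⟨?_, ?_, ?_, hD.input_inj, ?_⟩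
  · intro u v h
    rw [attach_adj hne] at h
    change u ∈ insert w D.verts
    rw [Finset.mem_insert]
    rcases h with h | ⟨rfl, _⟩ | ⟨rfl, _⟩
    · exact Or.inr (hD.adj_mem _ _ h)
    · exact Or.inr (hD.output_mem q)
    · exact Or.inl rfl
  · exact fun i => Finset.mem_insert_of_mem (hD.input_mem i)
  · intro j
    change Function.update D.output q w j ∈ insert w D.verts
    by_cases hj : j = q
    · subst hj; simp
    · rw [Function.update_of_ne hj]
      exact Finset.mem_insert_of_mem (hD.output_mem j)
  · intro i j h
    change Function.update D.output q w i = Function.update D.output q w j at h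
    have hne' : ∀ j, D.output j ≠ w := fun j h => hw (h ▸ hD.output_mem j)
    by_cases hi : i = q <;> by_cases hj : j = q
    · rw [hi, hj]
    · subst hi
      rw [Function.update_self, Function.update_of_ne hj] at h
      exact absurd h.symm (hne' j)
    · subst hj
      rw [Function.update_self, Function.update_of_ne hi] at h
      exact absurd h (hne' i)
    · rw [Function.update_of_ne hi, Function.update_of_ne hj] at h
      exact hD.output_inj h

theorem attach_past {D : Diagram m n} (hD : D.WellFormed) (q : Fin n) {w : ℕ}
    (hw : w ∉ D.verts) : (D.attach q w).past = insert (D.output q) D.past := by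
  have hne : ∀ j, D.output j ≠ w := fun j h => hw (h ▸ hD.output_mem j)
  ext v
  rw [Finset.mem_insert, mem_past, mem_past]
  change v ∈ insert w D.verts ∧ (∀ p, Function.update D.output q w p ≠ v) ↔ _
  rw [Finset.mem_insert]
  constructor
  · rintro ⟨h1, h2⟩
    have hvw : v ≠ w := by
      rintro rfl
      exact h2 q (by simp)
    by_cases hvq : v = D.output q
    · exact Or.inl hvq
    · refine Or.inr ⟨h1.resolve_left hvw, fun p hp => ?_⟩
      refine h2 p ?_
      rw [Function.update_of_ne, hp]
      rintro rfl
      exact hvq hp.symm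
  · rintro (rfl | ⟨h1, h2⟩)
    · refine ⟨Or.inr (hD.output_mem q), fun p => ?_⟩
      by_cases hp : p = q
      · subst hp; simpa using (hne p).symm
      · rw [Function.update_of_ne hp]
        exact fun e => hp (hD.output_inj e)
    · refine ⟨Or.inr h1, fun p => ?_⟩
      by_cases hp : p = q
      · subst hp
        rw [Function.update_self]
        rintro rfl
        exact hw h1
      · rw [Function.update_of_ne hp]
        exact h2 p

/-- The old output spider `v` joins the past with maximal rank and is corrected by the new output
`w`. In the past, `w` is adjacent only to `v`, so adding it to the other correction sets as needed
repairs the parity at `v` and changes nothing else. -/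
theorem HasFocusedGFlow.attach {D : Diagram m n} (hD : D.WellFormed) (q : Fin n) {w : ℕ}
    (hw : w ∉ D.verts) (hF : D.HasFocusedGFlow) : (D.attach q w).HasFocusedGFlow := by
  obtain ⟨k, r, hF⟩ := hF.exists_isFocusedFlow
  have hne : D.output q ≠ w := fun h => hw (h ▸ hD.output_mem q)
  have hVq := hD.output_mem q
  set v := D.output q with hv
  have hvp : v ∉ D.past := fun h => (mem_past.1 h).2 q rfl
  have hpast := attach_past hD q hw
  rw [← hv] at hpast
  have hpv : ∀ u ∈ D.past, u ≠ v := fun u hu h => hvp (h ▸ hu)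
  have hpw : ∀ u ∈ D.past, u ≠ w := fun u hu h => hw (h ▸ (mem_past.1 hu).1)
  have hkw : ∀ u ∈ D.past, k u w = 0 := by
    intro u hu
    by_contra h
    exact hw (hF.mem u hu w h)
  have hadj : ∀ x y, x ≠ w → y ≠ w → adjBit (D.attach q w).graph x y = adjBit D.graph x y := by
    intro x y hx hy
    apply adjBit_congr
    rw [attach_adj hne]
    simp [hx, hy]
  have hadjw : ∀ x ∈ insert v D.past, adjBit (D.attach q w).graph x w = if x = v then 1 else 0 := by
    intro x hx
    have hxw : x ≠ w := by
      rcases Finset.mem_insert.1 hx with rfl | hx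
      · exact hne
      · exact hpw x hx
    split_ifs with h
    · apply adjBit_of_adj
      rw [attach_adj hne]
      tauto
    · apply adjBit_of_not_adj
      rw [attach_adj hne]
      rintro (h1 | h1 | h1)
      · exact hD.not_adj hw _ h1.symm
      · exact h h1.1
      · exact hxw h1.1
  have hodd : ∀ u ∈ D.past, ∀ x, x ≠ w → oddAt (D.attach q w).graph (insert w D.verts) (k u) x =
      oddAt D.graph D.verts (k u) x := by
    intro u hu x hx
    rw [oddAt_insert_of_eq_zero _ (hkw u hu)]
    refine oddAt_congr fun y hy => ?_
    rw [hadj x y hx fun h => hw (h ▸ hy)]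
  have hvI : ∀ i, D.input i ≠ w := fun i h => hw (h ▸ hD.input_mem i)
  refine IsFocusedFlow.hasFocusedGFlow
    (k := fun u => if u = v then Pi.single w 1 else
      k u + Pi.single w (oddAt D.graph D.verts (k u) v))
    (r := Function.update r v (D.past.sup r + 1)) ⟨?_, ?_, ?_, ?_⟩
  · intro u hu x hx
    change x ∈ insert w D.verts
    rw [hpast, Finset.mem_insert] at hu
    rw [Finset.mem_insert]
    by_contra hcon
    push Not at hcon
    rcases hu with rfl | hu
    · simp [hcon.1] at hx
    · simp [hpv u hu, hcon.1] at hx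
      exact hcon.2 (hF.mem u hu x hx)
  · intro u hu x hx i
    rw [hpast, Finset.mem_insert] at hu
    by_cases hxw : x = w
    · rw [hxw]; exact hvI i
    rcases hu with rfl | hu
    · simp [hxw] at hx
    · simp [hpv u hu, hxw] at hx
      exact hF.notInput u hu x hx i
  · intro u hu x hx' hx
    rw [hpast, Finset.mem_insert] at hu hx'
    have hxw : x ≠ w := by
      rcases hx' with rfl | hx'
      · exact hne
      · exact hpw x hx'
    rcases hu with rfl | hu
    · simp [hxw] at hx
    · simp [hpv u hu, hxw] at hx
      rw [Function.update_of_ne (hpv u hu)]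
      rcases hx' with rfl | hx'
      · rw [Function.update_self]
        exact Nat.lt_succ_of_le (Finset.le_sup hu)
      · rw [Function.update_of_ne (hpv x hx')]
        exact hF.lt u hu x hx' hx
  · intro u hu x hx
    change oddAt _ (insert w D.verts) _ x = _
    rw [hpast] at hu hx
    have hx0 := hadjw x hx
    rw [Finset.mem_insert] at hu hx
    have hxw : x ≠ w := by
      rcases hx with rfl | hx'
      · exact hne
      · exact hpw x hx'
    rcases hu with rfl | hu
    · rw [if_pos rfl, oddAt_single _ (Finset.mem_insert_self _ _), hx0, mul_one]
    · rw [if_neg (hpv u hu), oddAt_add, oddAt_single _ (Finset.mem_insert_self _ _), hx0,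
        hodd u hu x hxw]
      rcases hx with rfl | hx
      · rw [if_pos rfl, one_mul, zmod_two_add_self, if_neg (hpv u hu).symm]
      · rw [if_neg (hpv x hx), zero_mul, add_zero, hF.odd u hu x hx]

/-- Insert the phaseless spider `w` before the spider of input `i`, joined to it by a Hadamard
edge, and compensate by a Hadamard on the input wire. -/
def attachInput (D : Diagram m n) (i : Fin m) (w : ℕ) : Diagram m n :=
  (D.reverse.attach i w).reverse

/-- Reversal is not available here, since gFlow treats inputs and outputs differently. The new input
`w` is corrected by its neighbour `v`, which has just ceased to be an input. Old correction sets
avoid `v`, so `w` is never in their odd neighbourhood. -/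
theorem HasFocusedGFlow.attachInput {D : Diagram m n} (hD : D.WellFormed) (i : Fin m) {w : ℕ}
    (hw : w ∉ D.verts) (hF : D.HasFocusedGFlow) : (D.attachInput i w).HasFocusedGFlow := by
  obtain ⟨k, r, hF⟩ := hF.exists_isFocusedFlow
  have hne : D.input i ≠ w := fun h => hw (h ▸ hD.input_mem i)
  have hVq := hD.input_mem i
  have hadj : ∀ {x y}, (D.attachInput i w).graph.Adj x y ↔
      D.graph.Adj x y ∨ (x = D.input i ∧ y = w) ∨ (x = w ∧ y = D.input i) :=
    attach_adj (D := D.reverse) (q := i) hne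
  have hinp : (D.attachInput i w).input = Function.update D.input i w := rfl
  have hverts : (D.attachInput i w).verts = insert w D.verts := rfl
  have hwo : ∀ j, D.output j ≠ w := fun j h => hw (h ▸ hD.output_mem j)
  have hpast : (D.attachInput i w).past = insert w D.past := by
    ext v
    rw [Finset.mem_insert, mem_past, mem_past, hverts, Finset.mem_insert]
    change (v = w ∨ v ∈ D.verts) ∧ (∀ q, D.output q ≠ v) ↔ _
    constructor
    · tauto
    · rintro (rfl | h)
      · exact ⟨Or.inl rfl, hwo⟩
      · tauto
  have hpw : ∀ u ∈ D.past, u ≠ w := fun u hu h => hw (h ▸ (mem_past.1 hu).1)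
  set v := D.input i with hv
  have hkw : ∀ u ∈ D.past, k u w = 0 := by
    intro u hu
    by_contra h
    exact hw (hF.mem u hu w h)
  have hodd : ∀ u ∈ D.past, ∀ x, x ≠ w →
      oddAt (D.attachInput i w).graph (insert w D.verts) (k u) x =
      oddAt D.graph D.verts (k u) x := by
    intro u hu x hx
    rw [oddAt_insert_of_eq_zero _ (hkw u hu)]
    refine oddAt_congr fun y hy => ?_
    have hyw : y ≠ w := fun h => hw (h ▸ hy)
    rw [adjBit_congr (hadj.trans (show _ ↔ D.graph.Adj x y by simp [hx, hyw]))]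
  have hkv : ∀ u ∈ D.past, k u v = 0 := by
    intro u hu
    by_contra h
    exact hF.notInput u hu v h i rfl
  have hoddw : ∀ u ∈ D.past, oddAt (D.attachInput i w).graph (insert w D.verts) (k u) w = 0 := by
    intro u hu
    rw [oddAt_insert_of_eq_zero _ (hkw u hu)]
    refine Finset.sum_eq_zero fun y hy => ?_
    by_cases hyv : y = v
    · rw [hyv, hkv u hu, mul_zero]
    · rw [adjBit_of_not_adj, zero_mul]
      rw [hadj]
      rintro (h | h | h)
      · exact hD.not_adj hw _ h
      · exact hne h.1.symm
      · exact hyv h.2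
  -- The set `{v}` has all neighbours of `v` in its odd neighbourhood, so the flow is not focused.
  -- Rank 0 for `w`, with the other ranks shifted by 1, puts all of them later than `w`.
  refine IsFlow.hasFocusedGFlow (k := fun u => if u = w then Pi.single v 1 else k u)
    (r := fun u => if u = w then 0 else r u + 1) ⟨?_, ?_, ?_, ?_, ?_⟩
  · intro u hu x hx
    rw [hpast, Finset.mem_insert] at hu
    rw [hverts, Finset.mem_insert]
    right
    rcases hu with rfl | hu
    · have : x = v := by
        by_contra h
        simp [h] at hx
      rw [this]; exact hVq
    · rw [if_neg (hpw u hu)] at hx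
      exact hF.mem u hu x hx
  · intro u hu x hx j
    rw [hpast, Finset.mem_insert] at hu
    rw [hinp]
    have hxw : x ≠ w ∧ (j ≠ i → D.input j ≠ x) := by
      rcases hu with rfl | hu
      · have : x = v := by
          by_contra h
          simp [h] at hx
        rw [this]
        exact ⟨hne, fun hj e => hj (hD.input_inj e)⟩
      · rw [if_neg (hpw u hu)] at hx
        exact ⟨fun h => hw (h ▸ hF.mem u hu x hx), fun _ => hF.notInput u hu x hx j⟩
    by_cases hj : j = i
    · rw [hj, Function.update_self]; exact hxw.1.symm
    · rw [Function.update_of_ne hj]; exact hxw.2 hj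
  · intro u hu x hx' hx
    rw [hpast, Finset.mem_insert] at hu hx'
    have hxw : x ≠ w := by
      rintro rfl
      rcases hu with rfl | hu
      · simp [hne.symm] at hx
      · rw [if_neg (hpw u hu), hkw u hu] at hx
        exact hx rfl
    rw [if_neg hxw]
    rcases hu with rfl | hu
    · rw [if_pos rfl]; omega
    · rw [if_neg (hpw u hu)] at hx ⊢
      have := hF.lt u hu x (hx'.resolve_left hxw) hx
      omega
  · intro u hu
    rw [hpast, Finset.mem_insert] at hu
    rw [hverts]
    rcases hu with rfl | hu
    · rw [if_pos rfl, oddAt_single _ (Finset.mem_insert_of_mem hVq), adjBit_of_adj, one_mul]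
      rw [hadj]; tauto
    · rw [if_neg (hpw u hu), hodd u hu u (hpw u hu), hF.odd u hu u hu, if_pos rfl]
  · intro u hu x hx hxu ho
    rw [hpast, Finset.mem_insert] at hu hx
    rw [hverts] at ho
    rcases hu with rfl | hu
    · rw [if_pos rfl, if_neg hxu]; omega
    · rw [if_neg (hpw u hu)] at ho
      rcases hx with rfl | hx
      · exact absurd (hoddw u hu) ho
      · rw [hodd u hu x (hpw x hx), hF.odd u hu x hx, if_neg hxu] at ho
        exact absurd rfl ho

theorem lcSimp_past {D : Diagram m n} (u : ℕ) : (D.lcSimp u).past = D.past.erase u := by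
  ext v
  rw [Finset.mem_erase, mem_past, mem_past]
  change v ∈ D.verts.erase u ∧ _ ↔ _
  rw [Finset.mem_erase, and_assoc]
  rfl

/-- A correction set that contains `u` absorbs the correction set of `u`, after which `u` is
deleted. The parity at `x` then becomes [x = w] plus the adjacency of `u` and `x` times membership
of `x` in the new set. Any further odd vertex thus lies in the set, hence is later than `w`: a flow,
though not a focused one. -/
theorem HasFocusedGFlow.lcSimp {D : Diagram m n} {u : ℕ} (hu : D.IsInterior u)
    (hF : D.HasFocusedGFlow) : (D.lcSimp u).HasFocusedGFlow := by
  classical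
  obtain ⟨k, r, hF⟩ := hF.exists_isFocusedFlow
  have hup : u ∈ D.past := mem_past.2 ⟨hu.1, hu.2.2⟩
  have hkuu : k u u = 0 := by
    by_contra h
    exact lt_irrefl _ (hF.lt u hup u hup h)
  have hpast := lcSimp_past (D := D) u
  have hverts : (D.lcSimp u).verts = D.verts.erase u := rfl
  set f : ℕ → ℕ → ZMod 2 := fun w => k w + k w u • k u with hf
  have hfor : ∀ w x, f w x ≠ 0 → k w x ≠ 0 ∨ (k w u ≠ 0 ∧ k u x ≠ 0) := by
    intro w x h
    by_contra hcon
    push Not at hcon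
    apply h
    by_cases h2 : k w u = 0
    · simp [hf, hcon.1, h2]
    · simp [hf, hcon.1, hcon.2 h2]
  have hfu : ∀ w, f w u = k w u := by
    intro w
    simp [hf, hkuu]
  have hlt : ∀ w ∈ D.past, ∀ x ∈ D.past, f w x ≠ 0 → r w < r x := by
    intro w hw x hx h
    rcases hfor w x h with h | ⟨h1, h2⟩
    · exact hF.lt w hw x hx h
    · exact (hF.lt w hw u hup h1).trans (hF.lt u hup x hx h2)
  have hoddf : ∀ w ∈ D.past, ∀ x ∈ D.past, oddAt D.graph D.verts (f w) x =
      (if x = w then 1 else 0) + k w u * (if x = u then 1 else 0) := by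
    intro w hw x hx
    rw [hf, oddAt_add, oddAt_smul, hF.odd w hw x hx, hF.odd u hup x hx]
  -- The product formula would create a loop at each neighbour of `u`; the diagonal term removes it.
  -- It is also the source of the defect in the focusing.
  have hA : ∀ x y, x ≠ u → y ≠ u → adjBit (D.lcSimp u).graph x y =
      adjBit D.graph x y + adjBit D.graph u x * adjBit D.graph u y +
        if x = y then adjBit D.graph u x else 0 := by
    intro x y hx hy
    by_cases hxy : x = y
    · subst hxy
      rw [adjBit_of_not_adj (SimpleGraph.irrefl _), adjBit_of_not_adj (SimpleGraph.irrefl _),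
        if_pos rfl, zero_add]
      rcases zmod_two_cases (adjBit D.graph u x) with h | h <;> rw [h] <;> decide
    · rw [if_neg hxy, add_zero]
      have : (D.lcSimp u).graph.Adj x y ↔
          ¬ (D.graph.Adj x y ↔ (D.graph.Adj u x ∧ D.graph.Adj u y)) := by
        rw [Diagram.lcSimp, SimpleGraph.deleteIncidenceSet_adj, localComp_adj hxy]
        tauto
      by_cases h1 : D.graph.Adj x y <;> by_cases h2 : D.graph.Adj u x <;>
        by_cases h3 : D.graph.Adj u y <;> (simp [adjBit, this, h1, h2, h3]; try decide)
  have hodd : ∀ w ∈ D.past.erase u, ∀ x ∈ D.past.erase u,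
      oddAt (D.lcSimp u).graph (D.verts.erase u) (Function.update (f w) u 0) x =
        (if x = w then 1 else 0) + adjBit D.graph u x * f w x := by
    intro w hw x hx
    obtain ⟨hwu, hw⟩ := Finset.mem_erase.1 hw
    obtain ⟨hxu, hx⟩ := Finset.mem_erase.1 hx
    have h1 := hoddf w hw x hx
    have h2 := hoddf w hw u hup
    rw [oddAt_eq_add_erase _ hu.1, hfu] at h1 h2
    rw [if_neg hxu, mul_zero, add_zero] at h1
    rw [if_neg hwu.symm, if_pos rfl, mul_one, zero_add, adjBit_of_not_adj (SimpleGraph.irrefl _),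
      zero_mul, zero_add] at h2
    have h3 : oddAt (D.lcSimp u).graph (D.verts.erase u) (Function.update (f w) u 0) x =
        oddAt D.graph (D.verts.erase u) (f w) x +
          adjBit D.graph u x * oddAt D.graph (D.verts.erase u) (f w) u +
          adjBit D.graph u x * f w x := by
      have : adjBit D.graph u x * f w x = ∑ y ∈ D.verts.erase u,
          if x = y then adjBit D.graph u x * f w y else 0 := by
        rw [Finset.sum_ite_eq, if_pos (Finset.mem_erase.2 ⟨hxu, (mem_past.1 hx).1⟩)]
      rw [this]
      simp only [oddAt, Finset.mul_sum, ← Finset.sum_add_distrib]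
      refine Finset.sum_congr rfl fun y hy => ?_
      have hyu := Finset.ne_of_mem_erase hy
      rw [Function.update_of_ne hyu, hA x y hxu hyu]
      split_ifs <;> ring
    rw [h3, h2, adjBit_comm D.graph u x, ← h1]
    ring
  refine IsFlow.hasFocusedGFlow (k := fun w => Function.update (f w) u 0) (r := r)
    ⟨?_, ?_, ?_, ?_, ?_⟩
  · intro w hw x hx
    have hxu : x ≠ u := by rintro rfl; simp at hx
    rw [Function.update_of_ne hxu] at hx
    rw [hpast] at hw
    have hw := Finset.mem_of_mem_erase hw
    rw [hverts, Finset.mem_erase]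
    refine ⟨hxu, ?_⟩
    rcases hfor w x hx with h | ⟨_, h⟩
    · exact hF.mem w hw x h
    · exact hF.mem u hup x h
  · intro w hw x hx
    have hxu : x ≠ u := by rintro rfl; simp at hx
    rw [Function.update_of_ne hxu] at hx
    rw [hpast] at hw
    have hw := Finset.mem_of_mem_erase hw
    rcases hfor w x hx with h | ⟨_, h⟩
    · exact hF.notInput w hw x h
    · exact hF.notInput u hup x h
  · intro w hw x hx' hx
    have hxu : x ≠ u := by rintro rfl; simp at hx
    rw [Function.update_of_ne hxu] at hx
    rw [hpast] at hw hx'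
    exact hlt w (Finset.mem_of_mem_erase hw) x (Finset.mem_of_mem_erase hx') hx
  · intro w hw
    rw [hpast] at hw
    rw [hverts, hodd w hw w hw, if_pos rfl]
    have hw := Finset.mem_of_mem_erase hw
    have : f w w = 0 := by
      by_contra h
      exact lt_irrefl _ (hlt w hw w hw h)
    rw [this, mul_zero, add_zero]
  · intro w hw x hx hxw ho
    rw [hpast] at hw hx
    rw [hverts, hodd w hw x hx, if_neg hxw, zero_add] at ho
    exact hlt w (Finset.mem_of_mem_erase hw) x (Finset.mem_of_mem_erase hx)
      (right_ne_zero_of_mul ho)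

theorem pivotSimp_past {D : Diagram m n} (u v : ℕ) :
    (D.pivotSimp u v).past = (D.past.erase u).erase v := by
  ext x
  rw [Finset.mem_erase, Finset.mem_erase, mem_past, mem_past]
  change x ∈ (D.verts.erase u).erase v ∧ _ ↔ _
  rw [Finset.mem_erase, Finset.mem_erase, and_assoc, and_assoc]
  rfl

/-- Deleting `u` and `v` from the correction sets is enough, and the flow stays focused. The parity
conditions at `u` and `v`, which are joined by an edge, say that the rest of the set is seen by `v`
with the parity of the bit of `u`, and by `u` with that of `v`. The edges created by the pivot
therefore supply exactly the contributions lost at every other vertex. -/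
theorem HasFocusedGFlow.pivotSimp {D : Diagram m n} {u v : ℕ} (hu : D.IsInterior u)
    (hv : D.IsInterior v) (huv : D.graph.Adj u v)
    (hF : D.HasFocusedGFlow) : (D.pivotSimp u v).HasFocusedGFlow := by
  classical
  obtain ⟨k, r, hF⟩ := hF.exists_isFocusedFlow
  have hup : u ∈ D.past := mem_past.2 ⟨hu.1, hu.2.2⟩
  have hvp : v ∈ D.past := mem_past.2 ⟨hv.1, hv.2.2⟩
  have hpast := pivotSimp_past (D := D) u v
  have hverts : (D.pivotSimp u v).verts = (D.verts.erase u).erase v := rfl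
  have hmem : ∀ w ∈ D.pivotSimp u v |>.past, w ≠ u ∧ w ≠ v ∧ w ∈ D.past := by
    intro w hw
    rw [hpast, Finset.mem_erase, Finset.mem_erase] at hw
    tauto
  have hk : ∀ w x, Function.update (Function.update (k w) u 0) v 0 x ≠ 0 →
      x ≠ u ∧ x ≠ v ∧ k w x ≠ 0 := by
    intro w x hx
    have hxv : x ≠ v := by rintro rfl; simp at hx
    rw [Function.update_of_ne hxv] at hx
    have hxu : x ≠ u := by rintro rfl; simp at hx
    rw [Function.update_of_ne hxu] at hx
    exact ⟨hxu, hxv, hx⟩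
  have hA : ∀ x y, x ≠ u → x ≠ v → y ≠ u → y ≠ v → adjBit (D.pivotSimp u v).graph x y =
      adjBit D.graph x y + adjBit D.graph u x * adjBit D.graph v y +
        adjBit D.graph v x * adjBit D.graph u y := by
    intro x y hxu hxv hyu hyv
    by_cases hxy : x = y
    · subst hxy
      rw [adjBit_of_not_adj (SimpleGraph.irrefl _), adjBit_of_not_adj (SimpleGraph.irrefl _),
        zero_add, mul_comm, zmod_two_add_self]
    · have : (D.pivotSimp u v).graph.Adj x y ↔ ¬ (D.graph.Adj x y ↔
          ¬ ((D.graph.Adj u x ∧ D.graph.Adj v y) ↔ (D.graph.Adj v x ∧ D.graph.Adj u y))) := by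
        rw [Diagram.pivotSimp, SimpleGraph.deleteIncidenceSet_adj,
          SimpleGraph.deleteIncidenceSet_adj, pivot_adj huv hxy hxu hxv hyu hyv]
        tauto
      by_cases h1 : D.graph.Adj x y <;> by_cases h2 : D.graph.Adj u x <;>
        by_cases h3 : D.graph.Adj v y <;> by_cases h4 : D.graph.Adj v x <;>
        by_cases h5 : D.graph.Adj u y <;> simp [adjBit, this, h1, h2, h3, h4, h5] <;> decide
  refine IsFocusedFlow.hasFocusedGFlow
    (k := fun w => Function.update (Function.update (k w) u 0) v 0) (r := r) ⟨?_, ?_, ?_, ?_⟩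
  · intro w hw x hx
    obtain ⟨h1, h2, h3⟩ := hk w x hx
    rw [hverts, Finset.mem_erase, Finset.mem_erase]
    exact ⟨h2, h1, hF.mem w (hmem w hw).2.2 x h3⟩
  · intro w hw x hx
    exact hF.notInput w (hmem w hw).2.2 x (hk w x hx).2.2
  · intro w hw x hx' hx
    exact hF.lt w (hmem w hw).2.2 x (hmem x hx').2.2 (hk w x hx).2.2
  · intro w hw x hx
    obtain ⟨hwu, hwv, hw⟩ := hmem w hw
    obtain ⟨hxu, hxv, hx⟩ := hmem x hx
    have hv' : v ∈ D.verts.erase u := Finset.mem_erase.2 ⟨huv.ne.symm, hv.1⟩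
    have h1 := hF.odd w hw x hx
    have h2 := hF.odd w hw u hup
    have h3 := hF.odd w hw v hvp
    rw [oddAt_eq_add_erase _ hu.1, oddAt_eq_add_erase _ hv'] at h1 h2 h3
    rw [if_neg hwu.symm, adjBit_of_not_adj (SimpleGraph.irrefl _), adjBit_of_adj huv] at h2
    rw [if_neg hwv.symm, adjBit_of_not_adj (SimpleGraph.irrefl _), adjBit_of_adj huv.symm] at h3
    have h4 : oddAt (D.pivotSimp u v).graph ((D.verts.erase u).erase v)
          (Function.update (Function.update (k w) u 0) v 0) x =
        oddAt D.graph ((D.verts.erase u).erase v) (k w) x +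
          adjBit D.graph u x * oddAt D.graph ((D.verts.erase u).erase v) (k w) v +
          adjBit D.graph v x * oddAt D.graph ((D.verts.erase u).erase v) (k w) u := by
      simp only [oddAt, Finset.mul_sum, ← Finset.sum_add_distrib]
      refine Finset.sum_congr rfl fun y hy => ?_
      rw [Finset.mem_erase, Finset.mem_erase] at hy
      rw [Function.update_of_ne hy.1, Function.update_of_ne hy.2.1, hA x y hxu hxv hy.2.1 hy.1]
      ring
    rw [hverts, h4, ← h1, adjBit_comm D.graph u x, adjBit_comm D.graph v x]
    linear_combination adjBit D.graph x u * h3 + adjBit D.graph x v * h2 -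
      zmod_two_add_self (adjBit D.graph x u * k w u) -
      zmod_two_add_self (adjBit D.graph x v * k w v)

end Diagram

/-! ### Row operations on the biadjacency matrix -/

namespace Diagram

variable {m n : ℕ}

theorem mem_freeRows {D : Diagram m n} {q : Fin n} :
    q ∈ D.freeRows ↔ ∀ i, D.input i ≠ D.output q := by
  simp [freeRows]

theorem freeRows_nodup (D : Diagram m n) : D.freeRows.Nodup :=
  (List.nodup_finRange n).filter _

theorem WellFormed.addRow {D : Diagram m n} (hD : D.WellFormed) (src dst : Fin n) :
    (D.addRow src dst).WellFormed := by
  refine ⟨?_, hD.input_mem, hD.output_mem, hD.input_inj, hD.output_inj⟩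
  intro u v h
  change u ∈ D.verts
  by_contra hu
  rw [addRow_adj] at h
  have h1 := hD.not_adj hu v
  have h2 : u ≠ D.output dst := fun e => hu (e ▸ hD.output_mem dst)
  have h3 : u ∉ D.row src := fun e => hu (mem_past.1 (mem_row.1 e).1).1
  tauto

theorem Prepared.addRow {D : Diagram m n} (hP : D.Prepared) (src dst : Fin n) :
    (D.addRow src dst).Prepared := by
  refine ⟨hP.plain, hP.phaseless, ?_⟩
  intro p q h
  change (D.addRow src dst).graph.Adj (D.output p) (D.output q) at h
  rw [addRow_adj] at h
  have h1 := hP.disconnected p q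
  have h2 := D.output_notMem_row p src
  have h3 := D.output_notMem_row q src
  tauto

theorem row_addRow_self {D : Diagram m n} {src dst : Fin n} :
    (D.addRow src dst).row dst = symmDiff (D.row dst) (D.row src) := by
  ext v
  rw [mem_row, Finset.mem_symmDiff, mem_row]
  change v ∈ D.past ∧ (D.addRow src dst).graph.Adj (D.output dst) v ↔ _
  rw [addRow_adj]
  have h1 := D.output_notMem_row dst src
  have h2 : v ∈ D.row src → v ∈ D.past := fun h => (mem_row.1 h).1
  tauto

theorem row_addRow_of_ne {D : Diagram m n} (hD : D.WellFormed) {src dst q : Fin n}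
    (h : q ≠ dst) : (D.addRow src dst).row q = D.row q := by
  ext v
  rw [mem_row, mem_row]
  change v ∈ D.past ∧ (D.addRow src dst).graph.Adj (D.output q) v ↔ _
  rw [addRow_adj]
  have h1 : D.output q ≠ D.output dst := fun e => h (hD.output_inj e)
  have h2 := D.output_notMem_row q src
  tauto

theorem biadj_addRow {D : Diagram m n} (hD : D.WellFormed) (src dst : Fin n) :
    (D.addRow src dst).biadj = Matrix.updateRow D.biadj dst (D.biadj dst + D.biadj src) := by
  ext q v
  by_cases hq : q = dst
  · subst hq
    rw [Matrix.updateRow_self, Pi.add_apply]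
    simp only [biadj, row_addRow_self, Finset.mem_symmDiff]
    by_cases h1 : v ∈ D.row q <;> by_cases h2 : v ∈ D.row src <;> simp [h1, h2]
    decide
  · rw [Matrix.updateRow_ne hq]
    simp only [biadj, row_addRow_of_ne hD hq]

theorem addRow_eval {D : Diagram m n} (hD : D.WellFormed) (hP : D.Prepared)
    {src dst : Fin n} (h : dst ≠ src) (hI : ∀ i, D.input i ≠ D.output src) :
    EqUpToScalar D.eval ((Gate.cnot dst src h).toMatrix * (D.addRow src dst).eval) :=
  eval_equiv_mul (EqUpToScalar.of_eq (contraction_addRow hD hP h hI))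

end Diagram

namespace ExtractState

open Diagram

variable {m n : ℕ}

/-- `T` is obtained from `S` by steps that preserve well-formedness, the existence of a gFlow and
the linear map. -/
structure Valid (S T : ExtractState m n) : Prop where
  wf : T.diagram.WellFormed
  flow : S.diagram.HasFocusedGFlow → T.diagram.HasFocusedGFlow
  eval : EqUpToScalar T.eval S.eval

theorem Valid.refl {S : ExtractState m n} (h : S.diagram.WellFormed) : Valid S S :=
  ⟨h, id, EqUpToScalar.refl _⟩

theorem Valid.trans {S T U : ExtractState m n} (h : Valid S T) (h' : Valid T U) : Valid S U :=
  ⟨h'.wf, fun hF => h'.flow (h.flow hF), h'.eval.trans h.eval⟩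

/-- The gate just extracted acts directly after the remaining diagram and before all gates extracted
earlier, so it goes to the head of the list. -/
theorem eval_cons {D E : Diagram m n} {C : Circuit n} {g : Gate n}
    (h : EqUpToScalar D.eval (g.toMatrix * E.eval)) :
    EqUpToScalar (ExtractState.mk E (g :: C)).eval (ExtractState.mk D C).eval := by
  refine EqUpToScalar.trans (EqUpToScalar.of_eq ?_) (h.symm.mul_left C.eval)
  simp only [eval, Circuit.eval, Matrix.mul_assoc]

/-! ### Extracting single-qubit gates and CZ gates -/

theorem unfuseHad_diagram (S : ExtractState m n) (q : Fin n) : (S.unfuseHad q).diagram =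
    { S.diagram with outputHad := Function.update S.diagram.outputHad q false } := by
  unfold unfuseHad
  split_ifs with h
  · rfl
  · rw [← Bool.eq_false_of_not_eq_true h, Function.update_eq_self]

theorem unfusePhase_diagram (S : ExtractState m n) (q : Fin n) : (S.unfusePhase q).diagram =
    { S.diagram with
      phase := Function.update S.diagram.phase (S.diagram.output q) 0 } := by
  unfold unfusePhase
  split_ifs with h
  · rfl
  · rw [not_not] at h
    rw [← h, Function.update_eq_self]

theorem unfuseCZ_diagram (S : ExtractState m n) (p : Fin n × Fin n) : (S.unfuseCZ p).diagram =
    { S.diagram with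
      graph := S.diagram.graph.deleteEdges
        {s(S.diagram.output p.1, S.diagram.output p.2)} } := by
  unfold unfuseCZ
  split_ifs with h
  · rfl
  · have : ¬ S.diagram.graph.Adj (S.diagram.output p.1) (S.diagram.output p.2) := by
      intro h'
      refine h ⟨?_, h'⟩
      intro e
      rw [e] at h'
      exact h'.ne rfl
    have h2 : S.diagram.graph.deleteEdges {s(S.diagram.output p.1, S.diagram.output p.2)} =
        S.diagram.graph := by
      rw [SimpleGraph.deleteEdges_eq_self]
      simpa using this
    rw [h2]

theorem unfuseHad_valid {S : ExtractState m n} (hD : S.diagram.WellFormed) (q : Fin n) :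
    Valid S (S.unfuseHad q) := by
  refine ⟨?_, fun hF => ?_, ?_⟩
  · rw [unfuseHad_diagram]
    exact ⟨hD.adj_mem, hD.input_mem, hD.output_mem, hD.input_inj, hD.output_inj⟩
  · refine hF.congr ?_ ?_ ?_ ?_ <;> rw [unfuseHad_diagram]
    · rfl
    · exact fun v h => h
    · exact fun _ _ _ => Iff.rfl
  · unfold unfuseHad
    split_ifs with h
    · refine eval_cons ?_
      have h1 := S.diagram.eval_had_mul q
      rwa [applyHad, h] at h1
    · exact EqUpToScalar.refl _

theorem unfusePhase_valid {S : ExtractState m n} (hD : S.diagram.WellFormed) (q : Fin n)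
    (hq : S.diagram.outputHad q = false) : Valid S (S.unfusePhase q) := by
  refine ⟨?_, fun hF => ?_, ?_⟩
  · rw [unfusePhase_diagram]
    exact ⟨hD.adj_mem, hD.input_mem, hD.output_mem, hD.input_inj, hD.output_inj⟩
  · refine hF.congr ?_ ?_ ?_ ?_ <;> rw [unfusePhase_diagram]
    · rfl
    · exact fun v h => h
    · exact fun _ _ _ => Iff.rfl
  · unfold unfusePhase
    split_ifs with h
    · refine eval_cons (eval_equiv_mul (EqUpToScalar.of_eq ?_))
      rw [← contraction_addPhase]
      · simp
      · exact hq
    · exact EqUpToScalar.refl _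

theorem unfuseCZ_valid {S : ExtractState m n} (hD : S.diagram.WellFormed)
    (hp : ∀ q, S.diagram.outputHad q = false) (p : Fin n × Fin n) : Valid S (S.unfuseCZ p) := by
  refine ⟨?_, fun hF => ?_, ?_⟩
  · rw [unfuseCZ_diagram]
    refine ⟨?_, hD.input_mem, hD.output_mem, hD.input_inj, hD.output_inj⟩
    intro u v h
    exact hD.adj_mem u v (SimpleGraph.deleteEdges_adj.1 h).1
  · refine hF.congr ?_ ?_ ?_ ?_ <;> rw [unfuseCZ_diagram]
    · rfl
    · exact fun v h => h
    -- The deleted edge has both ends on the frontier, so no past vertex loses a neighbour.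
    · intro v hv w
      rw [SimpleGraph.deleteEdges_adj]
      refine ⟨fun h => h.1, fun h => ⟨h, ?_⟩⟩
      have := (mem_past.1 hv).2
      rw [Set.mem_singleton_iff, Sym2.eq_iff]
      rintro (h' | h')
      · exact this _ h'.1.symm
      · exact this _ h'.1.symm
  · unfold unfuseCZ
    split_ifs with h
    · refine eval_cons (eval_equiv_mul (EqUpToScalar.of_eq ?_))
      rw [← contraction_symmDiff_edge]
      · congr 1
        -- The old graph is the new one with the edge toggled back in, which is the form in which CZ
        -- gates are evaluated.
        have : S.diagram.graph = symmDiff (S.diagram.graph.deleteEdges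
            {s(S.diagram.output p.1, S.diagram.output p.2)})
            (SimpleGraph.edge (S.diagram.output p.1) (S.diagram.output p.2)) := by
          ext v w
          rw [symmDiff_adj, SimpleGraph.deleteEdges_adj, SimpleGraph.edge_adj,
            Set.mem_singleton_iff, Sym2.eq_iff]
          have h1 := h.2
          have h2 := h.2.symm
          have h3 := h.2.ne
          constructor
          · intro h4
            have := h4.ne
            tauto
          · intro h4
            by_contra h5
            apply h4
            constructor
            · tauto
            · rintro ⟨⟨rfl, rfl⟩ | ⟨rfl, rfl⟩, _⟩ <;> tauto
        cases hS : S.diagram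
        rw [hS] at this
        simpa using this
      · exact hp _
      · exact hp _
      · exact fun e => h.1 (hD.output_inj e)
    · exact EqUpToScalar.refl _

/-- Outputs and all data other than the graph stay fixed along the fold, so the final graph can be
described in terms of the original outputs. -/
theorem foldl_unfuseCZ {L : List (Fin n × Fin n)} {S : ExtractState m n}
    (hD : S.diagram.WellFormed) (hp : ∀ q, S.diagram.outputHad q = false) :
    Valid S (L.foldl unfuseCZ S) ∧ ∃ G : SimpleGraph ℕ,
      (L.foldl unfuseCZ S).diagram = { S.diagram with graph := G } ∧
      ∀ x y, G.Adj x y ↔ S.diagram.graph.Adj x y ∧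
        ∀ p ∈ L, s(x, y) ≠ s(S.diagram.output p.1, S.diagram.output p.2) := by
  induction L generalizing S with
  | nil => exact ⟨Valid.refl hD, S.diagram.graph, rfl, by simp⟩
  | cons p L ih =>
    have hv := unfuseCZ_valid hD hp p
    have hd := S.unfuseCZ_diagram p
    obtain ⟨h1, G, h2, h3⟩ := ih (S := S.unfuseCZ p) hv.wf (by rw [hd]; exact hp)
    refine ⟨hv.trans h1, G, ?_, ?_⟩
    · rw [List.foldl_cons, h2, hd]
    · intro x y
      rw [h3, hd]
      simp only [SimpleGraph.deleteEdges_adj, Set.mem_singleton_iff, List.forall_mem_cons,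
        and_assoc]

theorem unfuseAllCZ_valid {S : ExtractState m n}
    (hD : S.diagram.WellFormed) (hp : ∀ q, S.diagram.outputHad q = false) :
    Valid S S.unfuseAllCZ := (foldl_unfuseCZ hD hp).1

theorem unfuseAllCZ_past {S : ExtractState m n}
    (hD : S.diagram.WellFormed) (hp : ∀ q, S.diagram.outputHad q = false) :
    S.unfuseAllCZ.diagram.past = S.diagram.past := by
  obtain ⟨_, G, h, _⟩ := foldl_unfuseCZ (L := List.finRange n ×ˢ List.finRange n) hD hp
  rw [unfuseAllCZ, h]
  rfl

theorem unfuseAllCZ_prepared {S : ExtractState m n}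
    (hD : S.diagram.WellFormed) (hp : ∀ q, S.diagram.outputHad q = false)
    (hph : ∀ q, S.diagram.phase (S.diagram.output q) = 0) : S.unfuseAllCZ.diagram.Prepared := by
  obtain ⟨_, G, h, hG⟩ := foldl_unfuseCZ (L := List.finRange n ×ˢ List.finRange n) hD hp
  rw [unfuseAllCZ, h]
  refine ⟨hp, hph, fun p q hpq => ?_⟩
  exact ((hG _ _).1 hpq).2 (p, q) (List.pair_mem_product.2
    ⟨List.mem_finRange p, List.mem_finRange q⟩) rfl

/-- The alternative "still to be treated, or already good" is the invariant that passes through the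
fold; later folds over qubits use the same device. -/
theorem foldl_unfuse {L : List (Fin n)} {S : ExtractState m n} (hD : S.diagram.WellFormed) :
    let T := L.foldl (fun S q => (S.unfuseHad q).unfusePhase q) S
    Valid S T ∧ T.diagram.past = S.diagram.past ∧ T.diagram.output = S.diagram.output ∧
      ∀ q, (q ∈ L ∨ (S.diagram.outputHad q = false ∧ S.diagram.phase (S.diagram.output q) = 0)) →
        T.diagram.outputHad q = false ∧ T.diagram.phase (T.diagram.output q) = 0 := by
  induction L generalizing S with
  | nil => exact ⟨Valid.refl hD, rfl, rfl, by simp⟩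
  | cons p L ih =>
    have h1 := unfuseHad_valid hD p
    have d1 := S.unfuseHad_diagram p
    have h2 := unfusePhase_valid h1.wf p (by rw [d1]; simp)
    have d2 := (S.unfuseHad p).unfusePhase_diagram p
    rw [d1] at d2
    obtain ⟨h3, h4, h5, h6⟩ := ih (S := (S.unfuseHad p).unfusePhase p) h2.wf
    refine ⟨(h1.trans h2).trans h3, ?_, ?_, ?_⟩
    · rw [List.foldl_cons, h4, d2]; rfl
    · rw [List.foldl_cons, h5, d2]
    · intro q hq
      rw [List.foldl_cons]
      apply h6
      rw [d2]
      simp only [List.mem_cons, or_assoc] at hq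
      rcases hq with rfl | hq | hq
      · right; simp
      · exact Or.inl hq
      · right
        constructor
        · by_cases hqp : q = p
          · rw [hqp]; simp
          · simp [hqp, hq.1]
        · by_cases hqp : S.diagram.output q = S.diagram.output p
          · simp [hqp]
          · simp [hqp, hq.2]

theorem prepare_spec {S : ExtractState m n} (hD : S.diagram.WellFormed) :
    Valid S S.prepare ∧ S.prepare.diagram.Prepared ∧
      S.prepare.diagram.past = S.diagram.past := by
  obtain ⟨h1, h2, _, h4⟩ := foldl_unfuse (L := List.finRange n) hD
  have hp := fun q => (h4 q (Or.inl (List.mem_finRange q))).1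
  have hph := fun q => (h4 q (Or.inl (List.mem_finRange q))).2
  refine ⟨h1.trans (unfuseAllCZ_valid h1.wf hp), unfuseAllCZ_prepared h1.wf hp hph, ?_⟩
  rw [prepare, unfuseAllCZ_past h1.wf hp, h2]

/-! ### Row operations -/

/-- `T` is obtained from `S` by row operations. -/
structure RowEquiv (S T : ExtractState m n) : Prop extends Valid S T where
  prepared : T.diagram.Prepared
  input_eq : T.diagram.input = S.diagram.input
  output_eq : T.diagram.output = S.diagram.output
  past_eq : T.diagram.past = S.diagram.past

theorem RowEquiv.refl {S : ExtractState m n} (h : S.diagram.WellFormed)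
    (hP : S.diagram.Prepared) : RowEquiv S S :=
  ⟨Valid.refl h, hP, rfl, rfl, rfl⟩

theorem RowEquiv.trans {S T U : ExtractState m n} (h : RowEquiv S T) (h' : RowEquiv T U) :
    RowEquiv S U :=
  ⟨h.toValid.trans h'.toValid, h'.prepared, h'.input_eq.trans h.input_eq,
    h'.output_eq.trans h.output_eq, h'.past_eq.trans h.past_eq⟩

theorem RowEquiv.freeRows_eq {S T : ExtractState m n} (h : RowEquiv S T) :
    T.diagram.freeRows = S.diagram.freeRows := by
  simp only [freeRows, h.input_eq, h.output_eq]

theorem addRow_rowEquiv {S : ExtractState m n} (hD : S.diagram.WellFormed)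
    (hP : S.diagram.Prepared) {src : Fin n} (hs : src ∈ S.diagram.freeRows) (dst : Fin n) :
    RowEquiv S (S.addRow src dst) := by
  rw [mem_freeRows] at hs
  unfold ExtractState.addRow
  split_ifs with h
  · exact ⟨⟨hD.addRow src dst, fun hF => hF.addRow hD h hs,
      eval_cons (addRow_eval hD hP h hs)⟩, hP.addRow src dst, rfl, rfl, rfl⟩
  · exact RowEquiv.refl hD hP

/-- Row `q` is never altered, so it keeps its 1 in column `v`. Another row loses that entry as soon
as it is treated, so it is changed at most once even if it is listed repeatedly. -/
theorem clearColumn_spec {rows : List (Fin n)} {S : ExtractState m n}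
    (hD : S.diagram.WellFormed) (hP : S.diagram.Prepared) {q : Fin n}
    (hq : q ∈ S.diagram.freeRows) {v : ℕ} (hv : v ∈ S.diagram.row q) :
    RowEquiv S (S.clearColumn q v rows) ∧
      (S.clearColumn q v rows).diagram.row q = S.diagram.row q ∧
      (∀ r ∈ rows, r ≠ q → v ∈ S.diagram.row r → (S.clearColumn q v rows).diagram.row r =
        symmDiff (S.diagram.row r) (S.diagram.row q)) ∧
      (∀ r, (r ∉ rows ∨ v ∉ S.diagram.row r) →
        (S.clearColumn q v rows).diagram.row r = S.diagram.row r) := by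
  induction rows generalizing S with
  | nil => exact ⟨RowEquiv.refl hD hP, rfl, by simp, fun _ _ => rfl⟩
  | cons a L ih =>
    set S₁ := if a ≠ q ∧ v ∈ S.diagram.row a then S.addRow q a else S with hS₁
    have hclear : S.clearColumn q v (a :: L) = S₁.clearColumn q v L := rfl
    rw [hclear]
    by_cases ha : a ≠ q ∧ v ∈ S.diagram.row a
    · rw [if_pos ha] at hS₁
      have h1 : RowEquiv S S₁ := hS₁ ▸ addRow_rowEquiv hD hP hq a
      have hd : S₁.diagram = S.diagram.addRow q a := by
        rw [hS₁, ExtractState.addRow, dif_pos ha.1]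
      have hrow : ∀ r, r ≠ a → S₁.diagram.row r = S.diagram.row r := fun r hr => by
        rw [hd, row_addRow_of_ne hD hr]
      have hrowa : S₁.diagram.row a = symmDiff (S.diagram.row a) (S.diagram.row q) := by
        rw [hd, row_addRow_self]
      have hva : v ∉ S₁.diagram.row a := by
        rw [hrowa, Finset.mem_symmDiff]
        tauto
      have hrowq := hrow q (Ne.symm ha.1)
      obtain ⟨i1, i2, i3, i4⟩ := ih h1.wf h1.prepared (h1.freeRows_eq ▸ hq) (hrowq ▸ hv)
      refine ⟨h1.trans i1, i2.trans hrowq, ?_, ?_⟩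
      · intro r hr hrq hvr
        by_cases hra : r = a
        · rw [hra, i4 a (Or.inr hva), hrowa]
        · have := hrow r hra
          rw [i3 r ((List.mem_cons.1 hr).resolve_left hra) hrq (this ▸ hvr), this, hrowq]
      · intro r hr
        have hra : r ≠ a := by
          rintro rfl
          rcases hr with hr | hr
          · exact hr (List.mem_cons_self ..)
          · exact hr ha.2
        have := hrow r hra
        rw [i4 r, this]
        rw [this]
        exact hr.imp (fun h h' => h (List.mem_cons_of_mem _ h')) id
    · rw [if_neg ha] at hS₁
      rw [hS₁]
      obtain ⟨i1, i2, i3, i4⟩ := ih hD hP hq hv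
      refine ⟨i1, i2, ?_, ?_⟩
      · intro r hr hrq hvr
        refine i3 r ((List.mem_cons.1 hr).resolve_left ?_) hrq hvr
        rintro rfl
        exact ha ⟨hrq, hvr⟩
      · intro r hr
        exact i4 r (hr.imp (fun h h' => h (List.mem_cons_of_mem _ h')) id)

/-! ### Gauss-Jordan elimination -/

end ExtractState

/-- Row `q` is zero or has a pivot, whose column is zero in all other rows that belong to non-input
frontier spiders. -/
def Diagram.ReducedRow {m n : ℕ} (D : Diagram m n) (q : Fin n) : Prop :=
  D.row q = ∅ ∨ ∃ p ∈ D.row q, ∀ r ∈ D.freeRows, r ≠ q → p ∉ D.row r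

namespace ExtractState

open Diagram

variable {m n : ℕ}

/-- The first column of the row becomes its pivot. Columns that already serve as pivots of other
free rows are zero in row `q`, so adding row `q` leaves them untouched and earlier work is not
undone. -/
theorem pivotRow_spec {S : ExtractState m n}
    (hD : S.diagram.WellFormed) (hP : S.diagram.Prepared) {q : Fin n}
    (hq : q ∈ S.diagram.freeRows) :
    RowEquiv S (S.pivotRow q) ∧ (S.pivotRow q).diagram.ReducedRow q ∧
      ∀ r ∈ S.diagram.freeRows, S.diagram.ReducedRow r → (S.pivotRow q).diagram.ReducedRow r := by
  unfold pivotRow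
  split_ifs with h
  · set v := (S.diagram.row q).min' h
    have hv : v ∈ S.diagram.row q := Finset.min'_mem _ h
    obtain ⟨h1, h2, h3, h4⟩ := clearColumn_spec (rows := S.diagram.freeRows) hD hP hq hv
    have hfree := h1.freeRows_eq
    have hredq : (S.clearColumn q v S.diagram.freeRows).diagram.ReducedRow q := by
      refine Or.inr ⟨v, h2 ▸ hv, ?_⟩
      intro r hr hrq
      rw [hfree] at hr
      by_cases hvr : v ∈ S.diagram.row r
      · rw [h3 r hr hrq hvr, Finset.mem_symmDiff]
        tauto
      · rw [h4 r (Or.inr hvr)]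
        exact hvr
    refine ⟨h1, hredq, ?_⟩
    · intro r hr hred
      by_cases hrq : r = q
      · rw [hrq]
        exact hredq
      · rcases hred with hred | ⟨p, hp, hp'⟩
        · left
          rw [h4 r (Or.inr (by rw [hred]; simp)), hred]
        · right
          have hpq := hp' q hq (Ne.symm hrq)
          have key : ∀ r' ∈ S.diagram.freeRows,
              (p ∈ (S.clearColumn q v S.diagram.freeRows).diagram.row r' ↔
                p ∈ S.diagram.row r') := by
            intro r' hr'
            by_cases hvr : r' ≠ q ∧ v ∈ S.diagram.row r'
            · rw [h3 r' hr' hvr.1 hvr.2, Finset.mem_symmDiff]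
              tauto
            · by_cases hrq' : r' = q
              · rw [hrq', h2]
              · rw [h4 r' (Or.inr fun h => hvr ⟨hrq', h⟩)]
          refine ⟨p, (key r hr).2 hp, ?_⟩
          intro r' hr' hne
          rw [hfree] at hr'
          rw [key r' hr']
          exact hp' r' hr' hne
  · exact ⟨RowEquiv.refl hD hP, Or.inl (Finset.not_nonempty_iff_eq_empty.1 h), fun r _ h => h⟩

theorem foldl_pivotRow {L : List (Fin n)} {S : ExtractState m n}
    (hD : S.diagram.WellFormed) (hP : S.diagram.Prepared)
    (hL : ∀ q ∈ L, q ∈ S.diagram.freeRows) :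
    RowEquiv S (L.foldl pivotRow S) ∧
      ∀ q ∈ S.diagram.freeRows, (q ∈ L ∨ S.diagram.ReducedRow q) →
        (L.foldl pivotRow S).diagram.ReducedRow q := by
  induction L generalizing S with
  | nil => exact ⟨RowEquiv.refl hD hP, by simp⟩
  | cons a L ih =>
    obtain ⟨h1, h2, h3⟩ := pivotRow_spec hD hP (hL a (List.mem_cons_self ..))
    have hfree := h1.freeRows_eq
    obtain ⟨i1, i2⟩ := ih h1.wf h1.prepared
      (fun q hq => hfree.symm ▸ hL q (List.mem_cons_of_mem _ hq))
    refine ⟨h1.trans i1, fun q hq hq' => i2 q (hfree.symm ▸ hq) ?_⟩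
    rw [List.mem_cons, or_assoc] at hq'
    rcases hq' with rfl | hq' | hq'
    · exact Or.inr h2
    · exact Or.inl hq'
    · exact Or.inr (h3 q hq hq')

theorem gaussJordan_spec {S : ExtractState m n}
    (hD : S.diagram.WellFormed) (hP : S.diagram.Prepared) :
    RowEquiv S S.gaussJordan ∧
      ∀ q ∈ S.gaussJordan.diagram.freeRows, S.gaussJordan.diagram.ReducedRow q := by
  obtain ⟨h1, h2⟩ := foldl_pivotRow (L := S.diagram.freeRows) hD hP fun _ h => h
  refine ⟨h1, fun q hq => ?_⟩
  have hq' : q ∈ S.diagram.freeRows := h1.freeRows_eq ▸ hq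
  exact h2 q hq' (Or.inl hq')

end ExtractState

/-- When the rows of the non-input frontier spiders are reduced, one of them has exactly
one non-zero entry. -/
theorem Diagram.exists_card_row_eq_one {m n : ℕ} {D : Diagram m n}
    (hF : D.HasFocusedGFlow) (hne : D.past.Nonempty) (hred : ∀ q ∈ D.freeRows, D.ReducedRow q) :
    ∃ q ∈ D.freeRows, (D.row q).card = 1 := by
  obtain ⟨k, r, hF⟩ := hF.exists_isFocusedFlow
  -- Nothing in the past is later than `u`, so the correction set of `u` consists of non-input
  -- frontier spiders alone, and their rows sum to the unit vector of `u`.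
  obtain ⟨u, hu, hmax⟩ := Finset.exists_max_image D.past r hne
  have hk : ∀ w, k u w ≠ 0 → ∃ q ∈ D.freeRows, w = D.output q := by
    intro w hw
    have hV := hF.mem u hu w hw
    have hnp : w ∉ D.past := fun h => absurd (hF.lt u hu w h hw) (not_lt.2 (hmax w h))
    rw [mem_past] at hnp
    push Not at hnp
    obtain ⟨q, rfl⟩ := hnp hV
    exact ⟨q, mem_freeRows.2 (hF.notInput u hu _ hw), rfl⟩
  have hadj : ∀ x ∈ D.past, ∀ w, adjBit D.graph x w * k u w ≠ 0 →
      ∃ q ∈ D.freeRows, w = D.output q ∧ x ∈ D.row q ∧ k u (D.output q) ≠ 0 := by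
    intro x hx w h
    obtain ⟨q, hq, rfl⟩ := hk w (right_ne_zero_of_mul h)
    refine ⟨q, hq, rfl, mem_row.2 ⟨hx, ?_⟩, right_ne_zero_of_mul h⟩
    by_contra hcon
    exact left_ne_zero_of_mul h (adjBit_of_not_adj fun h' => hcon h'.symm)
  have hone : ∀ z : ZMod 2, z ≠ 0 → z = 1 := by decide
  -- A column met by exactly one row of the correction set has sum 1, and `u` is the only column
  -- with that sum.
  have hsingle : ∀ q, k u (D.output q) ≠ 0 → ∀ x ∈ D.row q,
      (∀ p ∈ D.freeRows, p ≠ q → k u (D.output p) ≠ 0 → x ∉ D.row p) → x = u := by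
    intro q hq x hx hp
    have hxp := (mem_row.1 hx).1
    have h1 := hF.odd u hu x hxp
    rw [oddAt, Finset.sum_eq_single (D.output q), adjBit_of_adj (mem_row.1 hx).2.symm, one_mul,
      hone _ hq] at h1
    · by_contra hcon
      rw [if_neg hcon] at h1
      exact one_ne_zero h1
    · intro w _ hw
      by_contra hcon
      obtain ⟨p, hp1, rfl, hp2, hp3⟩ := hadj x hxp w hcon
      exact hp p hp1 (fun e => hw (e ▸ rfl)) hp3 hp2
    · intro h
      exact absurd (hF.mem u hu _ hq) h
  -- A pivot column is met by just one free row, so every nonzero row of the correction set has its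
  -- pivot in column `u`.
  have hpivot : ∀ q ∈ D.freeRows, k u (D.output q) ≠ 0 → D.row q = ∅ ∨
      (u ∈ D.row q ∧ ∀ p ∈ D.freeRows, p ≠ q → u ∉ D.row p) := by
    intro q hq hkq
    rcases hred q hq with h | ⟨p, hp, hp'⟩
    · exact Or.inl h
    · right
      have : p = u := hsingle q hkq p hp fun r hr hrq _ => hp' r hr hrq
      subst this
      exact ⟨hp, hp'⟩
  have h1 := hF.odd u hu u hu
  rw [if_pos rfl] at h1
  obtain ⟨w, _, hw⟩ := Finset.exists_ne_zero_of_sum_ne_zero (by rw [← oddAt, h1]; exact one_ne_zero)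
  obtain ⟨q, hq, rfl, huq, hkq⟩ := hadj u hu w hw
  refine ⟨q, hq, Finset.card_eq_one.2 ⟨u, ?_⟩⟩
  have h2 := (hpivot q hq hkq).resolve_left (fun h => by rw [h] at huq; simp at huq)
  -- A second nonzero row in the correction set would also own the pivot column `u`, which is
  -- impossible. So no other row of the set interferes with the columns of row `q`.
  refine Finset.eq_singleton_iff_unique_mem.2 ⟨huq, fun x hx => hsingle q hkq x hx ?_⟩
  intro p hp hpq hkp hxp
  rcases hpivot p hp hkp with h | h
  · rw [h] at hxp; simp at hxp
  · exact h.2 q hq (Ne.symm hpq) huq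

namespace ExtractState

open Diagram

variable {m n : ℕ}

/-! ### Moving the frontier -/

/-- Adding a row whose only entry is in column `v` to a row that meets this column just erases that
entry. Rows can therefore only shrink. -/
theorem isolate_spec {S : ExtractState m n} (hD : S.diagram.WellFormed)
    (hP : S.diagram.Prepared) {q : Fin n} (hq : q ∈ S.diagram.freeRows)
    (hc : (S.diagram.row q).card ≤ 1) :
    RowEquiv S (S.isolate q) ∧ (S.isolate q).diagram.row q = S.diagram.row q ∧
      (∀ r, (S.isolate q).diagram.row r ⊆ S.diagram.row r) ∧
      (∀ r, r ≠ q →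
        Disjoint ((S.isolate q).diagram.row q) ((S.isolate q).diagram.row r)) ∧
      (S.diagram.row q = ∅ → S.isolate q = S) := by
  unfold isolate
  split_ifs with h
  · set v := (S.diagram.row q).min' h with hvdef
    have hv : v ∈ S.diagram.row q := Finset.min'_mem _ h
    have hrow : S.diagram.row q = {v} :=
      (Finset.card_le_one_iff_subset_singleton.1 hc).elim fun x hx => by
        have : v = x := Finset.mem_singleton.1 (hx hv)
        rw [← this] at hx
        exact Finset.Subset.antisymm hx (Finset.singleton_subset_iff.2 hv)
    obtain ⟨h1, h2, h3, h4⟩ := clearColumn_spec (rows := List.finRange n) hD hP hq hv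
    refine ⟨h1, h2, ?_, ?_, ?_⟩
    · intro r
      by_cases hr : r ≠ q ∧ v ∈ S.diagram.row r
      · rw [h3 r (List.mem_finRange r) hr.1 hr.2, hrow]
        intro x hx
        rw [Finset.mem_symmDiff, Finset.mem_singleton] at hx
        rcases hx with hx | hx
        · exact hx.1
        · rw [hx.1]; exact hr.2
      · by_cases hrq : r = q
        · rw [hrq, h2]
        · rw [h4 r (Or.inr fun h => hr ⟨hrq, h⟩)]
    · intro r hr
      rw [h2]
      by_cases hvr : v ∈ S.diagram.row r
      · rw [h3 r (List.mem_finRange r) hr hvr, hrow, Finset.disjoint_singleton_left,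
          Finset.mem_symmDiff]
        simp [hvr]
      · rw [h4 r (Or.inr hvr), hrow, Finset.disjoint_singleton_left]
        exact hvr
    · intro h0
      rw [h0] at hv
      simp at hv
  · rw [Finset.not_nonempty_iff_eq_empty] at h
    exact ⟨RowEquiv.refl hD hP, rfl, fun r => Finset.Subset.refl _, fun r _ => by simp [h],
      fun _ => rfl⟩

/-- The bound `≤ 1` is stable under shrinking, and a row that has become empty is simply skipped.
Once a nonempty row has been isolated it is disjoint from all others, so it contains no later pivot
and is met by none of the later row operations; this keeps at least one row alive for the advance.
-/
theorem foldl_isolate {L : List (Fin n)} {S : ExtractState m n} (hD : S.diagram.WellFormed)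
    (hP : S.diagram.Prepared) (hL : ∀ q ∈ L, q ∈ S.diagram.freeRows)
    (hc : ∀ q ∈ L, (S.diagram.row q).card ≤ 1) :
    RowEquiv S (L.foldl isolate S) ∧
      (∀ r, (L.foldl isolate S).diagram.row r ⊆ S.diagram.row r) ∧
      (∀ q, (q ∈ L ∨ ∀ r, r ≠ q → Disjoint (S.diagram.row q) (S.diagram.row r)) → ∀ r, r ≠ q →
        Disjoint ((L.foldl isolate S).diagram.row q) ((L.foldl isolate S).diagram.row r)) ∧
      ((∃ q ∈ L, (S.diagram.row q).Nonempty) →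
        ∃ q ∈ L, ((L.foldl isolate S).diagram.row q).Nonempty) ∧
      ∀ q, (∀ r, r ≠ q → Disjoint (S.diagram.row q) (S.diagram.row r)) →
        (S.diagram.row q).Nonempty → ((L.foldl isolate S).diagram.row q).Nonempty := by
  induction L generalizing S with
  | nil => exact ⟨RowEquiv.refl hD hP, fun r => Finset.Subset.refl _, by simp, by simp, by simp⟩
  | cons a L ih =>
    have hca := hc a (List.mem_cons_self ..)
    obtain ⟨h1, h2, h3, h4, h5⟩ := isolate_spec hD hP (hL a (List.mem_cons_self ..)) hca
    obtain ⟨i1, i2, i3, i4, i5⟩ := ih h1.wf h1.prepared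
      (fun q hq => h1.freeRows_eq.symm ▸ hL q (List.mem_cons_of_mem _ hq))
      (fun q hq => (Finset.card_le_card (h3 q)).trans (hc q (List.mem_cons_of_mem _ hq)))
    rw [List.foldl_cons]
    have hdis : ∀ q, (∀ r, r ≠ q → Disjoint (S.diagram.row q) (S.diagram.row r)) →
        ∀ r, r ≠ q → Disjoint ((S.isolate a).diagram.row q) ((S.isolate a).diagram.row r) :=
      fun q hq r hr => (hq r hr).mono (h3 q) (h3 r)
    refine ⟨h1.trans i1, fun r => (i2 r).trans (h3 r), ?_, ?_, ?_⟩
    · intro q hq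
      refine i3 q ?_
      rw [List.mem_cons, or_assoc] at hq
      rcases hq with rfl | hq | hq
      · exact Or.inr h4
      · exact Or.inl hq
      · exact Or.inr (hdis q hq)
    · rintro ⟨q, hq, hne⟩
      by_cases ha : (S.diagram.row a).Nonempty
      · exact ⟨a, List.mem_cons_self .., i5 a h4 (h2 ▸ ha)⟩
      · have hS := h5 (Finset.not_nonempty_iff_eq_empty.1 ha)
        rcases List.mem_cons.1 hq with rfl | hq
        · exact absurd hne ha
        · obtain ⟨p, hp, hp'⟩ := i4 ⟨q, hq, by rwa [hS]⟩
          exact ⟨p, List.mem_cons_of_mem _ hp, hp'⟩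
    · intro q hq hne
      refine i5 q (hdis q hq) ?_
      by_cases hqa : q = a
      · rw [hqa, h2, ← hqa]; exact hne
      · by_cases ha : (S.diagram.row a).Nonempty
        · obtain ⟨x, hx⟩ := hne
          by_contra hcon
          rw [Finset.not_nonempty_iff_eq_empty] at hcon
          have key := clearColumn_spec (rows := List.finRange n) hD hP
            (hL a (List.mem_cons_self ..)) (Finset.min'_mem _ ha)
          have hiso : S.isolate a = S.clearColumn a ((S.diagram.row a).min' ha) (List.finRange n) :=
            dif_pos ha
          have hv : (S.diagram.row a).min' ha ∉ S.diagram.row q := fun h =>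
            (Finset.disjoint_left.1 (hq a (Ne.symm hqa)) h) (Finset.min'_mem _ ha)
          rw [hiso, key.2.2.2 q (Or.inr hv)] at hcon
          rw [hcon] at hx
          simp at hx
        · rw [h5 (Finset.not_nonempty_iff_eq_empty.1 ha)]
          exact hne

/-- The condition under which the frontier can be advanced on the qubits in `L`. -/
structure Ready (S : ExtractState m n) (L : List (Fin n)) : Prop where
  wf : S.diagram.WellFormed
  plain : ∀ q, S.diagram.outputHad q = false
  phaseless : ∀ q, S.diagram.phase (S.diagram.output q) = 0
  free : ∀ q ∈ L, ∀ i, S.diagram.input i ≠ S.diagram.output q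
  mem_past : ∀ q ∈ L, ∀ x, S.diagram.graph.Adj (S.diagram.output q) x → x ∈ S.diagram.past
  card_le : ∀ q ∈ L, (S.diagram.row q).card ≤ 1
  disjoint : ∀ q ∈ L, ∀ r ∈ L, r ≠ q → Disjoint (S.diagram.row q) (S.diagram.row r)

theorem advance_of_row_eq {S : ExtractState m n} {q : Fin n} {v : ℕ}
    (hrow : S.diagram.row q = {v}) : S.advance q = unfusePhase
      ⟨{ S.diagram with
          verts := S.diagram.verts.erase (S.diagram.output q)
          graph := S.diagram.graph.deleteIncidenceSet (S.diagram.output q)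
          output := Function.update S.diagram.output q v },
        .had q :: S.circuit⟩ q := by
  have h : (S.diagram.row q).Nonempty := by rw [hrow]; simp
  have hv : (S.diagram.row q).min' h = v := by
    have := Finset.min'_mem _ h
    exact Finset.mem_singleton.1 ((Finset.ext_iff.1 hrow _).1 this)
  rw [advance, dif_pos h, hv]

theorem advance_of_row_eq_empty {S : ExtractState m n} {q : Fin n}
    (hrow : S.diagram.row q = ∅) : S.advance q = S := by
  rw [advance, dif_neg]
  rw [hrow]
  simp

/-- Read backwards, the move is the insertion of the spider `w` behind the output spider `v`, so the
linear map is covered by `attach_eval`. The new frontier spider may have neighbours on the frontier,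
so disconnectedness is demanded only of the qubits still to be advanced; the remaining edges become
CZ gates afterwards. -/
theorem advance_spec {S : ExtractState m n} {q : Fin n} {L : List (Fin n)}
    (hS : S.Ready (q :: L)) (hqL : q ∉ L) {v : ℕ} (hrow : S.diagram.row q = {v}) :
    Valid S (S.advance q) ∧ (S.advance q).Ready L ∧
      (S.advance q).diagram.past = S.diagram.past.erase v := by
  have hD := hS.wf
  set w := S.diagram.output q with hw
  set E : Diagram m n :=
    { S.diagram with
      verts := S.diagram.verts.erase w
      graph := S.diagram.graph.deleteIncidenceSet w
      output := Function.update S.diagram.output q v } with hE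
  have hadv : S.advance q = unfusePhase ⟨E, .had q :: S.circuit⟩ q := advance_of_row_eq hrow
  have hvr : v ∈ S.diagram.row q := by rw [hrow]; simp
  have hvp : v ∈ S.diagram.past := (mem_row.1 hvr).1
  have hvw : S.diagram.graph.Adj w v := (mem_row.1 hvr).2
  have hwadj : ∀ x, S.diagram.graph.Adj w x ↔ x = v := by
    intro x
    constructor
    · intro h
      have : x ∈ S.diagram.row q :=
        mem_row.2 ⟨hS.mem_past q (List.mem_cons_self ..) x h, h⟩
      rw [hrow] at this
      simpa using this
    · rintro rfl; exact hvw
  have hvo : ∀ p, S.diagram.output p ≠ v := (Diagram.mem_past.1 hvp).2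
  have hEwf : E.WellFormed := by
    refine ⟨?_, ?_, ?_, hD.input_inj, ?_⟩
    · intro x y h
      rw [SimpleGraph.deleteIncidenceSet_adj] at h
      exact Finset.mem_erase.2 ⟨h.2.1, hD.adj_mem _ _ h.1⟩
    · exact fun i => Finset.mem_erase.2 ⟨hS.free q (List.mem_cons_self ..) i, hD.input_mem i⟩
    · intro p
      change Function.update S.diagram.output q v p ∈ _
      rw [Finset.mem_erase]
      by_cases hp : p = q
      · rw [hp, Function.update_self]
        exact ⟨hvw.ne.symm, (Diagram.mem_past.1 hvp).1⟩
      · rw [Function.update_of_ne hp]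
        exact ⟨fun e => hp (hD.output_inj e), hD.output_mem p⟩
    · intro p p' h
      change Function.update S.diagram.output q v p = Function.update S.diagram.output q v p' at h
      by_cases hp : p = q <;> by_cases hp' : p' = q
      · rw [hp, hp']
      · rw [hp, Function.update_self, Function.update_of_ne hp'] at h
        exact absurd h.symm (hvo p')
      · rw [hp', Function.update_self, Function.update_of_ne hp] at h
        exact absurd h (hvo p)
      · rw [Function.update_of_ne hp, Function.update_of_ne hp'] at h
        exact hD.output_inj h
  have hEpast : E.past = S.diagram.past.erase v := by
    ext x
    rw [Finset.mem_erase, Diagram.mem_past, Diagram.mem_past]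
    change x ∈ S.diagram.verts.erase w ∧ (∀ p, Function.update S.diagram.output q v p ≠ x) ↔ _
    rw [Finset.mem_erase]
    constructor
    · rintro ⟨⟨h1, h2⟩, h3⟩
      refine ⟨?_, h2, ?_⟩
      · rintro rfl
        exact h3 q (by simp)
      · intro p hp
        by_cases hpq : p = q
        · rw [hpq] at hp; exact h1 hp.symm
        · exact h3 p (by rw [Function.update_of_ne hpq]; exact hp)
    · rintro ⟨h1, h2, h3⟩
      refine ⟨⟨(h3 q).symm, h2⟩, fun p => ?_⟩
      by_cases hpq : p = q
      · rw [hpq, Function.update_self]; exact h1.symm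
      · rw [Function.update_of_ne hpq]; exact h3 p
  -- This uses that `w` is phaseless and has `v` as its only neighbour. The Hadamard applied to `E`
  -- offsets the toggle made by `attach`.
  have hattach : S.diagram = (E.applyHad q).attach q w := by
    have h1 : (insert w (S.diagram.verts.erase w)) = S.diagram.verts :=
      Finset.insert_erase (hD.output_mem q)
    have h2 : S.diagram.graph.deleteIncidenceSet w ⊔ SimpleGraph.edge v w = S.diagram.graph := by
      ext x y
      rw [SimpleGraph.sup_adj, SimpleGraph.deleteIncidenceSet_adj, SimpleGraph.edge_adj]
      constructor
      · rintro (h | ⟨⟨rfl, rfl⟩ | ⟨rfl, rfl⟩, _⟩)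
        · exact h.1
        · exact hvw.symm
        · exact hvw
      · intro h
        by_cases hx : x = w
        · subst hx
          have := (hwadj y).1 h
          right
          exact ⟨Or.inr ⟨rfl, this⟩, h.ne⟩
        · by_cases hy : y = w
          · subst hy
            have := (hwadj x).1 h.symm
            right
            exact ⟨Or.inl ⟨this, rfl⟩, h.ne⟩
          · exact Or.inl ⟨h, hx, hy⟩
    have h3 : Function.update S.diagram.phase w 0 = S.diagram.phase := by
      rw [← hS.phaseless q, ← hw, Function.update_eq_self]
    have h4 : Function.update (Function.update S.diagram.output q v) q w = S.diagram.output := by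
      simp [hw]
    have h5 : Function.update (Function.update S.diagram.outputHad q (!S.diagram.outputHad q)) q
        (!!S.diagram.outputHad q) = S.diagram.outputHad := by
      simp
    simp only [attach, applyHad, hE, h1, h3, h4, Function.update_self, h2, h5]
  have hwE : w ∉ E.verts := Finset.notMem_erase _ _
  have hv1 : Valid S ⟨E, .had q :: S.circuit⟩ := by
    refine ⟨hEwf, fun hF => ?_, ?_⟩
    · refine hF.advance (w := w) (v := v) (hD.output_mem q) ?_ rfl hEpast (fun _ => rfl) rfl ?_
      · intro x hx
        rw [(hwadj x).1 hx]
        exact Finset.notMem_erase _ _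
      · exact fun h => (Diagram.mem_past.1 h).2 q rfl
    · refine eval_cons (C := S.circuit) (EqUpToScalar.trans ?_ (E.eval_applyHad q))
      have := attach_eval (hEwf.applyHad q) q (w := w) hwE
      rwa [← hattach] at this
  have hv2 := unfusePhase_valid (S := ⟨E, .had q :: S.circuit⟩) hEwf q (hS.plain q)
  have hd := unfusePhase_diagram ⟨E, .had q :: S.circuit⟩ q
  rw [← hadv] at hv2 hd
  have hout : ∀ p, p ≠ q → E.output p = S.diagram.output p := fun p hp =>
    Function.update_of_ne hp _ _
  have houtq : E.output q = v := Function.update_self _ _ _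
  have hpast : (S.advance q).diagram.past = S.diagram.past.erase v := by rw [hd]; exact hEpast
  have hLq : ∀ p ∈ L, p ≠ q := fun p hp e => hqL (e ▸ hp)
  have hrowle : ∀ p, p ≠ q → (S.advance q).diagram.row p = (S.diagram.row p).erase v := by
    intro p hp
    ext x
    rw [Finset.mem_erase, mem_row, mem_row, hpast, Finset.mem_erase, hd]
    change (x ≠ v ∧ _) ∧ (S.diagram.graph.deleteIncidenceSet w).Adj (E.output p) x ↔ _
    rw [hout p hp, SimpleGraph.deleteIncidenceSet_adj]
    have h1 : S.diagram.output p ≠ w := fun e => hp (hD.output_inj e)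
    have h2 : x ∈ S.diagram.past → x ≠ w := by
      rintro h rfl
      exact (Diagram.mem_past.1 h).2 q rfl
    tauto
  refine ⟨hv1.trans hv2, ⟨hv2.wf, ?_, ?_, ?_, ?_, ?_, ?_⟩, hpast⟩
  · rw [hd]; exact hS.plain
  · intro p
    rw [hd]
    change Function.update S.diagram.phase (E.output q) 0 (E.output p) = 0
    by_cases hp : p = q
    · rw [hp, Function.update_self]
    · rw [hout p hp, houtq, Function.update_of_ne (hvo p)]
      exact hS.phaseless p
  · intro p hp i
    rw [hd]
    change S.diagram.input i ≠ E.output p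
    rw [hout p (hLq p hp)]
    exact hS.free p (List.mem_cons_of_mem _ hp) i
  · intro p hp x hx
    rw [hpast]
    rw [hd] at hx
    change (S.diagram.graph.deleteIncidenceSet w).Adj (E.output p) x at hx
    rw [hout p (hLq p hp), SimpleGraph.deleteIncidenceSet_adj] at hx
    have hxp := hS.mem_past p (List.mem_cons_of_mem _ hp) x hx.1
    refine Finset.mem_erase.2 ⟨?_, hxp⟩
    rintro rfl
    exact Finset.disjoint_left.1 (hS.disjoint q (List.mem_cons_self ..) p
      (List.mem_cons_of_mem _ hp) (hLq p hp)) hvr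
      (mem_row.2 ⟨hxp, hx.1⟩)
  · intro p hp
    rw [hrowle p (hLq p hp)]
    exact (Finset.card_le_card (Finset.erase_subset _ _)).trans
      (hS.card_le p (List.mem_cons_of_mem _ hp))
  · intro p hp r hr hrp
    rw [hrowle p (hLq p hp), hrowle r (hLq r hr)]
    exact (hS.disjoint p (List.mem_cons_of_mem _ hp) r (List.mem_cons_of_mem _ hr) hrp).mono
      (Finset.erase_subset _ _) (Finset.erase_subset _ _)

theorem foldl_advance {L : List (Fin n)} {S : ExtractState m n} (hS : S.Ready L)
    (hL : L.Nodup) :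
    Valid S (L.foldl advance S) ∧ (L.foldl advance S).Ready [] ∧
      (L.foldl advance S).diagram.past ⊆ S.diagram.past ∧
      ((∃ q ∈ L, (S.diagram.row q).Nonempty) →
        (L.foldl advance S).diagram.past ⊂ S.diagram.past) := by
  induction L generalizing S with
  | nil => exact ⟨Valid.refl hS.wf, hS, Finset.Subset.refl _, by simp⟩
  | cons q L ih =>
    obtain ⟨hqL, hL⟩ := List.nodup_cons.1 hL
    rw [List.foldl_cons]
    rcases (S.diagram.row q).eq_empty_or_nonempty with hrow | hrow
    · rw [advance_of_row_eq_empty hrow]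
      have hS' : S.Ready L := ⟨hS.wf, hS.plain, hS.phaseless,
        fun p hp => hS.free p (List.mem_cons_of_mem _ hp),
        fun p hp => hS.mem_past p (List.mem_cons_of_mem _ hp),
        fun p hp => hS.card_le p (List.mem_cons_of_mem _ hp),
        fun p hp r hr => hS.disjoint p (List.mem_cons_of_mem _ hp) r (List.mem_cons_of_mem _ hr)⟩
      obtain ⟨i1, i2, i3, i4⟩ := ih hS' hL
      refine ⟨i1, i2, i3, ?_⟩
      rintro ⟨p, hp, hne⟩
      rcases List.mem_cons.1 hp with rfl | hp
      · rw [hrow] at hne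
        simp at hne
      · exact i4 ⟨p, hp, hne⟩
    · obtain ⟨v, hv⟩ := Finset.card_eq_one.1 (le_antisymm (hS.card_le q (List.mem_cons_self ..))
        (Finset.card_pos.2 hrow))
      obtain ⟨h1, h2, h3⟩ := advance_spec hS hqL hv
      obtain ⟨i1, i2, i3, _⟩ := ih h2 hL
      have hvp : v ∈ S.diagram.past := (mem_row.1 (hv ▸ Finset.mem_singleton_self v)).1
      have hss : S.diagram.past.erase v ⊂ S.diagram.past := Finset.erase_ssubset hvp
      rw [h3] at i3
      exact ⟨h1.trans i1, i2, i3.trans hss.1, fun _ => lt_of_le_of_lt i3 hss⟩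

theorem updateFrontier_spec {S : ExtractState m n} (hD : S.diagram.WellFormed)
    (hP : S.diagram.Prepared) (hF : S.diagram.HasFocusedGFlow) (hne : S.diagram.past.Nonempty) :
    Valid S S.updateFrontier ∧ S.updateFrontier.diagram.Prepared ∧
      S.updateFrontier.diagram.past ⊂ S.diagram.past := by
  obtain ⟨g1, g2⟩ := gaussJordan_spec hD hP
  set T := S.gaussJordan with hT
  obtain ⟨q, hq, hqc⟩ := exists_card_row_eq_one (g1.flow hF) (g1.past_eq.symm ▸ hne) g2
  have hws : ∀ p, p ∈ T.readyRows ↔ p ∈ T.diagram.freeRows ∧ (T.diagram.row p).card = 1 := by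
    intro p
    simp [readyRows]
  have hnd : T.readyRows.Nodup := (freeRows_nodup _).filter _
  obtain ⟨i1, i2, i3, i4, _⟩ := foldl_isolate (L := T.readyRows) g1.wf g1.prepared
    (fun p hp => ((hws p).1 hp).1) (fun p hp => ((hws p).1 hp).2.le)
  set U := T.readyRows.foldl isolate T with hU
  have hready : U.Ready T.readyRows := by
    refine ⟨i1.wf, i1.prepared.plain, i1.prepared.phaseless, ?_, ?_, ?_, ?_⟩
    · intro p hp
      rw [← mem_freeRows, i1.freeRows_eq]
      exact ((hws p).1 hp).1
    · exact fun p _ x hx => mem_past_of_adj_output i1.wf i1.prepared hx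
    · exact fun p hp => (Finset.card_le_card (i2 p)).trans ((hws p).1 hp).2.le
    · exact fun p hp r _ hr => i3 p (Or.inl hp) r hr
  obtain ⟨a1, a2, a3, a4⟩ := foldl_advance hready hnd
  have hup : S.updateFrontier = (T.readyRows.foldl advance U).unfuseAllCZ := rfl
  rw [hup]
  refine ⟨((g1.toValid.trans i1.toValid).trans a1).trans (unfuseAllCZ_valid a2.wf a2.plain),
    unfuseAllCZ_prepared a2.wf a2.plain a2.phaseless, ?_⟩
  rw [unfuseAllCZ_past a2.wf a2.plain, ← g1.past_eq, ← i1.past_eq]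
  refine a4 (i4 ⟨q, (hws q).2 ⟨hq, hqc⟩, ?_⟩)
  rw [← Finset.card_pos, hqc]
  exact one_pos

theorem run_spec {N : ℕ} {S : ExtractState m n} (hD : S.diagram.WellFormed)
    (hP : S.diagram.Prepared) (hF : S.diagram.HasFocusedGFlow) (hN : S.diagram.past.card ≤ N) :
    Valid S (run N S) ∧ (run N S).diagram.Prepared ∧ (run N S).diagram.past = ∅ := by
  induction N generalizing S with
  | zero => exact ⟨Valid.refl hD, hP, Finset.card_eq_zero.1 (Nat.le_zero.1 hN)⟩
  | succ N ih =>
    rw [run]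
    split_ifs with h
    · exact ⟨Valid.refl hD, hP, h⟩
    · obtain ⟨h1, h2, h3⟩ := updateFrontier_spec hD hP hF (Finset.nonempty_iff_ne_empty.2 h)
      have := Finset.card_lt_card h3
      obtain ⟨i1, i2, i3⟩ := ih h1.wf h2 (h1.flow hF) (by omega)
      exact ⟨h1.trans i1, i2, i3⟩

/-! ### The remaining permutation -/

/-- Only frontier spiders are left. -/
structure Final (S : ExtractState m n) : Prop where
  wf : S.diagram.WellFormed
  prepared : S.diagram.Prepared
  past_eq : S.diagram.past = ∅

theorem Final.exists_output {S : ExtractState m n} (h : S.Final) (i : Fin m) :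
    ∃ q, S.diagram.output q = S.diagram.input i := by
  by_contra hcon
  push Not at hcon
  have := Diagram.mem_past.2 ⟨h.wf.input_mem i, hcon⟩
  rw [h.past_eq] at this
  simp at this

theorem Final.qubit?_eq {S : ExtractState m n} (h : S.Final) (i : Fin m) :
    ∃ q, S.qubit? (S.diagram.input i) = some q ∧ S.diagram.output q = S.diagram.input i := by
  obtain ⟨q, hq⟩ := h.exists_output i
  cases hf : S.qubit? (S.diagram.input i) with
  | none =>
    have := List.find?_eq_none.1 hf q (List.mem_finRange q)
    simp [hq] at this
  | some p =>
    have := List.find?_some hf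
    exact ⟨p, rfl, by simpa using this⟩

/-- When all spiders are outputs on plain wires, `y` determines every spider bit and a single
summand `t` survives. Its weight is 1, as there are neither phases nor edges. -/
theorem Final.contraction_eq {S : ExtractState m n} (h : S.Final) {σ : Fin m → Fin n}
    (hσ : ∀ i, S.diagram.output (σ i) = S.diagram.input i) (y : Bits n) (x : Bits m) :
    S.diagram.contraction y x = ∏ i, wireEntry (S.diagram.inputHad i) (x i) (y (σ i)) := by
  classical
  have hD := h.wf
  set t := (Finset.univ.filter fun q => y q = true).image S.diagram.output with ht
  have hmem : ∀ q, S.diagram.output q ∈ t ↔ y q = true := by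
    intro q
    simp [ht, hD.output_inj.eq_iff]
  have hV : ∀ v ∈ S.diagram.verts, ∃ q, S.diagram.output q = v := by
    intro v hv
    by_contra hcon
    push Not at hcon
    have := Diagram.mem_past.2 ⟨hv, hcon⟩
    rw [h.past_eq] at this
    simp at this
  have htV : t ⊆ S.diagram.verts := by
    intro v hv
    obtain ⟨q, _, rfl⟩ := Finset.mem_image.1 hv
    exact hD.output_mem q
  have hw : ∀ s ⊆ S.diagram.verts, S.diagram.weight s = 1 := by
    intro s hs
    rw [weight, edgeSign_eq_one, mul_one]
    · refine Finset.prod_eq_one fun v hv => ?_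
      obtain ⟨q, rfl⟩ := hV v (hs hv)
      rw [h.prepared.phaseless]
      simp
    · intro u hu v hv
      obtain ⟨p, rfl⟩ := hV u (hs hu)
      obtain ⟨q, rfl⟩ := hV v (hs hv)
      exact h.prepared.disconnected p q
  rw [contraction, Finset.sum_eq_single t]
  · rw [hw t htV, one_mul]
    have : S.diagram.outputAmp t y = 1 := by
      refine Finset.prod_eq_one fun q _ => ?_
      rw [h.prepared.plain]
      simp [wireEntry, hmem]
    rw [this, mul_one]
    refine Finset.prod_congr rfl fun i _ => ?_
    congr 1
    rw [Bool.eq_iff_iff, decide_eq_true_iff, ← hσ i, hmem]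
  · intro s hs hst
    have hs := Finset.mem_powerset.1 hs
    have : S.diagram.outputAmp s y = 0 := by
      by_contra hne
      apply hst
      have key : ∀ q, S.diagram.output q ∈ s ↔ y q = true := by
        intro q
        have := Finset.prod_ne_zero_iff.1 hne q (Finset.mem_univ q)
        rw [h.prepared.plain] at this
        simp only [wireEntry] at this
        cases hy : y q <;> by_cases hq : S.diagram.output q ∈ s <;> simp_all
      ext v
      constructor
      · intro hv
        obtain ⟨q, rfl⟩ := hV v (hs hv)
        rw [hmem, ← key]
        exact hv
      · intro hv
        obtain ⟨q, rfl⟩ := hV v (htV hv)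
        rw [key, ← hmem]
        exact hv
    rw [this, mul_zero]
  · intro hcon
    exact absurd (Finset.mem_powerset.2 htV) hcon

/-- Input `i` is now connected straight to output `q`, so a Hadamard on the input wire may be moved
to the output. -/
theorem finishHad_spec {S : ExtractState m n} (h : S.Final) (i : Fin m) :
    (S.finishHad i).Final ∧ EqUpToScalar (S.finishHad i).eval S.eval ∧
      (S.finishHad i).diagram = { S.diagram with
        inputHad := Function.update S.diagram.inputHad i false } := by
  obtain ⟨q, hq, hqi⟩ := h.qubit?_eq i
  unfold finishHad
  rw [hq]
  simp only
  split_ifs with hi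
  · set E : Diagram m n := { S.diagram with
        inputHad := Function.update S.diagram.inputHad i false } with hE
    have hEF : Final ⟨E, .had q :: S.circuit⟩ :=
      ⟨⟨h.wf.adj_mem, h.wf.input_mem, h.wf.output_mem, h.wf.input_inj, h.wf.output_inj⟩,
        ⟨h.prepared.plain, h.prepared.phaseless, h.prepared.disconnected⟩, h.past_eq⟩
    refine ⟨hEF, eval_cons (C := S.circuit) (eval_equiv_mul (EqUpToScalar.of_eq ?_)), rfl⟩
    ext y x
    choose σ hσ using fun i => h.exists_output i
    have hσi : σ i = q := h.wf.output_inj ((hσ i).trans hqi.symm)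
    have hσne : ∀ j ≠ i, σ j ≠ q := by
      intro j hj e
      refine hj (h.wf.input_inj ?_)
      rw [← hσ j, e, hqi]
    rw [Gate.had_mul_apply, h.contraction_eq hσ]
    have h1 : ∀ b, E.contraction (Function.update y q b) x =
        wireEntry false (x i) b *
          ∏ j ∈ Finset.univ.erase i, wireEntry (S.diagram.inputHad j) (x j) (y (σ j)) := by
      intro b
      rw [hEF.contraction_eq (σ := σ) hσ, ← Finset.mul_prod_erase _ _ (Finset.mem_univ i)]
      congr 1
      · simp [hE, hσi]
      · refine Finset.prod_congr rfl fun j hj => ?_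
        have hj := Finset.ne_of_mem_erase hj
        rw [Function.update_of_ne (hσne j hj)]
        simp [hE, hj]
    simp only [h1]
    rw [← Finset.mul_prod_erase _ _ (Finset.mem_univ i)]
    simp only [← mul_assoc]
    rw [← Finset.sum_mul, sum_hadEntry_mul_wireEntry, hi, hσi]
    rfl
  · have : ({ S.diagram with inputHad := Function.update S.diagram.inputHad i false } :
        Diagram m n) = S.diagram := by
      rw [← Bool.eq_false_of_not_eq_true hi, Function.update_eq_self]
    exact ⟨h, EqUpToScalar.refl _, this.symm⟩

theorem foldl_finishHad {L : List (Fin m)} {S : ExtractState m n} (h : S.Final) :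
    (L.foldl finishHad S).Final ∧ EqUpToScalar (L.foldl finishHad S).eval S.eval ∧
      ∀ i, (i ∈ L ∨ S.diagram.inputHad i = false) →
        (L.foldl finishHad S).diagram.inputHad i = false := by
  induction L generalizing S with
  | nil => exact ⟨h, EqUpToScalar.refl _, by simp⟩
  | cons a L ih =>
    obtain ⟨h1, h2, h3⟩ := finishHad_spec h a
    obtain ⟨i1, i2, i3⟩ := ih h1
    refine ⟨i1, i2.trans h2, fun i hi => i3 i ?_⟩
    rw [h3]
    rw [List.mem_cons, or_assoc] at hi
    rcases hi with rfl | hi | hi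
    · right; simp
    · exact Or.inl hi
    · right
      by_cases hia : i = a
      · rw [hia]; simp
      · simp [hia, hi]

theorem finishSwap_spec {S : ExtractState n n} (h : S.Final) (i : Fin n) :
    (S.finishSwap i).Final ∧ EqUpToScalar (S.finishSwap i).eval S.eval ∧
      (S.finishSwap i).diagram.inputHad = S.diagram.inputHad ∧
      ∀ j, (j = i ∨ S.diagram.output j = S.diagram.input j) →
        (S.finishSwap i).diagram.output j = (S.finishSwap i).diagram.input j := by
  obtain ⟨q, hq, hqi⟩ := h.qubit?_eq i
  unfold finishSwap
  rw [hq]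
  simp only
  split_ifs with hne
  · refine ⟨⟨⟨h.wf.adj_mem, h.wf.input_mem, fun j => h.wf.output_mem _, h.wf.input_inj,
      h.wf.output_inj.comp (Equiv.injective _)⟩, ⟨fun j => h.prepared.plain _,
      fun j => h.prepared.phaseless _, fun j k => h.prepared.disconnected _ _⟩, ?_⟩,
      eval_cons (C := S.circuit) (eval_equiv_mul (EqUpToScalar.of_eq ?_)), rfl, ?_⟩
    · rw [Finset.eq_empty_iff_forall_notMem]
      intro v hv
      rw [Diagram.mem_past] at hv
      have : v ∈ S.diagram.past := by
        refine Diagram.mem_past.2 ⟨hv.1, fun p => ?_⟩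
        have := hv.2 (Equiv.swap i q p)
        simpa using this
      rw [h.past_eq] at this
      simp at this
    · rw [← contraction_swap]
      simp [Function.comp_assoc, ← Equiv.coe_trans]
    · intro j hj
      change S.diagram.output (Equiv.swap i q j) = S.diagram.input j
      by_cases hji : j = i
      · rw [hji, Equiv.swap_apply_left, hqi]
      · have hj := hj.resolve_left hji
        -- A qubit that is already in place is not moved: it could only be moved if it were `q`, but
        -- the spider of `q` belongs to input `i`.
        rw [Equiv.swap_apply_of_ne_of_ne hji, hj]
        rintro rfl
        exact hji (h.wf.input_inj (hj.symm.trans hqi))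
  · rw [not_not] at hne
    refine ⟨h, EqUpToScalar.refl _, rfl, ?_⟩
    rintro j (rfl | hj)
    · rw [← hqi, hne]
    · exact hj

theorem foldl_finishSwap {L : List (Fin n)} {S : ExtractState n n} (h : S.Final) :
    (L.foldl finishSwap S).Final ∧ EqUpToScalar (L.foldl finishSwap S).eval S.eval ∧
      (L.foldl finishSwap S).diagram.inputHad = S.diagram.inputHad ∧
      ∀ i, (i ∈ L ∨ S.diagram.output i = S.diagram.input i) →
        (L.foldl finishSwap S).diagram.output i = (L.foldl finishSwap S).diagram.input i := by
  induction L generalizing S with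
  | nil => exact ⟨h, EqUpToScalar.refl _, rfl, by simp⟩
  | cons a L ih =>
    obtain ⟨h1, h2, h3, h4⟩ := finishSwap_spec h a
    obtain ⟨i1, i2, i3, i4⟩ := ih h1
    refine ⟨i1, i2.trans h2, i3.trans h3, fun i hi => i4 i ?_⟩
    rw [List.mem_cons, or_assoc] at hi
    rcases hi with rfl | hi | hi
    · exact Or.inr (h4 _ (Or.inl rfl))
    · exact Or.inl hi
    · exact Or.inr (h4 i (Or.inr hi))

theorem finish_spec {S : ExtractState n n} (h : S.Final) :
    EqUpToScalar S.finish.circuit.eval S.eval := by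
  obtain ⟨h1, h2, h3⟩ := foldl_finishHad (L := List.finRange n) h
  obtain ⟨i1, i2, i3, i4⟩ := foldl_finishSwap (L := List.finRange n) h1
  refine EqUpToScalar.trans ?_ (i2.trans h2)
  change EqUpToScalar S.finish.circuit.eval S.finish.eval
  have hout : ∀ i, S.finish.diagram.output i = S.finish.diagram.input i :=
    fun i => i4 i (Or.inl (List.mem_finRange i))
  have hone : S.finish.diagram.contraction = 1 := by
    ext y x
    have hf : S.finish.Final := i1
    rw [hf.contraction_eq (σ := id) hout]
    have hhad : ∀ i, S.finish.diagram.inputHad i = false := by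
      intro i
      have : S.finish.diagram.inputHad = _ := i3
      rw [this]
      exact h3 i (Or.inl (List.mem_finRange i))
    simp only [hhad, wireEntry, id]
    rw [Matrix.one_apply]
    simp only [Bool.false_eq_true, if_false]
    rw [Finset.prod_ite_zero]
    simp only [Finset.mem_univ, true_imp_iff, Finset.prod_const_one]
    congr 1
    rw [eq_iff_iff, funext_iff]
    exact forall_congr' fun i => eq_comm
  have := (S.finish.diagram.eval_equiv_contraction).mul_left S.finish.circuit.eval
  rw [hone, Matrix.mul_one] at this
  exact this.symm

end ExtractState

theorem extract_spec {n : ℕ} {D : Diagram n n} (hD : D.WellFormed) (hF : D.HasFocusedGFlow) :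
    ∃ C : Circuit n, extract D = some C ∧ EqUpToScalar C.eval D.eval := by
  obtain ⟨h1, h2, h3⟩ := ExtractState.prepare_spec (S := ⟨D, []⟩) hD
  -- Preparation does not change the past, which is part of the original spiders, so `D.verts.card`
  -- rounds are enough.
  obtain ⟨r1, r2, r3⟩ := ExtractState.run_spec (N := D.verts.card) h1.wf h2 (h1.flow hF)
    (by rw [h3]; exact Finset.card_le_card Finset.sdiff_subset)
  refine ⟨_, if_pos r3, (ExtractState.finish_spec ⟨r1.wf, r2, r3⟩).trans
    ((h1.trans r1).eval.trans (EqUpToScalar.of_eq ?_))⟩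
  simp [ExtractState.eval, Circuit.eval]

/-! ### Circuits are unitary -/

/-- Unitarity is needed only to recognise the final scalar as a phase. The CNOT is reduced to
Hadamards and a CZ. -/
theorem Gate.conjTranspose_mul_self {n : ℕ} (g : Gate n) :
    g.toMatrix.conjTranspose * g.toMatrix = 1 := by
  have hhad : ∀ q : Fin n, (Gate.had q).toMatrix.conjTranspose = (Gate.had q).toMatrix := by
    intro q
    conv_rhs => rw [← Gate.had_transpose]
    ext y x
    change star (if ∀ k, k ≠ q → x k = y k then hadEntry (y q) (x q) else 0) =
      if ∀ k, k ≠ q → x k = y k then hadEntry (y q) (x q) else 0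
    split_ifs
    · unfold hadEntry
      split_ifs <;> simp [Complex.conj_ofReal]
    · simp
  have hcz : ∀ (a b : Fin n) (h : a ≠ b),
      (Gate.cz a b h).toMatrix.conjTranspose * (Gate.cz a b h).toMatrix = 1 := by
    intro a b h
    change (Matrix.diagonal _).conjTranspose * Matrix.diagonal _ = 1
    rw [Matrix.diagonal_conjTranspose, Matrix.diagonal_mul_diagonal, ← Matrix.diagonal_one]
    congr 1
    ext x
    simp only [Pi.star_apply]
    split_ifs <;> simp
  cases g with
  | cnot c t h =>
    rw [Gate.cnot_eq, Matrix.conjTranspose_mul, Matrix.conjTranspose_mul, hhad]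
    calc _ = (Gate.had t).toMatrix * ((Gate.cz c t h).toMatrix.conjTranspose *
          ((Gate.had t).toMatrix * (Gate.had t).toMatrix) * (Gate.cz c t h).toMatrix) *
            (Gate.had t).toMatrix := by simp only [Matrix.mul_assoc]
      _ = 1 := by rw [Gate.had_mul_had, Matrix.mul_one, hcz, Matrix.mul_one, Gate.had_mul_had]
  | cz a b h => exact hcz a b h
  | had q => rw [hhad, Gate.had_mul_had]
  | phase α q =>
    change (Matrix.diagonal _).conjTranspose * Matrix.diagonal _ = 1
    rw [Matrix.diagonal_conjTranspose, Matrix.diagonal_mul_diagonal, ← Matrix.diagonal_one]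
    congr 1
    ext x
    simp only [Pi.star_apply]
    split_ifs
    · rw [Complex.star_def, ← Complex.exp_conj, ← Complex.exp_add]
      simp
    · simp
  | swap a b h =>
    have h1 : (Gate.swap a b h).toMatrix.conjTranspose = (Gate.swap a b h).toMatrix := by
      ext y x
      change star (if x = y ∘ Equiv.swap a b then 1 else 0) =
        if y = x ∘ Equiv.swap a b then (1 : ℂ) else 0
      have : x = y ∘ Equiv.swap a b ↔ y = x ∘ Equiv.swap a b := by
        constructor <;> rintro rfl <;> simp [Function.comp_assoc, ← Equiv.coe_trans]
      simp only [this]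
      split_ifs <;> simp
    rw [h1]
    ext y x
    rw [Gate.swap_mul_apply, Matrix.one_apply]
    simp only [Gate.toMatrix]
    congr 1
    rw [eq_iff_iff]
    exact (Equiv.swap a b).surjective.injective_comp_right.eq_iff

theorem Circuit.conjTranspose_mul_self {n : ℕ} (C : Circuit n) :
    C.eval.conjTranspose * C.eval = 1 := by
  induction C with
  | nil => simp [Circuit.eval]
  | cons g C ih =>
    rw [Circuit.eval, Matrix.conjTranspose_mul, Matrix.mul_assoc, ← Matrix.mul_assoc _ _ g.toMatrix,
      ih, Matrix.one_mul, Gate.conjTranspose_mul_self]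

theorem EqUpToScalar.eqUpToPhase {n : ℕ} {A B : Circuit n} (h : EqUpToScalar A.eval B.eval) :
    EqUpToPhase A.eval B.eval := by
  obtain ⟨z, _, h⟩ := h
  have h1 := A.conjTranspose_mul_self
  rw [h, Matrix.conjTranspose_smul, Matrix.smul_mul, Matrix.mul_smul, smul_smul,
    B.conjTranspose_mul_self] at h1
  -- Any diagonal entry of the identity would do; the all-zero state exists for every number of
  -- qubits.
  have h2 := congrFun (congrFun h1 (fun _ => false)) (fun _ => false)
  simp only [Matrix.smul_apply, Matrix.one_apply_eq, smul_eq_mul, mul_one] at h2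
  have h3 : ‖z‖ = 1 := by
    have : Complex.normSq z = 1 := by
      have := Complex.normSq_eq_conj_mul_self (z := z)
      rw [← Complex.star_def, h2] at this
      exact_mod_cast this
    rw [Complex.normSq_eq_norm_sq] at this
    nlinarith [norm_nonneg z]
  obtain ⟨θ, hθ⟩ := (Complex.norm_eq_one_iff z).1 h3
  exact ⟨θ, by rw [hθ, h]⟩

/-! ### The diagram of a circuit -/

namespace Diagram

variable {m n : ℕ}

/-- The nontrivial branch is by definition `attach` with the fresh label, so everything is inherited
from there. Other wires that are plain stay plain, which a two-qubit gate needs. -/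
theorem plainOutput_spec {D : Diagram m n} (hD : D.WellFormed) (hF : D.HasFocusedGFlow)
    (q : Fin n) : (D.plainOutput q).WellFormed ∧ (D.plainOutput q).HasFocusedGFlow ∧
      EqUpToScalar (D.plainOutput q).eval D.eval ∧
      ∀ p, (p = q ∨ D.outputHad p = false) → (D.plainOutput q).outputHad p = false := by
  unfold plainOutput
  split_ifs with h
  · refine ⟨hD.attach q D.fresh_notMem, hF.attach hD q D.fresh_notMem,
      attach_eval hD q D.fresh_notMem, fun p hp => ?_⟩
    change Function.update D.outputHad q (!D.outputHad q) p = false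
    by_cases hpq : p = q
    · rw [hpq, Function.update_self, h]; rfl
    · rw [Function.update_of_ne hpq]; exact hp.resolve_left hpq
  · refine ⟨hD, hF, EqUpToScalar.refl _, ?_⟩
    rintro p (rfl | hp)
    · exact Bool.eq_false_of_not_eq_true h
    · exact hp

theorem applyHad_spec {D : Diagram m n} (hD : D.WellFormed) (hF : D.HasFocusedGFlow)
    (q : Fin n) : (D.applyHad q).WellFormed ∧ (D.applyHad q).HasFocusedGFlow ∧
      EqUpToScalar (D.applyHad q).eval ((Gate.had q).toMatrix * D.eval) :=
  ⟨hD.applyHad q, hF.congr rfl rfl (fun _ h => h) fun _ _ _ => Iff.rfl, D.eval_applyHad q⟩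

theorem applyPhase_spec {D : Diagram m n} (hD : D.WellFormed) (hF : D.HasFocusedGFlow)
    (α : ℝ) (q : Fin n) : (D.applyPhase α q).WellFormed ∧ (D.applyPhase α q).HasFocusedGFlow ∧
      EqUpToScalar (D.applyPhase α q).eval ((Gate.phase α q).toMatrix * D.eval) := by
  obtain ⟨h1, h2, h3, h4⟩ := plainOutput_spec hD hF q
  refine ⟨⟨h1.adj_mem, h1.input_mem, h1.output_mem, h1.input_inj, h1.output_inj⟩,
    h2.congr rfl rfl (fun _ h => h) fun _ _ _ => Iff.rfl, EqUpToScalar.trans ?_ (h3.mul_left _)⟩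
  exact eval_equiv_mul (EqUpToScalar.of_eq (contraction_addPhase (h4 q (Or.inl rfl)) α))

theorem applyCZ_spec {D : Diagram m n} (hD : D.WellFormed) (hF : D.HasFocusedGFlow)
    {a b : Fin n} (hab : a ≠ b) : (D.applyCZ a b).WellFormed ∧ (D.applyCZ a b).HasFocusedGFlow ∧
      EqUpToScalar (D.applyCZ a b).eval ((Gate.cz a b hab).toMatrix * D.eval) := by
  obtain ⟨h1, h2, h3, h4⟩ := plainOutput_spec hD hF a
  obtain ⟨i1, i2, i3, i4⟩ := plainOutput_spec h1 h2 b
  set E := (D.plainOutput a).plainOutput b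
  have hne : E.output a ≠ E.output b := fun e => hab (i1.output_inj e)
  have hG : (D.applyCZ a b).graph =
    symmDiff E.graph (SimpleGraph.edge (E.output a) (E.output b)) := rfl
  refine ⟨⟨?_, i1.input_mem, i1.output_mem, i1.input_inj, i1.output_inj⟩, ?_, ?_⟩
  · intro u v h
    change u ∈ E.verts
    rw [hG, symmDiff_adj, SimpleGraph.edge_adj] at h
    by_contra hu
    have h5 := i1.not_adj hu v
    have h6 : u ≠ E.output a := fun e => hu (e ▸ i1.output_mem a)
    have h7 : u ≠ E.output b := fun e => hu (e ▸ i1.output_mem b)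
    tauto
  · refine i2.congr rfl rfl (fun _ h => h) fun v hv w => ?_
    rw [hG, symmDiff_adj, SimpleGraph.edge_adj]
    have h5 := (mem_past.1 hv).2 a
    have h6 := (mem_past.1 hv).2 b
    have h7 : ¬ (v = E.output a) := fun e => h5 e.symm
    have h8 : ¬ (v = E.output b) := fun e => h6 e.symm
    tauto
  · refine EqUpToScalar.trans ?_ ((i3.trans h3).mul_left _)
    exact eval_equiv_mul (EqUpToScalar.of_eq (contraction_symmDiff_edge
      (i4 a (Or.inr (h4 a (Or.inl rfl)))) (i4 b (Or.inl rfl)) hab hne))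

theorem applyGate_spec {D : Diagram m n} (hD : D.WellFormed) (hF : D.HasFocusedGFlow)
    (g : Gate n) : (D.applyGate g).WellFormed ∧ (D.applyGate g).HasFocusedGFlow ∧
      EqUpToScalar (D.applyGate g).eval (g.toMatrix * D.eval) := by
  cases g with
  | cnot c t h =>
    obtain ⟨h1, h2, h3⟩ := applyHad_spec hD hF t
    obtain ⟨i1, i2, i3⟩ := applyCZ_spec h1 h2 h
    obtain ⟨j1, j2, j3⟩ := applyHad_spec i1 i2 t
    refine ⟨j1, j2, ?_⟩
    rw [Gate.cnot_eq, Matrix.mul_assoc, Matrix.mul_assoc]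
    exact j3.trans ((i3.trans (h3.mul_left _)).mul_left _)
  | cz a b h => exact applyCZ_spec hD hF h
  | had q => exact applyHad_spec hD hF q
  | phase α q => exact applyPhase_spec hD hF α q
  | swap a b h =>
    refine ⟨⟨hD.adj_mem, hD.input_mem, fun j => hD.output_mem _, hD.input_inj,
      hD.output_inj.comp (Equiv.injective _)⟩, ?_,
      eval_equiv_mul (EqUpToScalar.of_eq (contraction_swap D h))⟩
    refine hF.congr rfl ?_ (fun _ h => h) fun _ _ _ => Iff.rfl
    ext v
    rw [mem_past, mem_past]
    refine and_congr Iff.rfl ⟨fun h' p => ?_, fun h' p => h' _⟩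
    have := h' (Equiv.swap a b p)
    simpa [applyGate] using this

theorem foldl_applyGate {D : Diagram m n} (hD : D.WellFormed) (hF : D.HasFocusedGFlow)
    (C : Circuit n) : (C.foldl applyGate D).WellFormed ∧ (C.foldl applyGate D).HasFocusedGFlow ∧
      EqUpToScalar (C.foldl applyGate D).eval (C.eval * D.eval) := by
  induction C generalizing D with
  | nil => exact ⟨hD, hF, EqUpToScalar.of_eq (by simp [Circuit.eval])⟩
  | cons g C ih =>
    obtain ⟨h1, h2, h3⟩ := applyGate_spec hD hF g
    obtain ⟨i1, i2, i3⟩ := ih h1 h2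
    refine ⟨i1, i2, i3.trans ((h3.mul_left _).trans (EqUpToScalar.of_eq ?_))⟩
    rw [Circuit.eval, Matrix.mul_assoc]

/-- Bare wires have the shape of a finished extraction, so the formula for final states also
evaluates the starting point of the translation. -/
theorem wires_final (n : ℕ) : ExtractState.Final ⟨wires n, []⟩ := by
  refine ⟨⟨?_, ?_, ?_, ?_, ?_⟩, ⟨fun _ => rfl, fun _ => rfl, fun _ _ h => h⟩, ?_⟩
  · intro u v h
    exact absurd h (by simp [wires])
  · intro i
    simp [wires]
  · intro i
    simp [wires]
  · intro i j h
    exact Fin.ext h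
  · intro i j h
    exact Fin.ext h
  · rw [Finset.eq_empty_iff_forall_notMem]
    intro v hv
    rw [mem_past] at hv
    have h1 : v < n := by simpa [wires] using hv.1
    exact hv.2 ⟨v, h1⟩ rfl

theorem eval_wires (n : ℕ) : EqUpToScalar (wires n).eval 1 := by
  refine (wires n).eval_equiv_contraction.trans (EqUpToScalar.of_eq ?_)
  ext y x
  have h := (wires_final n).contraction_eq (σ := id) (fun _ => rfl) y x
  simp only at h
  rw [h, Matrix.one_apply]
  simp only [wires, wireEntry, Bool.false_eq_true, if_false, id]
  rw [Finset.prod_ite_zero]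
  simp only [Finset.mem_univ, true_imp_iff, Finset.prod_const_one]
  congr 1
  rw [eq_iff_iff, funext_iff]
  exact forall_congr' fun i => eq_comm

theorem extendOutput_spec {D : Diagram m n} (hD : D.WellFormed) (hF : D.HasFocusedGFlow)
    (q : Fin n) : (D.extendOutput q).WellFormed ∧ (D.extendOutput q).HasFocusedGFlow ∧
      EqUpToScalar (D.extendOutput q).eval D.eval ∧
      ∀ p, (p = q ∨ ∀ i, D.input i ≠ D.output p) →
        ∀ i, (D.extendOutput q).input i ≠ (D.extendOutput q).output p := by
  refine ⟨hD.attach q D.fresh_notMem, hF.attach hD q D.fresh_notMem,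
    attach_eval hD q D.fresh_notMem, fun p hp i => ?_⟩
  change D.input i ≠ Function.update D.output q D.fresh p
  by_cases hpq : p = q
  · rw [hpq, Function.update_self]
    intro e
    exact D.fresh_notMem (e ▸ hD.input_mem i)
  · rw [Function.update_of_ne hpq]
    exact hp.resolve_left hpq i

theorem separateOutput_spec {D : Diagram m n} (hD : D.WellFormed) (hF : D.HasFocusedGFlow)
    (q : Fin n) : (D.separateOutput q).WellFormed ∧ (D.separateOutput q).HasFocusedGFlow ∧
      EqUpToScalar (D.separateOutput q).eval D.eval ∧
      ∀ p, (p = q ∨ ∀ i, D.input i ≠ D.output p) →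
        ∀ i, (D.separateOutput q).input i ≠ (D.separateOutput q).output p := by
  unfold separateOutput
  obtain ⟨h1, h2, h3, h4⟩ := extendOutput_spec hD hF q
  split_ifs with h h'
  · exact ⟨h1, h2, h3, h4⟩
  · obtain ⟨i1, i2, i3, i4⟩ := extendOutput_spec h1 h2 q
    exact ⟨i1, i2, i3.trans h3, fun p hp => i4 p (Or.inr (h4 p hp))⟩
  · refine ⟨hD, hF, EqUpToScalar.refl _, ?_⟩
    rintro p (rfl | hp)
    · exact fun i e => h ⟨i, e⟩
    · exact hp

theorem foldl_separateOutput {D : Diagram m n} (hD : D.WellFormed) (hF : D.HasFocusedGFlow)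
    (L : List (Fin n)) : (L.foldl separateOutput D).WellFormed ∧
      (L.foldl separateOutput D).HasFocusedGFlow ∧
      EqUpToScalar (L.foldl separateOutput D).eval D.eval ∧
      ∀ p, (p ∈ L ∨ ∀ i, D.input i ≠ D.output p) →
        ∀ i, (L.foldl separateOutput D).input i ≠ (L.foldl separateOutput D).output p := by
  induction L generalizing D with
  | nil => exact ⟨hD, hF, EqUpToScalar.refl _, by simp⟩
  | cons q L ih =>
    obtain ⟨h1, h2, h3, h4⟩ := separateOutput_spec hD hF q
    obtain ⟨i1, i2, i3, i4⟩ := ih h1 h2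
    refine ⟨i1, i2, i3.trans h3, fun p hp => i4 p ?_⟩
    rw [List.mem_cons, or_assoc] at hp
    rcases hp with hp | hp | hp
    · exact Or.inr (h4 p (Or.inl hp))
    · exact Or.inl hp
    · exact Or.inr (h4 p (Or.inr hp))

/-- The gFlow is grown along the circuit. Bare wires have an empty past, and each gate alters only
the frontier or attaches new output spiders; the final separation of inputs from outputs again only
attaches spiders. -/
theorem ofCircuit_spec {n : ℕ} (C : Circuit n) :
    (ofCircuit C).IsGraphLike ∧ (ofCircuit C).HasFocusedGFlow ∧
      EqUpToScalar (ofCircuit C).eval C.eval := by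
  have hw := wires_final n
  obtain ⟨h1, h2, h3⟩ := foldl_applyGate hw.wf (hasFocusedGFlow_of_past_eq_empty hw.past_eq) C
  obtain ⟨i1, i2, i3, i4⟩ := foldl_separateOutput h1 h2 (List.finRange n)
  refine ⟨⟨i1, fun i j => i4 j (Or.inl (List.mem_finRange j)) i⟩, i2, (i3.trans h3).trans ?_⟩
  simpa using (eval_wires n).mul_left C.eval

/-! ### Simplification steps -/

theorem lcSimp_isInterior {D : Diagram m n} {u v : ℕ} :
    (D.lcSimp u).IsInterior v ↔ v ≠ u ∧ D.IsInterior v := by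
  change v ∈ D.verts.erase u ∧ _ ↔ _
  rw [Finset.mem_erase, and_assoc]
  rfl

theorem pivotSimp_isInterior {D : Diagram m n} {u v w : ℕ} :
    (D.pivotSimp u v).IsInterior w ↔ w ≠ v ∧ w ≠ u ∧ D.IsInterior w := by
  change w ∈ (D.verts.erase u).erase v ∧ _ ↔ _
  rw [Finset.mem_erase, Finset.mem_erase, and_assoc, and_assoc]
  rfl

theorem localComp_mem {V : Finset ℕ} {G : SimpleGraph ℕ} (h : ∀ x y, G.Adj x y → x ∈ V) (u : ℕ)
    (x y : ℕ) (hxy : (localComp G u).Adj x y) : x ∈ V := by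
  rw [localComp_adj hxy.ne] at hxy
  by_contra hx
  have h1 : ¬ G.Adj x y := fun h' => hx (h _ _ h')
  have h2 : ¬ G.Adj u x := fun h' => hx (h _ _ h'.symm)
  tauto

theorem IsGraphLike.lcSimp {D : Diagram m n} (hD : D.IsGraphLike) {u : ℕ} (hu : D.IsInterior u) :
    (D.lcSimp u).IsGraphLike := by
  refine ⟨⟨?_, ?_, ?_, hD.input_inj, hD.output_inj⟩, hD.disjoint⟩
  · intro x y h
    change ((localComp D.graph u).deleteIncidenceSet u).Adj x y at h
    rw [SimpleGraph.deleteIncidenceSet_adj] at h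
    exact Finset.mem_erase.2 ⟨h.2.1, localComp_mem hD.adj_mem u x y h.1⟩
  · exact fun i => Finset.mem_erase.2 ⟨hu.2.1 i, hD.input_mem i⟩
  · exact fun j => Finset.mem_erase.2 ⟨hu.2.2 j, hD.output_mem j⟩

theorem IsGraphLike.pivotSimp {D : Diagram m n} (hD : D.IsGraphLike) {u v : ℕ}
    (hu : D.IsInterior u) (hv : D.IsInterior v) : (D.pivotSimp u v).IsGraphLike := by
  refine ⟨⟨?_, ?_, ?_, hD.input_inj, hD.output_inj⟩, hD.disjoint⟩
  · intro x y h
    change (((pivot D.graph u v).deleteIncidenceSet u).deleteIncidenceSet v).Adj x y at h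
    rw [SimpleGraph.deleteIncidenceSet_adj, SimpleGraph.deleteIncidenceSet_adj] at h
    refine Finset.mem_erase.2 ⟨h.2.1, Finset.mem_erase.2 ⟨h.1.2.1, ?_⟩⟩
    exact localComp_mem (localComp_mem (localComp_mem hD.adj_mem u) v) u x y h.1.1
  · exact fun i => Finset.mem_erase.2 ⟨hv.2.1 i, Finset.mem_erase.2 ⟨hu.2.1 i, hD.input_mem i⟩⟩
  · exact fun j => Finset.mem_erase.2 ⟨hv.2.2 j, Finset.mem_erase.2 ⟨hu.2.2 j, hD.output_mem j⟩⟩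

theorem IsGraphLike.unfuseOutput {D : Diagram m n} (hD : D.IsGraphLike) (q : Fin n) :
    (D.unfuseOutput q).IsGraphLike := by
  have h := ((hD.toWellFormed.bareOutput q).applyHad q).attach q (w := D.fresh) D.fresh_notMem
  rw [← unfuseOutput_eq] at h
  refine ⟨h, fun i j => ?_⟩
  change D.input i ≠ Function.update D.output q D.fresh j
  by_cases hj : j = q
  · rw [hj, Function.update_self]
    intro e
    exact D.fresh_notMem (e ▸ hD.input_mem i)
  · rw [Function.update_of_ne hj]
    exact hD.disjoint i j

theorem IsGraphLike.reverse {D : Diagram m n} (hD : D.IsGraphLike) : D.reverse.IsGraphLike :=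
  ⟨hD.toWellFormed.reverse, fun i j e => hD.disjoint j i e.symm⟩

theorem IsGraphLike.unfuseInput {D : Diagram m n} (hD : D.IsGraphLike) (i : Fin m) :
    (D.unfuseInput i).IsGraphLike :=
  (hD.reverse.unfuseOutput i).reverse

theorem HasFocusedGFlow.unfuseOutput {D : Diagram m n} (hD : D.WellFormed) (q : Fin n)
    (hF : D.HasFocusedGFlow) : (D.unfuseOutput q).HasFocusedGFlow := by
  rw [unfuseOutput_eq]
  refine HasFocusedGFlow.attach ((hD.bareOutput q).applyHad q) q D.fresh_notMem ?_
  exact hF.congr rfl rfl (fun _ h => h) fun _ _ _ => Iff.rfl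

theorem HasFocusedGFlow.unfuseInput {D : Diagram m n} (hD : D.WellFormed) (i : Fin m)
    (hF : D.HasFocusedGFlow) : (D.unfuseInput i).HasFocusedGFlow := by
  rw [Diagram.unfuseInput, unfuseOutput_eq]
  refine HasFocusedGFlow.attachInput (D := ((D.reverse.bareOutput i).applyHad i).reverse)
    ((hD.reverse.bareOutput i).applyHad i).reverse i D.fresh_notMem ?_
  exact hF.congr rfl rfl (fun _ h => h) fun _ _ _ => Iff.rfl

theorem isInterior_reverse {D : Diagram m n} {v : ℕ} : D.reverse.IsInterior v ↔ D.IsInterior v :=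
  and_congr Iff.rfl and_comm

/-- The former output spider becomes interior because in a graph-like diagram it is attached to no
input. -/
theorem unfuseOutput_isInterior {D : Diagram m n} (hD : D.IsGraphLike) {q : Fin n} {v : ℕ} :
    (D.unfuseOutput q).IsInterior v ↔ v = D.output q ∨ D.IsInterior v := by
  have hne : ∀ j, D.output j ≠ D.fresh := fun j h => D.fresh_notMem (h ▸ hD.output_mem j)
  change v ∈ insert D.fresh D.verts ∧ (∀ i, D.input i ≠ v) ∧
    (∀ j, Function.update D.output q D.fresh j ≠ v) ↔ _
  rw [Finset.mem_insert]
  constructor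
  · rintro ⟨h1, h2, h3⟩
    have h4 : v ≠ D.fresh := by
      rintro rfl
      exact h3 q (by simp)
    by_cases hv : v = D.output q
    · exact Or.inl hv
    · refine Or.inr ⟨h1.resolve_left h4, h2, fun j => ?_⟩
      by_cases hj : j = q
      · rw [hj]; exact Ne.symm hv
      · have := h3 j
        rwa [Function.update_of_ne hj] at this
  · rintro (rfl | ⟨h1, h2, h3⟩)
    · refine ⟨Or.inr (hD.output_mem q), fun i => hD.disjoint i q, fun j => ?_⟩
      by_cases hj : j = q
      · rw [hj, Function.update_self]; exact (hne q).symm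
      · rw [Function.update_of_ne hj]
        exact fun e => hj (hD.output_inj e)
    · refine ⟨Or.inr h1, h2, fun j => ?_⟩
      by_cases hj : j = q
      · rw [hj, Function.update_self]
        rintro rfl
        exact D.fresh_notMem h1
      · rw [Function.update_of_ne hj]
        exact h3 j

theorem unfuseInput_isInterior {D : Diagram m n} (hD : D.IsGraphLike) {i : Fin m} {v : ℕ} :
    (D.unfuseInput i).IsInterior v ↔ v = D.input i ∨ D.IsInterior v := by
  rw [unfuseInput, isInterior_reverse, unfuseOutput_isInterior hD.reverse, isInterior_reverse]
  rfl

theorem interiorCount_lt {D E : Diagram m n} {u : ℕ} (hu : D.IsInterior u)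
    (h : ∀ v, E.IsInterior v → v ≠ u ∧ D.IsInterior v) : E.interiorCount < D.interiorCount := by
  classical
  unfold interiorCount
  refine Finset.card_lt_card ((Finset.ssubset_iff_of_subset ?_).2 ⟨u, ?_, ?_⟩)
  · intro v hv
    have := h v (Finset.mem_filter.1 hv).2
    exact Finset.mem_filter.2 ⟨this.2.1, this.2⟩
  · exact Finset.mem_filter.2 ⟨hu.1, hu⟩
  · intro h'
    exact (h u (Finset.mem_filter.1 h').2).1 rfl

end Diagram

/-! ### Invariants and termination of the simplification -/

namespace SimpState

open Diagram

variable {m n : ℕ}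

/-- The linear map of a state. -/
def eval (S : SimpState m n) : Matrix (Bits n) (Bits m) ℂ :=
  S.post.eval * (S.diagram.eval * S.pre.eval)

/-- What a simplification step preserves and decreases. -/
structure Improves (S T : SimpState m n) : Prop where
  graphLike : T.diagram.IsGraphLike
  flow : T.diagram.HasFocusedGFlow
  pre : (∀ g ∈ S.pre, g.IsSingleQubit) → ∀ g ∈ T.pre, g.IsSingleQubit
  post : (∀ g ∈ S.post, g.IsSingleQubit) → ∀ g ∈ T.post, g.IsSingleQubit
  eval : EqUpToScalar T.eval S.eval
  count : T.diagram.interiorCount < S.diagram.interiorCount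

theorem eval_congr {S : SimpState m n} {D : Diagram m n}
    (h : EqUpToScalar D.eval S.diagram.eval) :
    EqUpToScalar (SimpState.mk S.pre D S.post).eval S.eval :=
  (h.mul_right _).mul_left _

theorem unfuseOutput_eval {S : SimpState m n} (hD : S.diagram.WellFormed) (q : Fin n) :
    EqUpToScalar (S.unfuseOutput q).eval S.eval := by
  have h := eval_unfuseOutput hD q
  refine EqUpToScalar.trans (EqUpToScalar.of_eq ?_) ((h.symm.mul_right S.pre.eval).mul_left
    S.post.eval)
  change Circuit.eval (_ ++ S.post) * ((S.diagram.unfuseOutput q).eval * S.pre.eval) = _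
  rw [Circuit.eval_append]
  simp only [Matrix.mul_assoc]

theorem unfuseInput_eval {S : SimpState m n} (hD : S.diagram.WellFormed) (i : Fin m) :
    EqUpToScalar (S.unfuseInput i).eval S.eval := by
  have h := eval_unfuseInput hD i
  refine EqUpToScalar.trans (EqUpToScalar.of_eq ?_) ((h.symm.mul_right S.pre.eval).mul_left
    S.post.eval)
  change S.post.eval * ((S.diagram.unfuseInput i).eval * Circuit.eval (S.pre ++ _ ++ _)) = _
  rw [List.append_assoc, Circuit.eval_append]
  simp only [Matrix.mul_assoc]

/-- In the boundary cases the unfused spider `v` becomes interior with phase 0, hence Pauli, and an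
ordinary interior pivot applies. Unfusing creates one interior spider and the pivot removes two, so
the count still drops. -/
theorem Step.improves {S T : SimpState m n} (h : Step S T) (hD : S.diagram.IsGraphLike)
    (hF : S.diagram.HasFocusedGFlow) : Improves S T := by
  cases h with
  | lc u hu hc =>
    exact ⟨hD.lcSimp hu, hF.lcSimp hu, id, id, eval_congr (lcSimp_eval hu hc),
      interiorCount_lt hu fun v hv => lcSimp_isInterior.1 hv⟩
  | pivot u v hu hv pu pv huv =>
    exact ⟨hD.pivotSimp hu hv, hF.pivotSimp hu hv huv, id, id,
      eval_congr (pivotSimp_eval hu hv pu pv huv),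
      interiorCount_lt hu fun w hw => (pivotSimp_isInterior.1 hw).2⟩
  | pivotOutput u q hu pu huq =>
    set v := S.diagram.output q with hv
    have hfr : S.diagram.fresh ∉ S.diagram.verts := S.diagram.fresh_notMem
    have hu' : (S.unfuseOutput q).diagram.IsInterior u :=
      (unfuseOutput_isInterior hD).2 (Or.inr hu)
    have hv' : (S.unfuseOutput q).diagram.IsInterior v :=
      (unfuseOutput_isInterior hD).2 (Or.inl rfl)
    have huf : u ≠ S.diagram.fresh := fun e => hfr (e ▸ hu.1)
    have hvf : v ≠ S.diagram.fresh := fun e => hfr (e ▸ hD.output_mem q)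
    have pu' : (S.unfuseOutput q).diagram.IsPauli u := by
      obtain ⟨k, hk⟩ := pu
      refine ⟨k, ?_⟩
      change Function.update (Function.update S.diagram.phase v 0) S.diagram.fresh 0 u = _
      rw [Function.update_of_ne huf, Function.update_of_ne huq.ne, hk]
    have pv' : (S.unfuseOutput q).diagram.IsPauli v := by
      refine ⟨0, ?_⟩
      change Function.update (Function.update S.diagram.phase v 0) S.diagram.fresh 0 v = _
      rw [Function.update_of_ne hvf, Function.update_self]
      simp
    have huv' : (S.unfuseOutput q).diagram.graph.Adj u v := Or.inl huq
    refine ⟨(hD.unfuseOutput q).pivotSimp hu' hv',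
      HasFocusedGFlow.pivotSimp hu' hv' huv' (hF.unfuseOutput hD.toWellFormed q), id, ?_,
      (eval_congr (S := S.unfuseOutput q) (pivotSimp_eval hu' hv' pu' pv' huv')).trans
        (unfuseOutput_eval hD.toWellFormed q), interiorCount_lt hu fun w hw => ?_⟩
    · intro h g hg
      change g ∈ [Gate.had q, Gate.phase (S.diagram.phase (S.diagram.output q)) q] ++
        (if S.diagram.outputHad q then [Gate.had q] else []) ++ S.post at hg
      rw [List.mem_append, List.mem_append] at hg
      rcases hg with (hg | hg) | hg
      · simp only [List.mem_cons, List.not_mem_nil, or_false] at hg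
        rcases hg with rfl | rfl <;> trivial
      · split_ifs at hg
        · rw [List.mem_singleton] at hg
          rw [hg]; trivial
        · simp at hg
      · exact h g hg
    · obtain ⟨h1, h2, h3⟩ := pivotSimp_isInterior.1 hw
      exact ⟨h2, ((unfuseOutput_isInterior hD).1 h3).resolve_left h1⟩
  | pivotInput u i hu pu huq =>
    set v := S.diagram.input i with hv
    have hfr : S.diagram.fresh ∉ S.diagram.verts := S.diagram.fresh_notMem
    have hu' : (S.unfuseInput i).diagram.IsInterior u :=
      (unfuseInput_isInterior hD).2 (Or.inr hu)
    have hv' : (S.unfuseInput i).diagram.IsInterior v :=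
      (unfuseInput_isInterior hD).2 (Or.inl rfl)
    have huf : u ≠ S.diagram.fresh := fun e => hfr (e ▸ hu.1)
    have hvf : v ≠ S.diagram.fresh := fun e => hfr (e ▸ hD.input_mem i)
    have pu' : (S.unfuseInput i).diagram.IsPauli u := by
      obtain ⟨k, hk⟩ := pu
      refine ⟨k, ?_⟩
      change Function.update (Function.update S.diagram.phase v 0) S.diagram.fresh 0 u = _
      rw [Function.update_of_ne huf, Function.update_of_ne huq.ne, hk]
    have pv' : (S.unfuseInput i).diagram.IsPauli v := by
      refine ⟨0, ?_⟩
      change Function.update (Function.update S.diagram.phase v 0) S.diagram.fresh 0 v = _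
      rw [Function.update_of_ne hvf, Function.update_self]
      simp
    have huv' : (S.unfuseInput i).diagram.graph.Adj u v := Or.inl huq
    refine ⟨(hD.unfuseInput i).pivotSimp hu' hv',
      HasFocusedGFlow.pivotSimp hu' hv' huv' (hF.unfuseInput hD.toWellFormed i), ?_, id,
      (eval_congr (S := S.unfuseInput i) (pivotSimp_eval hu' hv' pu' pv' huv')).trans
        (unfuseInput_eval hD.toWellFormed i), interiorCount_lt hu fun w hw => ?_⟩
    · intro h g hg
      change g ∈ S.pre ++ (if S.diagram.inputHad i then [Gate.had i] else []) ++
        [Gate.phase (S.diagram.phase (S.diagram.input i)) i, Gate.had i] at hg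
      rw [List.mem_append, List.mem_append] at hg
      rcases hg with (hg | hg) | hg
      · exact h g hg
      · split_ifs at hg
        · rw [List.mem_singleton] at hg
          rw [hg]; trivial
        · simp at hg
      · simp only [List.mem_cons, List.not_mem_nil, or_false] at hg
        rcases hg with rfl | rfl <;> trivial
    · obtain ⟨h1, h2, h3⟩ := pivotSimp_isInterior.1 hw
      exact ⟨h2, ((unfuseInput_isInterior hD).1 h3).resolve_left h1⟩

theorem not_exists_step_iff {S : SimpState m n} :
    (¬ ∃ T, Step S T) ↔ S.diagram.IsSimplified := by
  constructor
  · intro h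
    refine ⟨fun u hu hc => h ⟨_, Step.lc S u hu hc⟩,
      fun u v hu hv pu pv huv => h ⟨_, Step.pivot S u v hu hv pu pv huv⟩, ?_⟩
    rintro u v hu pu (⟨i, rfl⟩ | ⟨q, rfl⟩) huv
    · exact h ⟨_, Step.pivotInput S u i hu pu huv⟩
    · exact h ⟨_, Step.pivotOutput S u q hu pu huv⟩
  · rintro hS ⟨T, hT⟩
    cases hT with
    | lc u hu hc => exact hS.no_properClifford u hu hc
    | pivot u v hu hv pu pv huv => exact hS.no_pauli_pair u v hu hv pu pv huv
    | pivotOutput u q hu pu huq => exact hS.no_pauli_boundary u _ hu pu (Or.inr ⟨q, rfl⟩) huq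
    | pivotInput u i hu pu hui => exact hS.no_pauli_boundary u _ hu pu (Or.inl ⟨i, rfl⟩) hui

theorem Reachable.spec {D : Diagram m n} (hD : D.IsGraphLike) (hF : D.HasFocusedGFlow)
    {S : SimpState m n} (h : Reachable D S) :
    S.diagram.IsGraphLike ∧ S.diagram.HasFocusedGFlow ∧ (∀ g ∈ S.pre, g.IsSingleQubit) ∧
      (∀ g ∈ S.post, g.IsSingleQubit) ∧ EqUpToScalar S.eval D.eval := by
  induction h with
  | refl =>
    exact ⟨hD, hF, by simp [init], by simp [init],
      EqUpToScalar.of_eq (by simp [init, eval, Circuit.eval])⟩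
  | tail _ hstep ih =>
    obtain ⟨h1, h2, h3, h4, h5⟩ := ih
    have := hstep.improves h1 h2
    exact ⟨this.graphLike, this.flow, this.pre h3, this.post h4, this.eval.trans h5⟩

/-- The number of interior spiders plus the number of steps taken never exceeds the initial count.
-/
theorem length_le_interiorCount {D : Diagram m n} (hD : D.IsGraphLike) (hF : D.HasFocusedGFlow)
    {k : ℕ} {S : ℕ → SimpState m n} (h0 : S 0 = init D)
    (hS : ∀ i < k, Step (S i) (S (i + 1))) : k ≤ D.interiorCount := by
  have key : ∀ i ≤ k, Reachable D (S i) ∧ (S i).diagram.interiorCount + i ≤ D.interiorCount := by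
    intro i
    induction i with
    | zero => intro _; rw [h0]; exact ⟨Relation.ReflTransGen.refl, le_rfl⟩
    | succ i ih =>
      intro hi
      obtain ⟨h1, h2⟩ := ih (by omega)
      have hstep := hS i (by omega)
      obtain ⟨h3, h4, _⟩ := h1.spec hD hF
      have := (hstep.improves h3 h4).count
      exact ⟨h1.tail hstep, by omega⟩
  have := (key k le_rfl).2
  omega

end SimpState

end ZX

end

/-! ### The main theorem -/

theorem mainTheorem3 :
    -- Row operations: adding row `src` to row `dst` extracts a CNOT and preserves gFlow.
    (∀ (m n : ℕ) (D : ZX.Diagram m n) (src dst : Fin n) (h : dst ≠ src),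
      D.WellFormed → D.Prepared → (∀ i, D.input i ≠ D.output src) →
        (D.addRow src dst).WellFormed ∧ (D.addRow src dst).Prepared ∧
        (D.addRow src dst).biadj =
          Matrix.updateRow D.biadj dst (D.biadj dst + D.biadj src) ∧
        ZX.EqUpToScalar D.eval
          ((ZX.Gate.cnot dst src h).toMatrix * (D.addRow src dst).eval) ∧
        (D.HasFocusedGFlow → (D.addRow src dst).HasFocusedGFlow)) ∧
    -- Initialisation of the frontier.
    (∀ (m n : ℕ) (S : ZX.ExtractState m n),
      S.diagram.WellFormed → S.diagram.HasFocusedGFlow →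
        S.prepare.diagram.WellFormed ∧ S.prepare.diagram.Prepared ∧
        S.prepare.diagram.HasFocusedGFlow ∧
        S.prepare.diagram.past = S.diagram.past ∧
        ZX.EqUpToScalar S.prepare.eval S.eval) ∧
    -- A round of Gaussian elimination always advances the frontier and preserves gFlow.
    (∀ (m n : ℕ) (S : ZX.ExtractState m n),
      S.diagram.WellFormed → S.diagram.Prepared → S.diagram.HasFocusedGFlow →
      S.diagram.past.Nonempty →
        S.updateFrontier.diagram.WellFormed ∧ S.updateFrontier.diagram.Prepared ∧
        S.updateFrontier.diagram.HasFocusedGFlow ∧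
        S.updateFrontier.diagram.past ⊂ S.diagram.past ∧
        ZX.EqUpToScalar S.updateFrontier.eval S.eval) ∧
    -- The extraction procedure succeeds on all graph-like diagrams with a focused gFlow.
    (∀ (n : ℕ) (D : ZX.Diagram n n), D.IsGraphLike → D.HasFocusedGFlow →
      ∃ C : ZX.Circuit n, ZX.extract D = some C ∧ ZX.EqUpToScalar C.eval D.eval) ∧
    -- Simplify and extract, for an arbitrary circuit.
    (∀ (n : ℕ) (C : ZX.Circuit n),
      (ZX.Diagram.ofCircuit C).IsGraphLike ∧ (ZX.Diagram.ofCircuit C).HasFocusedGFlow ∧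
      ZX.EqUpToScalar (ZX.Diagram.ofCircuit C).eval C.eval ∧
      -- the simplification terminates
      (∀ (k : ℕ) (S : ℕ → ZX.SimpState n n),
        S 0 = ZX.SimpState.init (ZX.Diagram.ofCircuit C) →
        (∀ i < k, ZX.SimpState.Step (S i) (S (i + 1))) →
          k ≤ (ZX.Diagram.ofCircuit C).interiorCount) ∧
      -- it ends exactly in simplified diagrams, and extraction gives back the circuit
      (∀ S : ZX.SimpState n n, ZX.SimpState.Reachable (ZX.Diagram.ofCircuit C) S →
        S.diagram.IsGraphLike ∧ S.diagram.HasFocusedGFlow ∧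
        (∀ g ∈ S.pre, g.IsSingleQubit) ∧ (∀ g ∈ S.post, g.IsSingleQubit) ∧
        ((¬ ∃ T, ZX.SimpState.Step S T) ↔ S.diagram.IsSimplified) ∧
        ∃ C' : ZX.Circuit n, ZX.extract S.diagram = some C' ∧
          ZX.EqUpToPhase (ZX.Circuit.eval (S.pre ++ C' ++ S.post)) C.eval)) := by
  refine ⟨?_, ?_, ?_, fun n D hD hF => ZX.extract_spec hD.toWellFormed hF, ?_⟩
  · intro m n D src dst h hD hP hI
    exact ⟨hD.addRow src dst, hP.addRow src dst, ZX.Diagram.biadj_addRow hD src dst,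
      ZX.Diagram.addRow_eval hD hP h hI, fun hF => hF.addRow hD h hI⟩
  · intro m n S hD hF
    obtain ⟨h1, h2, h3⟩ := ZX.ExtractState.prepare_spec hD
    exact ⟨h1.wf, h2, h1.flow hF, h3, h1.eval⟩
  · intro m n S hD hP hF hne
    obtain ⟨h1, h2, h3⟩ := ZX.ExtractState.updateFrontier_spec hD hP hF hne
    exact ⟨h1.wf, h2, h1.flow hF, h3, h1.eval⟩
  · intro n C
    obtain ⟨hD, hF, hev⟩ := ZX.Diagram.ofCircuit_spec C
    refine ⟨hD, hF, hev, fun k S h0 hS => ZX.SimpState.length_le_interiorCount hD hF h0 hS,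
      fun S hS => ?_⟩
    obtain ⟨h1, h2, h3, h4, h5⟩ := hS.spec hD hF
    obtain ⟨C', hC', hC'ev⟩ := ZX.extract_spec h1.toWellFormed h2
    refine ⟨h1, h2, h3, h4, ZX.SimpState.not_exists_step_iff, C', hC',
      -- The extracted circuit is substituted for the diagram between `pre` and `post`; the
      -- invariant of the simplification and the correctness of `ofCircuit` lead back to `C`.
      ZX.EqUpToScalar.eqUpToPhase (ZX.EqUpToScalar.trans ?_ (h5.trans hev))⟩
    rw [ZX.Circuit.eval_append, ZX.Circuit.eval_append]
    exact (hC'ev.mul_right _).mul_left _
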